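/- Let $\mathbb T=\mathbb R/\mathbb Z$ and let $M$ be either the closed annulus $\mathbb A=\mathbb T\times[0,1]$ or the torus $\mathbb T^2$, with coordinates $(\theta,r)$ and Lebesgue measure $\mu$. For $t\in\mathbb R$ put $R_t(\theta,r)=(\theta+t,r)$. Let $\mathrm{Diff}^\infty(M)$ be the group of $C^\infty$ diffeomorphisms of $M$ (smooth up to the boundary when $M=\mathbb A$). For $F,G\in\mathrm{Diff}^\infty(M)$ with lifts $\tilde F,\tilde G$ to $\mathbb R^2$ (respectively $\mathbb R\times[0,1]$), and with $\|u\|_0=\sup_{(0,1)^2}|u|$, put $$\tilde d_0(F,G)=\max_{i=1,2}\inf_{p}\|\tilde F_i-\tilde G_i+p\|_0,$$ where $p$ ranges over $\mathbb Z$, except that $p=0$ if $i=2$ and $M=\mathbb A$; let $\tilde d_k(F,G)$ be the maximum of $\tilde d_0(F,G)$ and of all $\|D_a(\tilde F_i-\tilde G_i)\|_0$ with $i=1,2$ and $1\le|a|\le k$, where $D_a=\partial^{|a|}/\partial r^{a_1}\partial\theta^{a_2}$; and put $$d_k(F,G)=\max\{\tilde d_k(F,G),\tilde d_k(F^{-1},G^{-1})\},\qquad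 d_\infty(F,G)=\sum_{k\ge1}\frac{d_k(F,G)}{2^k(1+d_k(F,G))}.$$ Convergence in $\mathrm{Diff}^\infty(M)$ means convergence for $d_k$ for every $k$. Let $\mathcal A_\alpha(M)$ be the closure in $\mathrm{Diff}^\infty(M)$ of the set of all $h\circ R_\alpha\circ h^{-1}$ with $h\in\mathrm{Diff}^\infty(M)$ preserving $\mu$. A $\mu$-preserving $f$ is weak mixing if every measurable $u:M\to\mathbb C$ with $u\circ f=\lambda u$ $\mu$-almost everywhere for some constant $\lambda\in\mathbb C$ is $\mu$-almost everywhere constant. Fix $0<\sigma<1$. For every Liouville number $\alpha$ and every $\varepsilon>0$ there exist rationals $\alpha_n=p_n/q_n$ (in lowest terms, $q_n\ge1$) with $\alpha_n\to\alpha$ and $|\alpha-\alpha_n|$ non-increasing, and $\mu$-preserving diffeomorphisms $\phi_n\in\mathrm{Diff}^\infty(M)$ with $R_{1/q_n}\circ\phi_n=\phi_n\circ R_{1/q_n}$, such that, with $$g_n(\theta,r)=(\theta+[nq_n^\sigma]\,r,\ r),\quad h_n=g_n\circ\phi_n,\quad H_n=h_1\circ\cdots\circ h_n,\quad f_n=H_n\circ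 R_{\alpha_{n+1}}\circ H_n^{-1}$$ ($[\cdot]$ denotes the integer part), the sequence $f_n$ converges in $\mathrm{Diff}^\infty(M)$ to a diffeomorphism $f$ which is weak mixing, belongs to $\mathcal A_\alpha(M)$, and satisfies $d_\infty(f,R_\alpha)<\varepsilon$. -/

import Mathlib

open MeasureTheory Set Filter Topology
open scoped ContDiff

namespace AbC

/-- The two surfaces under consideration: the closed annulus `𝔸 = ℝ/ℤ × [0,1]` and the torus
`𝕋² = ℝ/ℤ × ℝ/ℤ`. -/
inductive Surface : Type
  | annulus
  | torus

namespace Surface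

/-- The range of the second coordinate `r`: the interval `[0,1]` or the circle `ℝ/ℤ`. -/
def Fiber : Surface → Type
  | annulus => Set.Icc (0 : ℝ) 1
  | torus => UnitAddCircle

/-- Lebesgue measure on `[0,1]`, respectively on `ℝ/ℤ`. -/
noncomputable instance instMeasureSpaceFiber : (M : Surface) → MeasureSpace M.Fiber
  | annulus => inferInstanceAs (MeasureSpace (Set.Icc (0 : ℝ) 1))
  | torus => inferInstanceAs (MeasureSpace UnitAddCircle)

/-- The points `(θ, r)` of the surface. The area is `volume`, the product Lebesgue measure. -/
abbrev Pt (M : Surface) : Type := UnitAddCircle × M.Fiber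

/-- The universal cover of the surface inside `ℝ²`: the strip `ℝ × [0,1]`, respectively `ℝ²`. -/
def strip : Surface → Set (ℝ × ℝ)
  | annulus => univ ×ˢ Set.Icc (0 : ℝ) 1
  | torus => univ

/-- The covering map in the second coordinate; on the annulus only its values on `[0,1]`
matter. -/
noncomputable def coverFiber : (M : Surface) → ℝ → M.Fiber
  | annulus => Set.projIcc (0 : ℝ) 1 zero_le_one
  | torus => fun y => (y : UnitAddCircle)

/-- The covering map from `M.strip` to the surface. -/
noncomputable def proj (M : Surface) (z : ℝ × ℝ) : M.Pt :=
  ((z.1 : UnitAddCircle), M.coverFiber z.2)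

/-- The second coordinate modulo `1`. -/
noncomputable def fiberMod : (M : Surface) → M.Fiber → UnitAddCircle
  | annulus => fun r => (r.1 : UnitAddCircle)
  | torus => fun r => r

/-- Translations of the second coordinate by which two lifts of the same map may differ. -/
def deck : Surface → Set ℤ
  | annulus => {0}
  | torus => univ

/-- `F` is a smooth lift of the self-map `f` of the surface. (On the annulus: smooth on the closed
strip, including the boundary.) -/
structure IsSmoothLift (M : Surface) (F : ℝ × ℝ → ℝ × ℝ) (f : M.Pt → M.Pt) : Prop where
  mapsTo : MapsTo F M.strip M.strip
  contDiffOn : ContDiffOn ℝ ∞ F M.strip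
  proj_comp : ∀ z ∈ M.strip, M.proj (F z) = f (M.proj z)

end Surface

open Surface

/-- The `C^∞` diffeomorphisms of the surface: bijections that are smooth together with their
inverse. Smoothness is expressed through a lift to the universal cover. -/
structure Diff (M : Surface) where
  toEquiv : M.Pt ≃ M.Pt
  smooth_toFun : ∃ F, M.IsSmoothLift F toEquiv
  smooth_invFun : ∃ F, M.IsSmoothLift F toEquiv.symm

namespace Diff

variable {M : Surface}

instance : CoeFun (Diff M) (fun _ => M.Pt → M.Pt) := ⟨fun f => f.toEquiv⟩

theorem toEquiv_injective : Function.Injective (toEquiv : Diff M → (M.Pt ≃ M.Pt)) := by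
  rintro ⟨f, _, _⟩ ⟨g, _, _⟩ h
  cases h
  rfl

theorem isSmoothLift_id : M.IsSmoothLift id (id : M.Pt → M.Pt) :=
  ⟨fun _ h => h, contDiffOn_id, fun _ _ => rfl⟩

theorem isSmoothLift_comp {F G : ℝ × ℝ → ℝ × ℝ} {f g : M.Pt → M.Pt}
    (hF : M.IsSmoothLift F f) (hG : M.IsSmoothLift G g) :
    M.IsSmoothLift (F ∘ G) (f ∘ g) where
  mapsTo := hF.mapsTo.comp hG.mapsTo
  contDiffOn := hF.contDiffOn.comp hG.contDiffOn hG.mapsTo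
  proj_comp z hz := by
    simp only [Function.comp_apply]
    rw [hF.proj_comp _ (hG.mapsTo hz), hG.proj_comp _ hz]

theorem exists_lift_comp {f g : M.Pt → M.Pt} (hf : ∃ F, M.IsSmoothLift F f)
    (hg : ∃ G, M.IsSmoothLift G g) : ∃ F, M.IsSmoothLift F (f ∘ g) :=
  ⟨_, isSmoothLift_comp hf.choose_spec hg.choose_spec⟩

instance : One (Diff M) := ⟨⟨Equiv.refl _, ⟨id, isSmoothLift_id⟩, ⟨id, isSmoothLift_id⟩⟩⟩

/-- Multiplication is composition: `(f * g) x = f (g x)`. -/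
instance : Mul (Diff M) := ⟨fun f g =>
  ⟨g.toEquiv.trans f.toEquiv,
    (exists_lift_comp f.smooth_toFun g.smooth_toFun :),
    (exists_lift_comp g.smooth_invFun f.smooth_invFun :)⟩⟩

instance : Inv (Diff M) := ⟨fun f => ⟨f.toEquiv.symm, f.smooth_invFun, f.smooth_toFun⟩⟩

/-- The group of `C^∞` diffeomorphisms of the surface, under composition. -/
instance : Group (Diff M) where
  mul_assoc _ _ _ := toEquiv_injective (Equiv.ext fun _ => rfl)
  one_mul _ := toEquiv_injective (Equiv.ext fun _ => rfl)
  mul_one _ := toEquiv_injective (Equiv.ext fun _ => rfl)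
  inv_mul_cancel f := toEquiv_injective (Equiv.self_trans_symm f.toEquiv)

/-- `f` preserves the area of the surface. -/
def AreaPreserving (f : Diff M) : Prop := MeasurePreserving (f : M.Pt → M.Pt) volume volume

end Diff

/-! ### Rotations and integer shears -/

theorem isSmoothLift_affine (M : Surface) (k : ℤ) (t : ℝ) :
    M.IsSmoothLift (fun z => (z.1 + k * z.2 + t, z.2))
      (fun x => (x.1 + k • M.fiberMod x.2 + (t : UnitAddCircle), x.2)) where
  mapsTo := by
    cases M
    · rintro z ⟨-, hz⟩
      exact ⟨mem_univ _, hz⟩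
    · exact fun _ _ => mem_univ _
  contDiffOn := by fun_prop
  proj_comp := by
    have key (y : ℝ) : ((k * y : ℝ) : UnitAddCircle) = k • (y : UnitAddCircle) := by
      rw [← zsmul_eq_mul]
      rfl
    cases M
    · rintro z ⟨-, hz⟩
      simp only [proj, coverFiber, fiberMod, Set.projIcc_of_mem zero_le_one hz]
      refine Prod.ext ?_ rfl
      simp [key]
    · intro z _
      simp only [proj, coverFiber, fiberMod]
      refine Prod.ext ?_ rfl
      simp [key]

/-- The map `(θ, r) ↦ (θ + k r + t, r)` for an integer `k` and a real `t`. -/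
noncomputable def affineDiff (M : Surface) (k : ℤ) (t : ℝ) : Diff M where
  toEquiv :=
    { toFun := fun x => (x.1 + k • M.fiberMod x.2 + (t : UnitAddCircle), x.2)
      invFun := fun x => (x.1 + (-k) • M.fiberMod x.2 + ((-t : ℝ) : UnitAddCircle), x.2)
      left_inv := fun x => Prod.ext
        (by simp only [neg_smul, AddCircle.coe_neg]; abel) rfl
      right_inv := fun x => Prod.ext
        (by simp only [neg_smul, AddCircle.coe_neg]; abel) rfl }
  smooth_toFun := ⟨_, isSmoothLift_affine M k t⟩
  smooth_invFun := ⟨_, isSmoothLift_affine M (-k) (-t)⟩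

/-- The rotation `R_t (θ, r) = (θ + t, r)`. -/
noncomputable def rot (M : Surface) (t : ℝ) : Diff M := affineDiff M 0 t

/-- The shear `(θ, r) ↦ (θ + k r, r)`. -/
noncomputable def shear (M : Surface) (k : ℤ) : Diff M := affineDiff M k 0

/-! ### The `C^k` and `C^∞` distances -/

/-- The sup norm of a function over the open unit square. -/
noncomputable def supNorm (u : ℝ × ℝ → ℝ) : ℝ :=
  sSup ((fun z => |u z|) '' (Set.Ioo (0 : ℝ) 1 ×ˢ Set.Ioo (0 : ℝ) 1))

noncomputable def partialTheta (u : ℝ × ℝ → ℝ) : ℝ × ℝ → ℝ := fun z => fderiv ℝ u z (1, 0)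

noncomputable def partialR (u : ℝ × ℝ → ℝ) : ℝ × ℝ → ℝ := fun z => fderiv ℝ u z (0, 1)

/-- `D_a = ∂^{|a|} / ∂r^{a₁} ∂θ^{a₂}`. -/
noncomputable def partialD (a : ℕ × ℕ) (u : ℝ × ℝ → ℝ) : ℝ × ℝ → ℝ :=
  partialR^[a.1] (partialTheta^[a.2] u)

/-- The `C^0` distance of two lifts: the maximum over the two coordinates of the sup norm of the
difference, minimized over the integer translations of lifts. -/
noncomputable def liftDistZero (M : Surface) (F G : ℝ × ℝ → ℝ × ℝ) : ℝ :=
  max (⨅ p : ℤ, supNorm (fun z => (F z).1 - (G z).1 + p))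
    (⨅ p : M.deck, supNorm (fun z => (F z).2 - (G z).2 + (p : ℤ)))

/-- The `C^k` distance of two lifts: the maximum of the `C^0` distance and of the sup norms of the
partial derivatives of orders `1, …, k` of the coordinates of the difference. -/
noncomputable def liftDist (M : Surface) (k : ℕ) (F G : ℝ × ℝ → ℝ × ℝ) : ℝ :=
  sSup (insert (liftDistZero M F G)
    {s | ∃ a : ℕ × ℕ, 1 ≤ a.1 + a.2 ∧ a.1 + a.2 ≤ k ∧
      (s = supNorm (partialD a (fun z => (F z).1 - (G z).1)) ∨
        s = supNorm (partialD a (fun z => (F z).2 - (G z).2)))})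

namespace Diff

variable {M : Surface}

/-- A smooth lift of `f`; on `M.strip` it is unique up to an integer translation, which does not
affect the distances below. -/
noncomputable def lift (f : Diff M) : ℝ × ℝ → ℝ × ℝ := f.smooth_toFun.choose

/-- `d_k(f, g)`, which measures both the diffeomorphisms and their inverses. -/
noncomputable def distC (k : ℕ) (f g : Diff M) : ℝ :=
  max (liftDist M k f.lift g.lift) (liftDist M k f⁻¹.lift g⁻¹.lift)

/-- `d_∞(f, g) = ∑_{k ≥ 1} d_k(f, g) / (2^k (1 + d_k(f, g)))`. -/
noncomputable def distInfty (f g : Diff M) : ℝ :=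
  ∑' k : ℕ, distC (k + 1) f g / (2 ^ (k + 1) * (1 + distC (k + 1) f g))

/-- Convergence in `Diff^∞(M)`: convergence for every `d_k`. -/
def TendstoInfty (u : ℕ → Diff M) (f : Diff M) : Prop :=
  ∀ k : ℕ, Tendsto (fun n => distC k (u n) f) atTop (𝓝 0)

/-- `f` is weak mixing for the area: it preserves the area and every measurable complex
eigenfunction is almost everywhere constant. -/
def WeakMixing (f : Diff M) : Prop :=
  f.AreaPreserving ∧
    ∀ (u : M.Pt → ℂ) (c : ℂ), Measurable u →
      (∀ᵐ x ∂(volume : Measure M.Pt), u (f x) = c * u x) →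
      ∃ b : ℂ, ∀ᵐ x ∂(volume : Measure M.Pt), u x = b

end Diff

/-- `𝒜_α(M)`: the `C^∞` closure of the set of conjugates `h R_α h⁻¹` of the rotation by
area-preserving `C^∞` diffeomorphisms `h`. -/
def rotClosure (M : Surface) (α : ℝ) : Set (Diff M) :=
  {f | ∀ ε > 0, ∃ h : Diff M, h.AreaPreserving ∧ f.distInfty (h * rot M α * h⁻¹) < ε}

/-! ### The approximation by conjugations -/

/-- `g_n (θ, r) = (θ + [n q_n^σ] r, r)`, where `q_n` is the denominator of `a n = p_n / q_n` in
lowest terms. -/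
noncomputable def twist (M : Surface) (σ : ℝ) (a : ℕ → ℚ) (n : ℕ) : Diff M :=
  shear M ⌊(n : ℝ) * ((a n).den : ℝ) ^ σ⌋

/-- `H_n = h_1 ∘ ⋯ ∘ h_n` with `h_n = g_n ∘ φ_n`; `H_0` is the identity. -/
noncomputable def conjDiff (M : Surface) (σ : ℝ) (a : ℕ → ℚ) (φ : ℕ → Diff M) : ℕ → Diff M
  | 0 => 1
  | n + 1 => conjDiff M σ a φ n * (twist M σ a (n + 1) * φ (n + 1))

/-- `f_n = H_n ∘ R_{α_{n+1}} ∘ H_n⁻¹`. -/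
noncomputable def approx (M : Surface) (σ : ℝ) (a : ℕ → ℚ) (φ : ℕ → Diff M) (n : ℕ) : Diff M :=
  conjDiff M σ a φ n * rot M (a (n + 1) : ℝ) * (conjDiff M σ a φ n)⁻¹

end AbC

namespace AbC
open Surface

/-! ### Global lifts -/

/-! The proof is a fast version of approximation by conjugation. All maps are built once, as
diffeomorphisms of the plane that preserve the strip `ℝ × [0,1]` and are equivariant for all integer
translations up to a shear; the group `coverGroup` of such maps acts on both surfaces through
`desc`.

Convergence. The factor added at a step, shear times quasi-rotation, commutes with the rotation by
the new rational `a'` with denominator `q`. Conjugating the rotation by `a'` with the new `H`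
therefore gives the same map as with the old one (`conjRot_mul_of_commute`), and the conjugates of
the rotation by `α` change only by a multiple of `|α - a'|`. The multiple is polynomial in `q`
(`exists_closeTo_conjRot`), because the quasi-rotation is a fixed map rescaled horizontally by `q`
and the shear has slope at most `n * q`. A Liouville number admits `a'` for which this product is as
small as desired (`exists_liouville_approx`). The conjugates of the rotation by `α` thus converge,
together with their inverses and all derivatives, and their limit lies in the closure; the maps
`f_n` stay close to them and have the same limit.

Weak mixing. In every cell of width `1/q` the quasi-rotation is the identity on the left half and a
quarter turn on most of the right half. A rotation by half a cell therefore relates a point at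
height `t` to a point at height `s`, where `s` was the horizontal position inside the half cell. The
strong shear spreads each vertical fibre over the whole torus, so a continuous `w` composed with it
looks like a function `A` of the height alone with nearly the same mean as `w`. Integrating `‖A s -
ζ * A t‖ ^ 2` over independent `s` and `t` gives a lower bound that is positive when `w` is nearly
unimodular and its mean is off the unit circle (`exists_le_integral_twist`). Since the multiples of
`α` are dense modulo one, some iterate of the conjugated rotation is nearly this half-cell rotation,
so it moves `w` away from all its unimodular multiples (`exists_mixes`).

That property is open in the uniform topology. The `n`-th step secures it for the `n`-th member of a
sequence that approximates all unimodular functions in `L¹`, and all later steps are small enough to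
keep it. The limit then has no nonconstant unimodular eigenfunction (`unimodular_eigen_const`), and
arbitrary eigenfunctions reduce to unimodular ones (`torusEigenConst_of_unimodular`). The ergodic
arguments take place on the torus; the annulus differs from it by a null set. -/

/-- Smooth self-maps of the plane that preserve the strip `ℝ × [0,1]` and that are equivariant,
up to a shear, for the integer translations. -/
structure IsCover (u : ℝ × ℝ → ℝ × ℝ) : Prop where
  contDiff : ContDiff ℝ ∞ u
  strip : ∀ z : ℝ × ℝ, z.2 ∈ Icc (0 : ℝ) 1 → (u z).2 ∈ Icc (0 : ℝ) 1
  equivariant : ∃ B : ℤ, ∀ (z : ℝ × ℝ) (m n : ℤ),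
    u (z + ((m : ℝ), (n : ℝ))) = u z + ((m : ℝ) + B * n, (n : ℝ))

theorem IsCover.comp {u v : ℝ × ℝ → ℝ × ℝ} (hu : IsCover u) (hv : IsCover v) :
    IsCover (u ∘ v) where
  contDiff := hu.contDiff.comp hv.contDiff
  strip z hz := hu.strip _ (hv.strip z hz)
  equivariant := by
    obtain ⟨B, hB⟩ := hu.equivariant
    obtain ⟨C, hC⟩ := hv.equivariant
    refine ⟨C + B, fun z m n => ?_⟩
    have h := hB (v z) (m + C * n) n
    push_cast at h
    simp only [Function.comp_apply, hC, h]
    ext <;> simp; ring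

theorem isCover_id : IsCover id where
  contDiff := contDiff_id
  strip _ h := h
  equivariant := ⟨0, fun z m n => by simp⟩

/-- The group of global lifts. -/
def coverGroup : Subgroup (Equiv.Perm (ℝ × ℝ)) where
  carrier := {H | IsCover H ∧ IsCover H.symm}
  mul_mem' ha hb := ⟨ha.1.comp hb.1, hb.2.comp ha.2⟩
  one_mem' := ⟨isCover_id, isCover_id⟩
  inv_mem' ha := ⟨ha.2, ha.1⟩

/-! ### Descent of plane maps to the surfaces. -/

theorem coe_int_unitAddCircle (m : ℤ) : ((m : ℝ) : UnitAddCircle) = 0 := by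
  rw [AddCircle.coe_eq_zero_iff]
  exact ⟨m, by simp⟩

theorem exists_int_of_coe_eq {x y : ℝ} (h : (x : UnitAddCircle) = y) :
    ∃ m : ℤ, x = y + m := by
  have h' : ((x - y : ℝ) : UnitAddCircle) = 0 := by
    rw [AddCircle.coe_sub, h, sub_self]
  rw [AddCircle.coe_eq_zero_iff] at h'
  obtain ⟨n, hn⟩ := h'
  refine ⟨n, ?_⟩
  simp at hn
  linarith

theorem mem_strip_of_mem_Icc (M : Surface) {z : ℝ × ℝ} (hz : z.2 ∈ Icc (0 : ℝ) 1) :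
    z ∈ M.strip := by
  cases M
  · exact ⟨mem_univ _, hz⟩
  · exact mem_univ _

/-- A point of the plane above a point of the surface. -/
theorem exists_proj_eq (M : Surface) (x : M.Pt) : ∃ z ∈ M.strip, M.proj z = x := by
  obtain ⟨θ, r⟩ := x
  obtain ⟨t, rfl⟩ := QuotientAddGroup.mk_surjective θ
  cases M
  · refine ⟨(t, r.1), ⟨mem_univ _, r.2⟩, ?_⟩
    exact Prod.ext rfl (projIcc_of_mem zero_le_one r.2)
  · obtain ⟨s, hs⟩ := QuotientAddGroup.mk_surjective r
    exact ⟨(t, s), mem_univ _, Prod.ext rfl hs⟩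

theorem IsCover.mapsTo_strip {u : ℝ × ℝ → ℝ × ℝ} (hu : IsCover u) (M : Surface) :
    MapsTo u M.strip M.strip := by
  cases M
  · exact fun z hz => ⟨mem_univ _, hu.strip z hz.2⟩
  · exact fun _ _ => mem_univ _

/-- Points of the strip with the same projection differ by a deck translation. -/
theorem exists_deck_of_proj_eq (M : Surface) {z w : ℝ × ℝ} (hz : z ∈ M.strip)
    (hw : w ∈ M.strip) (h : M.proj z = M.proj w) :
    ∃ m : ℤ, ∃ n ∈ M.deck, z = w + ((m : ℝ), (n : ℝ)) := by
  obtain ⟨m, hm⟩ := exists_int_of_coe_eq (congrArg Prod.fst h)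
  have h2 := congrArg Prod.snd h
  cases M
  · refine ⟨m, 0, rfl, Prod.ext hm ?_⟩
    have h3 : projIcc (0 : ℝ) 1 zero_le_one z.2 = projIcc (0 : ℝ) 1 zero_le_one w.2 := h2
    rw [projIcc_of_mem zero_le_one hz.2, projIcc_of_mem zero_le_one hw.2] at h3
    simpa using congrArg Subtype.val h3
  · obtain ⟨n, hn⟩ := exists_int_of_coe_eq (show ((z.2 : ℝ) : UnitAddCircle) = w.2 from h2)
    exact ⟨m, n, mem_univ _, Prod.ext hm hn⟩

theorem proj_add_deck (M : Surface) (z : ℝ × ℝ) (m : ℤ) {n : ℤ} (hn : n ∈ M.deck) :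
    M.proj (z + ((m : ℝ), (n : ℝ))) = M.proj z := by
  refine Prod.ext ?_ ?_
  · simp [proj]
  · cases M
    · have : n = 0 := hn
      simp [proj, this]
    · change ((z.2 + (n : ℝ) : ℝ) : UnitAddCircle) = z.2
      rw [AddCircle.coe_add, coe_int_unitAddCircle, add_zero]

theorem IsCover.proj_eq {u : ℝ × ℝ → ℝ × ℝ} (hu : IsCover u) (M : Surface) {z w : ℝ × ℝ}
    (hz : z ∈ M.strip) (hw : w ∈ M.strip) (h : M.proj z = M.proj w) :
    M.proj (u z) = M.proj (u w) := by
  obtain ⟨m, n, hn, rfl⟩ := exists_deck_of_proj_eq M hz hw h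
  obtain ⟨B, hB⟩ := hu.equivariant
  have := proj_add_deck M (u w) (m + B * n) hn
  push_cast at this
  rw [hB, this]

/-- The self-map of the surface induced by a self-map of the plane. -/
noncomputable def descFun (M : Surface) (u : ℝ × ℝ → ℝ × ℝ) (x : M.Pt) : M.Pt :=
  M.proj (u (exists_proj_eq M x).choose)

theorem IsCover.isSmoothLift {u : ℝ × ℝ → ℝ × ℝ} (hu : IsCover u) (M : Surface) :
    M.IsSmoothLift u (descFun M u) where
  mapsTo := hu.mapsTo_strip M
  contDiffOn := hu.contDiff.contDiffOn
  proj_comp z hz := by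
    have h := (exists_proj_eq M (M.proj z)).choose_spec
    exact hu.proj_eq M hz h.1 h.2.symm

theorem descFun_proj {u : ℝ × ℝ → ℝ × ℝ} (hu : IsCover u) (M : Surface) {z : ℝ × ℝ}
    (hz : z ∈ M.strip) : descFun M u (M.proj z) = M.proj (u z) :=
  ((hu.isSmoothLift M).proj_comp z hz).symm

theorem descFun_comp {u v : ℝ × ℝ → ℝ × ℝ} (hu : IsCover u) (hv : IsCover v) (M : Surface)
    (x : M.Pt) : descFun M (u ∘ v) x = descFun M u (descFun M v x) := by
  obtain ⟨z, hz, rfl⟩ := exists_proj_eq M x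
  rw [descFun_proj (hu.comp hv) M hz, descFun_proj hv M hz,
    descFun_proj hu M (hv.mapsTo_strip M hz), Function.comp_apply]

theorem descFun_id (M : Surface) (x : M.Pt) : descFun M id x = x := by
  obtain ⟨z, hz, rfl⟩ := exists_proj_eq M x
  rw [descFun_proj isCover_id M hz, id]

/-- The diffeomorphism of the surface induced by a global lift. -/
noncomputable def desc (M : Surface) : coverGroup →* Diff M where
  toFun H :=
    { toEquiv :=
        { toFun := descFun M H.1
          invFun := descFun M H.1.symm
          left_inv := fun x => by
            rw [← descFun_comp H.2.2 H.2.1]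
            simpa using descFun_id M x
          right_inv := fun x => by
            rw [← descFun_comp H.2.1 H.2.2]
            simpa using descFun_id M x }
      smooth_toFun := ⟨_, H.2.1.isSmoothLift M⟩
      smooth_invFun := ⟨_, H.2.2.isSmoothLift M⟩ }
  map_one' := Diff.toEquiv_injective (Equiv.ext fun x => descFun_id M x)
  map_mul' H K := Diff.toEquiv_injective (Equiv.ext fun x => descFun_comp H.2.1 K.2.1 M x)

theorem desc_apply_proj (M : Surface) (H : coverGroup) {z : ℝ × ℝ} (hz : z ∈ M.strip) :
    desc M H (M.proj z) = M.proj (H.1 z) :=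
  descFun_proj H.2.1 M hz

theorem desc_isSmoothLift (M : Surface) (H : coverGroup) : M.IsSmoothLift H.1 (desc M H) :=
  H.2.1.isSmoothLift M

/-! ### Shears, rotations and conjugates of rotations. -/

/-- Shears composed with horizontal translations, as maps of the plane. -/
def affinePerm (k : ℤ) (t : ℝ) : Equiv.Perm (ℝ × ℝ) where
  toFun z := (z.1 + k * z.2 + t, z.2)
  invFun z := (z.1 + (-k : ℤ) * z.2 + (-t), z.2)
  left_inv z := by ext <;> simp; ring
  right_inv z := by ext <;> simp; ring

theorem isCover_affine (k : ℤ) (t : ℝ) :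
    IsCover (fun z : ℝ × ℝ => (z.1 + k * z.2 + t, z.2)) where
  contDiff := by fun_prop
  strip _ h := h
  equivariant := ⟨k, fun z m n => by ext <;> simp; ring⟩

/-- Shears composed with horizontal translations, as global lifts. -/
def affineCover (k : ℤ) (t : ℝ) : coverGroup :=
  ⟨affinePerm k t, isCover_affine k t, isCover_affine (-k) (-t)⟩

theorem affineCover_apply (k : ℤ) (t : ℝ) (z : ℝ × ℝ) :
    (affineCover k t).1 z = (z.1 + k * z.2 + t, z.2) := rfl

theorem desc_affineCover (M : Surface) (k : ℤ) (t : ℝ) :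
    desc M (affineCover k t) = affineDiff M k t := by
  refine Diff.toEquiv_injective (Equiv.ext fun x => ?_)
  obtain ⟨z, hz, rfl⟩ := exists_proj_eq M x
  exact (desc_apply_proj M _ hz).trans ((isSmoothLift_affine M k t).proj_comp z hz)

/-- The horizontal translation by `t`. -/
def rotCover (t : ℝ) : coverGroup := affineCover 0 t

theorem rotCover_apply (t : ℝ) (z : ℝ × ℝ) : (rotCover t).1 z = (z.1 + t, z.2) := by
  simp [rotCover, affineCover_apply]

theorem desc_rotCover (M : Surface) (t : ℝ) : desc M (rotCover t) = rot M t :=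
  desc_affineCover M 0 t

theorem coverGroup_ext {H K : coverGroup} (h : ∀ z, H.1 z = K.1 z) : H = K :=
  Subtype.ext (Equiv.ext h)

theorem rotCover_add (s t : ℝ) : rotCover (s + t) = rotCover s * rotCover t :=
  coverGroup_ext fun z => by
    rw [Subgroup.coe_mul, Equiv.Perm.mul_apply, rotCover_apply, rotCover_apply, rotCover_apply]
    ext <;> simp; ring

theorem rotCover_zero : rotCover 0 = 1 :=
  coverGroup_ext fun z => by rw [rotCover_apply]; simp

theorem rotCover_inv (t : ℝ) : (rotCover t)⁻¹ = rotCover (-t) :=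
  inv_eq_of_mul_eq_one_right (by rw [← rotCover_add, add_neg_cancel, rotCover_zero])

theorem affineCover_commute_rot (k : ℤ) (s t : ℝ) :
    rotCover s * affineCover k t = affineCover k t * rotCover s :=
  coverGroup_ext fun z => by
    rw [Subgroup.coe_mul, Equiv.Perm.mul_apply, Subgroup.coe_mul, Equiv.Perm.mul_apply,
      rotCover_apply, rotCover_apply, affineCover_apply, affineCover_apply]
    ext <;> simp; ring

/-- The conjugate of a rotation. -/
def conjRot (H : coverGroup) (t : ℝ) : coverGroup := H * rotCover t * H⁻¹

theorem conjRot_inv (H : coverGroup) (t : ℝ) : (conjRot H t)⁻¹ = conjRot H (-t) := by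
  simp only [conjRot, mul_inv_rev, inv_inv, rotCover_inv, mul_assoc]

theorem conjRot_apply (H : coverGroup) (t : ℝ) (z : ℝ × ℝ) :
    (conjRot H t).1 z = H.1 (H.1.symm z + (t, 0)) := by
  rw [conjRot, Subgroup.coe_mul, Equiv.Perm.mul_apply, Subgroup.coe_mul, Equiv.Perm.mul_apply,
    rotCover_apply]
  congr 1
  ext <;> simp

/-- The cancellation behind convergence: a factor commuting with a rational rotation is invisible in
the conjugate of that rotation, however wild its derivatives are. -/
theorem conjRot_mul_of_commute {H h : coverGroup} {t : ℝ}
    (hc : rotCover t * h = h * rotCover t) : conjRot (H * h) t = conjRot H t := by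
  simp only [conjRot]
  rw [mul_assoc H h, ← hc]
  group

/-- The shear constants of `H` and of its inverse cancel. Exact equivariance with no shear is a
condition that survives pointwise limits. -/
theorem conjRot_equivariant (H : coverGroup) (t : ℝ) (z : ℝ × ℝ) (m n : ℤ) :
    (conjRot H t).1 (z + ((m : ℝ), (n : ℝ))) = (conjRot H t).1 z + ((m : ℝ), (n : ℝ)) := by
  obtain ⟨B, hB⟩ := H.2.1.equivariant
  have key : H.1.symm (z + ((m : ℝ), (n : ℝ)))
      = H.1.symm z + (((m - B * n : ℤ) : ℝ), (n : ℝ)) := by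
    rw [Equiv.symm_apply_eq, hB, Equiv.apply_symm_apply]
    ext <;> simp
  rw [conjRot_apply, conjRot_apply, key, add_right_comm, hB]
  ext <;> simp

theorem conjRot_pow (H : coverGroup) (t : ℝ) (m : ℕ) : conjRot H t ^ m = conjRot H (m * t) := by
  induction m with
  | zero => simp [conjRot, rotCover_zero]
  | succ k ih =>
    rw [pow_succ, ih, conjRot, conjRot, conjRot, Nat.cast_succ, add_mul, one_mul, rotCover_add]
    group

/-! ### Bounds on the derivatives -/

theorem exists_bound_of_periodic {u : ℝ × ℝ → ℝ} (hu : Continuous u)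
    (hp : ∀ (z : ℝ × ℝ) (m n : ℤ), u (z + ((m : ℝ), (n : ℝ))) = u z) : ∃ C, ∀ z, u z ≤ C := by
  have hK : IsCompact (Icc (0 : ℝ) 1 ×ˢ Icc (0 : ℝ) 1) := isCompact_Icc.prod isCompact_Icc
  obtain ⟨C, hC⟩ := hK.bddAbove_image hu.continuousOn
  refine ⟨C, fun z => ?_⟩
  have h := hp (Int.fract z.1, Int.fract z.2) ⌊z.1⌋ ⌊z.2⌋
  have h' : ((Int.fract z.1, Int.fract z.2) : ℝ × ℝ) + ((⌊z.1⌋ : ℝ), (⌊z.2⌋ : ℝ)) = z := by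
    ext <;> simp
  rw [h'] at h
  rw [h]
  refine hC (mem_image_of_mem _ ⟨⟨Int.fract_nonneg _, (Int.fract_lt_one _).le⟩,
    ⟨Int.fract_nonneg _, (Int.fract_lt_one _).le⟩⟩)

theorem iteratedFDeriv_add_const_eq {E F : Type*} [NormedAddCommGroup E] [NormedSpace ℝ E]
    [NormedAddCommGroup F] [NormedSpace ℝ F] {i : ℕ} (hi : 1 ≤ i) {u : E → F} (hu : ContDiff ℝ ∞ u)
    (c : F) (z : E) :
    iteratedFDeriv ℝ i (fun w => u w + c) z = iteratedFDeriv ℝ i u z := by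
  have h : (fun w => u w + c) = u + fun _ => c := rfl
  rw [h, iteratedFDeriv_add_apply (hu.contDiffAt.of_le (by exact_mod_cast le_top))
    contDiffAt_const]
  rw [iteratedFDeriv_const_of_ne (by omega)]
  simp

/-- An integer translation changes `u` by an additive constant only, so its derivatives of positive
order are doubly periodic. This is why equivariance is demanded in the vertical direction even for
the annulus. -/
theorem IsCover.exists_bound {u : ℝ × ℝ → ℝ × ℝ} (hu : IsCover u) {i : ℕ} (hi : 1 ≤ i) :
    ∃ C, ∀ z, ‖iteratedFDeriv ℝ i u z‖ ≤ C := by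
  refine exists_bound_of_periodic
    (hu.contDiff.continuous_iteratedFDeriv (m := i) (by exact_mod_cast le_top)).norm
    fun z m n => ?_
  obtain ⟨B, hB⟩ := hu.equivariant
  rw [← iteratedFDeriv_comp_add_right]
  simp only [hB]
  rw [iteratedFDeriv_add_const_eq hi hu.contDiff]

/-- Families of smooth maps whose derivatives of positive order are bounded polynomially in the
parameter. -/
def PolyBounded (u : ℕ → ℝ × ℝ → ℝ × ℝ) : Prop :=
  (∀ q, 1 ≤ q → ContDiff ℝ ∞ (u q)) ∧
    ∀ k : ℕ, ∃ C : ℝ, ∃ N : ℕ, 1 ≤ C ∧ ∀ q : ℕ, 1 ≤ q → ∀ i, 1 ≤ i → i ≤ k →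
      ∀ z, ‖iteratedFDeriv ℝ i (u q) z‖ ≤ C * q ^ N

theorem polyBounded_of_forall {u : ℕ → ℝ × ℝ → ℝ × ℝ} (hu : ∀ q, 1 ≤ q → ContDiff ℝ ∞ (u q))
    (h : ∀ i : ℕ, 1 ≤ i → ∃ C : ℝ, ∃ N : ℕ, ∀ q : ℕ, 1 ≤ q →
      ∀ z, ‖iteratedFDeriv ℝ i (u q) z‖ ≤ C * q ^ N) : PolyBounded u := by
  refine ⟨hu, fun k => ?_⟩
  induction k with
  | zero => exact ⟨1, 0, le_rfl, fun q hq i h1 h2 => by omega⟩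
  | succ k ih =>
    obtain ⟨C, N, hC, hN⟩ := ih
    obtain ⟨C', N', hN'⟩ := h (k + 1) (by omega)
    refine ⟨max C C', N + N', le_max_of_le_left hC, fun q hq i h1 h2 z => ?_⟩
    have hq1 : (1 : ℝ) ≤ q := by exact_mod_cast hq
    have e1 : (q : ℝ) ^ N ≤ q ^ (N + N') := pow_le_pow_right₀ hq1 (by omega)
    have e2 : (q : ℝ) ^ N' ≤ q ^ (N + N') := pow_le_pow_right₀ hq1 (by omega)
    have hm : 0 ≤ max C C' := by linarith [le_max_left C C']
    rcases Nat.lt_or_ge k i with h3 | h3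
    · obtain rfl : i = k + 1 := by omega
      refine (hN' q hq z).trans ((mul_le_mul_of_nonneg_right (le_max_right C C')
        (by positivity)).trans (mul_le_mul_of_nonneg_left e2 hm))
    · refine (hN q hq i h1 h3 z).trans ((mul_le_mul_of_nonneg_right (le_max_left C C')
        (by positivity)).trans (mul_le_mul_of_nonneg_left e1 hm))

theorem IsCover.polyBounded {u : ℝ × ℝ → ℝ × ℝ} (hu : IsCover u) : PolyBounded fun _ => u := by
  refine polyBounded_of_forall (fun _ _ => hu.contDiff) fun i hi => ?_
  obtain ⟨C, hC⟩ := hu.exists_bound hi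
  exact ⟨C, 0, fun q _ z => by simpa using hC z⟩

theorem norm_iteratedFDeriv_clm_le {E F : Type*} [NormedAddCommGroup E] [NormedSpace ℝ E]
    [NormedAddCommGroup F] [NormedSpace ℝ F] (L : E →L[ℝ] F) {i : ℕ} (hi : 1 ≤ i) (z : E) :
    ‖iteratedFDeriv ℝ i L z‖ ≤ ‖L‖ := by
  obtain ⟨j, rfl⟩ : ∃ j, i = j + 1 := ⟨i - 1, by omega⟩
  rw [← norm_iteratedFDeriv_fderiv]
  have : fderiv ℝ (L : E → F) = fun _ => L := by
    ext1 z; exact L.fderiv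
  rw [this]
  rcases Nat.eq_zero_or_pos j with rfl | hj
  · simp
  · rw [iteratedFDeriv_const_of_ne (by omega)]
    simp

theorem polyBounded_clm {L : ℕ → (ℝ × ℝ →L[ℝ] ℝ × ℝ)} {C : ℝ} {N : ℕ}
    (h : ∀ q : ℕ, 1 ≤ q → ‖L q‖ ≤ C * q ^ N) : PolyBounded fun q => L q :=
  polyBounded_of_forall (fun q _ => (L q).contDiff) fun _ hi =>
    ⟨C, N, fun q hq z => (norm_iteratedFDeriv_clm_le (L q) hi z).trans (h q hq)⟩

/-- The bound for the derivatives of a composition; for `1 ≤ i` the value of the outer function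
itself does not enter. -/
theorem norm_iteratedFDeriv_comp_le_of_pos {u v : ℝ × ℝ → ℝ × ℝ} (hu : ContDiff ℝ ∞ u)
    (hv : ContDiff ℝ ∞ v) {i : ℕ} (hi : 1 ≤ i) {C D : ℝ} (hD1 : 1 ≤ D) (hC0 : 0 ≤ C) (z : ℝ × ℝ)
    (hC : ∀ j, 1 ≤ j → j ≤ i → ‖iteratedFDeriv ℝ j u (v z)‖ ≤ C)
    (hD : ∀ j, 1 ≤ j → j ≤ i → ‖iteratedFDeriv ℝ j v z‖ ≤ D) :
    ‖iteratedFDeriv ℝ i (u ∘ v) z‖ ≤ i.factorial * C * D ^ i := by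
  -- The general composition estimate also asks for a bound at order zero; subtracting the value at
  -- the point makes that term vanish and leaves the derivatives unchanged.
  set g : ℝ × ℝ → ℝ × ℝ := fun w => u w + (-u (v z)) with hg
  have hgs : ContDiff ℝ ∞ g := hu.add contDiff_const
  have e : iteratedFDeriv ℝ i (u ∘ v) z = iteratedFDeriv ℝ i (g ∘ v) z :=
    (iteratedFDeriv_add_const_eq hi (hu.comp hv) (-u (v z)) z).symm
  rw [e]
  refine norm_iteratedFDeriv_comp_le (N := ∞) hgs hv
    (by exact_mod_cast le_top) z ?_ ?_
  · intro j hj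
    rcases Nat.eq_zero_or_pos j with rfl | hj0
    · simpa [hg] using hC0
    · rw [hg, iteratedFDeriv_add_const_eq hj0 hu]
      exact hC j hj0 hj
  · intro j h1 h2
    exact (hD j h1 h2).trans (le_self_pow₀ hD1 (by omega))

theorem PolyBounded.comp {u v : ℕ → ℝ × ℝ → ℝ × ℝ} (hu : PolyBounded u) (hv : PolyBounded v) :
    PolyBounded fun q => u q ∘ v q := by
  refine polyBounded_of_forall (fun q hq => (hu.1 q hq).comp (hv.1 q hq)) fun i hi => ?_
  obtain ⟨C, N, hC, hN⟩ := hu.2 i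
  obtain ⟨D, N', hD, hN'⟩ := hv.2 i
  refine ⟨i.factorial * C * D ^ i, N + N' * i, fun q hq z => ?_⟩
  have hq1 : (1 : ℝ) ≤ q := by exact_mod_cast hq
  have hD1 : 1 ≤ D * (q : ℝ) ^ N' := one_le_mul_of_one_le_of_one_le hD (one_le_pow₀ hq1)
  refine (norm_iteratedFDeriv_comp_le_of_pos (hu.1 q hq) (hv.1 q hq) hi hD1 (by positivity) z
    (fun j h1 h2 => hN q hq j h1 h2 _) (fun j h1 h2 => hN' q hq j h1 h2 _)).trans (le_of_eq ?_)
  rw [mul_pow, pow_add, pow_mul]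
  ring

/-- Mean value inequality for the `j`-th derivative; this is where one extra derivative is spent. -/
theorem iteratedFDeriv_sub_translate_le {u : ℝ × ℝ → ℝ × ℝ} (hu : ContDiff ℝ ∞ u) (j : ℕ) {C : ℝ}
    (hC : ∀ z, ‖iteratedFDeriv ℝ (j + 1) u z‖ ≤ C) (s t : ℝ) (z : ℝ × ℝ) :
    ‖iteratedFDeriv ℝ j (fun w => u (w + (s, 0)) - u (w + (t, 0))) z‖ ≤ C * |s - t| := by
  have h1 : ∀ r : ℝ, ContDiff ℝ ∞ fun w : ℝ × ℝ => u (w + (r, 0)) := fun r =>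
    hu.comp (contDiff_id.add contDiff_const)
  have e : iteratedFDeriv ℝ j (fun w => u (w + (s, 0)) - u (w + (t, 0))) z
      = iteratedFDeriv ℝ j u (z + (s, 0)) - iteratedFDeriv ℝ j u (z + (t, 0)) := by
    rw [← iteratedFDeriv_comp_add_right, ← iteratedFDeriv_comp_add_right]
    exact iteratedFDeriv_sub_apply ((h1 s).contDiffAt.of_le (by exact_mod_cast le_top))
      ((h1 t).contDiffAt.of_le (by exact_mod_cast le_top))
  rw [e]
  refine (Convex.norm_image_sub_le_of_norm_fderiv_le (𝕜 := ℝ) (f := iteratedFDeriv ℝ j u)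
    (s := univ) (C := C) (fun x _ => ?_) (fun x _ => ?_) convex_univ (mem_univ _)
    (mem_univ _)).trans (le_of_eq ?_)
  · exact (hu.differentiable_iteratedFDeriv (m := j) (by exact_mod_cast WithTop.coe_lt_top _)) x
  · rw [norm_fderiv_iteratedFDeriv]; exact hC x
  · congr 1
    simp [Prod.norm_def]

/-- If `H q` and its inverse are polynomially bounded, then so is the dependence of the conjugate
`H q ∘ R_t ∘ (H q)⁻¹` on `t`. -/
theorem exists_conjRot_sub_bound {H : ℕ → coverGroup} (h1 : PolyBounded fun q => (H q).1)
    (h2 : PolyBounded fun q => (H q).1.symm) (k : ℕ) :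
    ∃ C : ℝ, ∃ N : ℕ, 0 ≤ C ∧ ∀ q : ℕ, 1 ≤ q → ∀ i ≤ k, ∀ (s t : ℝ) (z : ℝ × ℝ),
      ‖iteratedFDeriv ℝ i (fun w => (conjRot (H q) s).1 w - (conjRot (H q) t).1 w) z‖
        ≤ C * q ^ N * |s - t| := by
  obtain ⟨C, N, hC, hN⟩ := h1.2 (k + 1)
  obtain ⟨D, N', hD, hN'⟩ := h2.2 k
  refine ⟨k.factorial * C * D ^ k, N + N' * k, by positivity, fun q hq i hi s t z => ?_⟩
  have hq1 : (1 : ℝ) ≤ q := by exact_mod_cast hq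
  have hD1 : 1 ≤ D * (q : ℝ) ^ N' := one_le_mul_of_one_le_of_one_le hD (one_le_pow₀ hq1)
  -- The two conjugates share the inner map, so their difference is `g` composed with the inverse of
  -- `H q`, and every derivative of `g`, including order zero, carries the factor `|s - t|`.
  set g : ℝ × ℝ → ℝ × ℝ := fun w => (H q).1 (w + (s, 0)) - (H q).1 (w + (t, 0)) with hg
  have hcd : ∀ r : ℝ, ContDiff ℝ ∞ fun w : ℝ × ℝ => (H q).1 (w + (r, 0)) := fun r =>
    (h1.1 q hq).comp (contDiff_id.add contDiff_const)
  have e : (fun w => (conjRot (H q) s).1 w - (conjRot (H q) t).1 w) = g ∘ (H q).1.symm := by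
    funext w
    simp only [conjRot_apply, hg, Function.comp_apply]
  rw [e]
  have hb := norm_iteratedFDeriv_comp_le (N := ∞) (n := i) (g := g) (f := (H q).1.symm)
    (C := C * q ^ N * |s - t|) (D := D * q ^ N') ((hcd s).sub (hcd t))
    (h2.1 q hq) (by exact_mod_cast le_top) z
    (fun j hj => iteratedFDeriv_sub_translate_le (h1.1 q hq) j
      (fun w => hN q hq (j + 1) (by omega) (by omega) w) s t _)
    (fun j h1 h2 => (hN' q hq j h1 (by omega) _).trans (le_self_pow₀ hD1 (by omega)))
  refine hb.trans ?_
  have hf : (i.factorial : ℝ) ≤ k.factorial := by exact_mod_cast Nat.factorial_le hi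
  calc (i.factorial : ℝ) * (C * q ^ N * |s - t|) * (D * q ^ N') ^ i
      ≤ k.factorial * (C * q ^ N * |s - t|) * (D * q ^ N') ^ k := by
        gcongr
    _ = k.factorial * C * D ^ k * q ^ (N + N' * k) * |s - t| := by
        rw [mul_pow, pow_add, pow_mul]; ring

/-! ### The quasi-rotation -/

/-- The rotation angle at squared distance `s` from the centre: `π / 2` for `s ≤ 1 - κ` and `0` for
`s ≥ 1 - κ / 2`. -/
noncomputable def angle (κ s : ℝ) : ℝ :=
  Real.pi / 2 * Real.smoothTransition ((1 - κ / 2 - s) / (κ / 2))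

theorem contDiff_angle (κ : ℝ) : ContDiff ℝ ∞ (angle κ) := by
  unfold angle
  exact contDiff_const.mul (Real.smoothTransition.contDiff.comp
    ((contDiff_const.sub contDiff_id).div_const _))

theorem angle_of_le {κ s : ℝ} (hκ : 0 < κ) (hs : s ≤ 1 - κ) : angle κ s = Real.pi / 2 := by
  unfold angle
  rw [Real.smoothTransition.one_of_one_le, mul_one]
  rw [le_div_iff₀ (by positivity)]
  linarith

theorem angle_of_ge {κ s : ℝ} (hκ : 0 < κ) (hs : 1 - κ / 2 ≤ s) : angle κ s = 0 := by
  unfold angle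
  rw [Real.smoothTransition.zero_of_nonpos, mul_zero]
  exact div_nonpos_of_nonpos_of_nonneg (by linarith) (by positivity)

/-- The twist of the ellipse inscribed in `[1/2,1] × [0,1]`, rotating by `η` times the angle. -/
noncomputable def ellipseTwist (κ η : ℝ) (z : ℝ × ℝ) : ℝ × ℝ :=
  let X := 4 * z.1 - 3
  let Y := 2 * z.2 - 1
  let b := η * angle κ (X ^ 2 + Y ^ 2)
  ((X * Real.cos b - Y * Real.sin b + 3) / 4, (X * Real.sin b + Y * Real.cos b + 1) / 2)

/-- The squared distance from the centre of the ellipse. -/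
def ellipseSq (z : ℝ × ℝ) : ℝ := (4 * z.1 - 3) ^ 2 + (2 * z.2 - 1) ^ 2

theorem contDiff_ellipseTwist (κ η : ℝ) : ContDiff ℝ ∞ (ellipseTwist κ η) := by
  have hb : ContDiff ℝ ∞ fun z : ℝ × ℝ =>
      η * angle κ ((4 * z.1 - 3) ^ 2 + (2 * z.2 - 1) ^ 2) :=
    contDiff_const.mul ((contDiff_angle κ).comp (by fun_prop))
  unfold ellipseTwist
  have hs := Real.contDiff_sin.comp hb
  have hc := Real.contDiff_cos.comp hb
  refine ContDiff.prodMk (ContDiff.div_const (ContDiff.add (ContDiff.sub ?_ ?_) contDiff_const) _)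
    (ContDiff.div_const (ContDiff.add (ContDiff.add ?_ ?_) contDiff_const) _)
  · exact ContDiff.mul (by fun_prop) hc
  · exact ContDiff.mul (by fun_prop) hs
  · exact ContDiff.mul (by fun_prop) hs
  · exact ContDiff.mul (by fun_prop) hc

theorem ellipseTwist_of_ge {κ : ℝ} (hκ : 0 < κ) (η : ℝ) {z : ℝ × ℝ}
    (hz : 1 - κ / 2 ≤ ellipseSq z) : ellipseTwist κ η z = z := by
  have : angle κ ((4 * z.1 - 3) ^ 2 + (2 * z.2 - 1) ^ 2) = 0 := angle_of_ge hκ hz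
  simp only [ellipseTwist, this, mul_zero, Real.cos_zero, Real.sin_zero]
  ext <;> simp

theorem ellipseTwist_of_le {κ : ℝ} (hκ : 0 < κ) {z : ℝ × ℝ} (hz : ellipseSq z ≤ 1 - κ) :
    ellipseTwist κ 1 z = (1 - z.2 / 2, 2 * z.1 - 1) := by
  have : angle κ ((4 * z.1 - 3) ^ 2 + (2 * z.2 - 1) ^ 2) = Real.pi / 2 := angle_of_le hκ hz
  simp only [ellipseTwist, this, one_mul, Real.cos_pi_div_two, Real.sin_pi_div_two]
  ext <;> simp <;> ring

theorem ellipseSq_ellipseTwist (κ η : ℝ) (z : ℝ × ℝ) :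
    ellipseSq (ellipseTwist κ η z) = ellipseSq z := by
  simp only [ellipseSq, ellipseTwist]
  set b := η * angle κ ((4 * z.1 - 3) ^ 2 + (2 * z.2 - 1) ^ 2)
  have h := Real.sin_sq_add_cos_sq b
  linear_combination ((4 * z.1 - 3) ^ 2 + (2 * z.2 - 1) ^ 2) * h

theorem ellipseTwist_neg_ellipseTwist (κ η : ℝ) (z : ℝ × ℝ) :
    ellipseTwist κ (-η) (ellipseTwist κ η z) = z := by
  have h0 := ellipseSq_ellipseTwist κ η z
  simp only [ellipseSq] at h0
  rw [ellipseTwist, h0]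
  simp only [ellipseTwist]
  set b := η * angle κ ((4 * z.1 - 3) ^ 2 + (2 * z.2 - 1) ^ 2)
  have h := Real.sin_sq_add_cos_sq b
  rw [neg_mul, Real.cos_neg, Real.sin_neg]
  ext
  · simp only
    linear_combination (z.1 - 3 / 4) * h
  · simp only
    linear_combination (z.2 - 1 / 2) * h

/-- The twist preserves the concentric ellipses, which lie inside the cell, and is the identity
outside them. Invariance of the half-open cell is what makes the periodic extension invertible. -/
theorem ellipseTwist_mem {κ : ℝ} (hκ : 0 < κ) (η : ℝ) {z : ℝ × ℝ}
    (hz : z ∈ Ico (0 : ℝ) 1 ×ˢ Ico (0 : ℝ) 1) :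
    ellipseTwist κ η z ∈ Ico (0 : ℝ) 1 ×ˢ Ico (0 : ℝ) 1 := by
  rcases le_or_gt (1 - κ / 2) (ellipseSq z) with h | h
  · rwa [ellipseTwist_of_ge hκ η h]
  · rw [← ellipseSq_ellipseTwist κ η z] at h
    set w := ellipseTwist κ η z
    have h' : ellipseSq w < 1 := by linarith
    simp only [ellipseSq] at h'
    have h1 := abs_lt_of_sq_lt_sq (show (4 * w.1 - 3) ^ 2 < 1 ^ 2 by nlinarith) zero_le_one
    have h2 := abs_lt_of_sq_lt_sq (show (2 * w.2 - 1) ^ 2 < 1 ^ 2 by nlinarith) zero_le_one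
    rw [abs_lt] at h1 h2
    exact ⟨⟨by linarith, by linarith⟩, by linarith, by linarith⟩

/-! ### Periodic extension and its smoothness. -/

/-- The periodic extension of the twist. -/
noncomputable def cellTwist (κ η : ℝ) (z : ℝ × ℝ) : ℝ × ℝ :=
  ellipseTwist κ η (Int.fract z.1, Int.fract z.2) + ((⌊z.1⌋ : ℝ), (⌊z.2⌋ : ℝ))

theorem fract_mem_cell (z : ℝ × ℝ) :
    (Int.fract z.1, Int.fract z.2) ∈ Ico (0 : ℝ) 1 ×ˢ Ico (0 : ℝ) 1 :=
  ⟨⟨Int.fract_nonneg _, Int.fract_lt_one _⟩, Int.fract_nonneg _, Int.fract_lt_one _⟩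

theorem cellTwist_add {κ η : ℝ} {w : ℝ × ℝ} (hw : w ∈ Ico (0 : ℝ) 1 ×ˢ Ico (0 : ℝ) 1) (m n : ℤ) :
    cellTwist κ η (w + ((m : ℝ), (n : ℝ))) = ellipseTwist κ η w + ((m : ℝ), (n : ℝ)) := by
  have h1 : ⌊w.1⌋ = 0 := Int.floor_eq_zero_iff.2 hw.1
  have h2 : ⌊w.2⌋ = 0 := Int.floor_eq_zero_iff.2 hw.2
  have h3 : Int.fract w.1 = w.1 := Int.fract_eq_self.2 hw.1
  have h4 : Int.fract w.2 = w.2 := Int.fract_eq_self.2 hw.2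
  simp [cellTwist, h1, h2, h3, h4]

theorem cellTwist_equivariant (κ η : ℝ) (z : ℝ × ℝ) (m n : ℤ) :
    cellTwist κ η (z + ((m : ℝ), (n : ℝ))) = cellTwist κ η z + ((m : ℝ), (n : ℝ)) := by
  simp [cellTwist, add_assoc]

theorem cellTwist_neg_cellTwist {κ : ℝ} (hκ : 0 < κ) (η : ℝ) (z : ℝ × ℝ) :
    cellTwist κ (-η) (cellTwist κ η z) = z := by
  have h : cellTwist κ η z
      = ellipseTwist κ η (Int.fract z.1, Int.fract z.2) + ((⌊z.1⌋ : ℝ), (⌊z.2⌋ : ℝ)) := rfl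
  rw [h, cellTwist_add (ellipseTwist_mem hκ η (fract_mem_cell z)), ellipseTwist_neg_ellipseTwist]
  ext <;> simp

theorem cellTwist_of_ge {κ : ℝ} (hκ : 0 < κ) (η : ℝ) {z : ℝ × ℝ}
    (hz : 1 - κ / 2 ≤ ellipseSq (Int.fract z.1, Int.fract z.2)) : cellTwist κ η z = z := by
  rw [cellTwist, ellipseTwist_of_ge hκ η hz]
  ext <;> simp

theorem cellTwist_strip {κ : ℝ} (hκ : 0 < κ) (η : ℝ) {z : ℝ × ℝ} (hz : z.2 ∈ Icc (0 : ℝ) 1) :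
    (cellTwist κ η z).2 ∈ Icc (0 : ℝ) 1 := by
  rcases hz.2.lt_or_eq with h | h
  · have h0 : ⌊z.2⌋ = 0 := Int.floor_eq_zero_iff.2 ⟨hz.1, h⟩
    have := (ellipseTwist_mem hκ η (fract_mem_cell z)).2
    simp only [cellTwist, Prod.snd_add, h0, Int.cast_zero, add_zero]
    exact Ico_subset_Icc_self this
  -- On the top edge the fractional part of the height jumps to `0`, but there `2 * 0 - 1 = -1`, so
  -- the point is outside the support of the twist and is fixed.
  · rw [cellTwist_of_ge hκ η]
    · exact hz
    · simp only [ellipseSq, h, Int.fract_one]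
      nlinarith [sq_nonneg (4 * Int.fract z.1 - 3)]

theorem eventually_floor_eq {x : ℝ} (hx : Int.fract x ≠ 0) : ∀ᶠ y in 𝓝 x, ⌊y⌋ = ⌊x⌋ := by
  have h1 : (⌊x⌋ : ℝ) < x := by
    rcases (Int.floor_le x).lt_or_eq with h | h
    · exact h
    · exact absurd (by rw [Int.fract, h, sub_self]) hx
  filter_upwards [Ioo_mem_nhds h1 (Int.lt_floor_add_one x)] with y hy
  exact Int.floor_eq_iff.2 ⟨hy.1.le, hy.2⟩

theorem eventually_fract_near {x : ℝ} (hx : Int.fract x = 0) {δ : ℝ} (hδ : 0 < δ) :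
    ∀ᶠ y in 𝓝 x, Int.fract y < δ ∨ 1 - δ < Int.fract y := by
  have h0 : (⌊x⌋ : ℝ) = x := by
    have := Int.self_sub_floor x
    rw [hx] at this
    linarith
  have hm : 0 < min δ 1 := lt_min hδ one_pos
  have h1 : x - min δ 1 < x := by linarith
  have h2 : x < x + min δ 1 := by linarith
  filter_upwards [Ioo_mem_nhds h1 h2] with y hy
  have e1 := min_le_left δ 1
  have e2 := min_le_right δ 1
  rcases le_or_gt x y with h | h
  · left
    have : ⌊y⌋ = ⌊x⌋ := Int.floor_eq_iff.2 ⟨by linarith, by linarith [hy.2]⟩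
    rw [Int.fract, this, h0]
    linarith [hy.2]
  · right
    have : ⌊y⌋ = ⌊x⌋ - 1 := Int.floor_eq_iff.2 ⟨by push_cast; linarith [hy.1],
      by push_cast; linarith⟩
    rw [Int.fract, this]
    push_cast
    rw [h0]
    linarith [hy.1]

/-- Locally, the periodic extension is the identity or a translate of the twist. -/
theorem cellTwist_eventuallyEq {κ : ℝ} (hκ : 0 < κ) (η : ℝ) (z : ℝ × ℝ) :
    cellTwist κ η =ᶠ[𝓝 z] id ∨
      ∃ c : ℝ × ℝ, cellTwist κ η =ᶠ[𝓝 z] fun w => ellipseTwist κ η (w - c) + c := by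
  have t1 : Tendsto Prod.fst (𝓝 z) (𝓝 z.1) := continuous_fst.tendsto z
  have t2 : Tendsto Prod.snd (𝓝 z) (𝓝 z.2) := continuous_snd.tendsto z
  by_cases h1 : Int.fract z.1 = 0
  · left
    -- Near a vertical wall the twist is off. Within `κ / 16` of the right wall `4 * x - 3 > 1 - κ /
    -- 4`, with square above `1 - κ / 2`; near the left wall the cap `1 / 2` already gives `4 * x -
    -- 3 < -1`.
    filter_upwards [t1.eventually (eventually_fract_near h1 (δ := min (κ / 16) (1 / 2))
      (by positivity))] with w hw
    refine cellTwist_of_ge hκ η ?_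
    have e1 := min_le_left (κ / 16) (1 / 2)
    have e2 := min_le_right (κ / 16) (1 / 2)
    simp only [ellipseSq]
    rcases hw with hw | hw
    · nlinarith [sq_nonneg (2 * Int.fract w.2 - 1)]
    · nlinarith [sq_nonneg (2 * Int.fract w.2 - 1), sq_nonneg (4 * Int.fract w.1 - 4)]
  by_cases h2 : Int.fract z.2 = 0
  · left
    filter_upwards [t2.eventually (eventually_fract_near h2 (δ := min (κ / 16) (1 / 2))
      (by positivity))] with w hw
    refine cellTwist_of_ge hκ η ?_
    have e1 := min_le_left (κ / 16) (1 / 2)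
    have e2 := min_le_right (κ / 16) (1 / 2)
    have e3 := Int.fract_nonneg w.2
    simp only [ellipseSq]
    rcases hw with hw | hw
    · nlinarith [sq_nonneg (4 * Int.fract w.1 - 3)]
    · nlinarith [sq_nonneg (4 * Int.fract w.1 - 3), sq_nonneg (2 * Int.fract w.2 - 2)]
  · right
    refine ⟨((⌊z.1⌋ : ℝ), (⌊z.2⌋ : ℝ)), ?_⟩
    filter_upwards [t1.eventually (eventually_floor_eq h1), t2.eventually (eventually_floor_eq h2)]
      with w hw1 hw2
    rw [cellTwist, Int.fract, Int.fract, hw1, hw2]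
    rfl

theorem contDiff_cellTwist {κ : ℝ} (hκ : 0 < κ) (η : ℝ) : ContDiff ℝ ∞ (cellTwist κ η) := by
  rw [contDiff_iff_contDiffAt]
  intro z
  rcases cellTwist_eventuallyEq hκ η z with h | ⟨c, h⟩
  · exact contDiffAt_id.congr_of_eventuallyEq h
  · exact (((contDiff_ellipseTwist κ η).comp (contDiff_id.sub contDiff_const)).add
      contDiff_const).contDiffAt.congr_of_eventuallyEq h

/-! ### Preservation of area -/

theorem det_prod_clm (L₁ L₂ : ℝ × ℝ →L[ℝ] ℝ) :
    (L₁.prod L₂).det = L₁ (1, 0) * L₂ (0, 1) - L₁ (0, 1) * L₂ (1, 0) := by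
  rw [ContinuousLinearMap.det, ← LinearMap.det_toMatrix (Module.Basis.finTwoProd ℝ),
    Matrix.det_fin_two]
  simp [LinearMap.toMatrix_apply]

/-- A rotation of the normalized disc by an angle depending only on the radius: the terms with the
derivative of the angle cancel because the motion is tangent to the circles. -/
theorem exists_hasFDerivAt_ellipseTwist (κ η : ℝ) (z : ℝ × ℝ) :
    ∃ L : ℝ × ℝ →L[ℝ] ℝ × ℝ, HasFDerivAt (ellipseTwist κ η) L z ∧ L.det = 1 := by
  have hX : HasFDerivAt (fun z : ℝ × ℝ => 4 * z.1 - 3) ((4 : ℝ) • ContinuousLinearMap.fst ℝ ℝ ℝ) z :=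
    ((hasFDerivAt_fst).const_mul 4).sub_const 3
  have hY : HasFDerivAt (fun z : ℝ × ℝ => 2 * z.2 - 1) ((2 : ℝ) • ContinuousLinearMap.snd ℝ ℝ ℝ) z :=
    ((hasFDerivAt_snd).const_mul 2).sub_const 1
  have hang : HasDerivAt (angle κ) (deriv (angle κ) ((4 * z.1 - 3) ^ 2 + (2 * z.2 - 1) ^ 2))
      ((4 * z.1 - 3) ^ 2 + (2 * z.2 - 1) ^ 2) :=
    (((contDiff_angle κ).differentiable (by simp)) _).hasDerivAt
  have hb := (hang.comp_hasFDerivAt z ((hX.pow 2).add (hY.pow 2))).const_mul η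
  have hc := hb.cos
  have hs := hb.sin
  have h1 := (((hX.mul hc).sub (hY.mul hs)).add_const 3).mul_const (4 : ℝ)⁻¹
  have h2 := (((hX.mul hs).add (hY.mul hc)).add_const 1).mul_const (2 : ℝ)⁻¹
  refine ⟨_, h1.prodMk h2, ?_⟩
  rw [det_prod_clm]
  simp
  set X := 4 * z.1 - 3
  set Y := 2 * z.2 - 1
  set b := η * angle κ (X ^ 2 + Y ^ 2)
  set b' := deriv (angle κ) (X ^ 2 + Y ^ 2)
  linear_combination Real.sin_sq_add_cos_sq b

theorem exists_hasFDerivAt_cellTwist {κ : ℝ} (hκ : 0 < κ) (η : ℝ) (z : ℝ × ℝ) :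
    ∃ L : ℝ × ℝ →L[ℝ] ℝ × ℝ, HasFDerivAt (cellTwist κ η) L z ∧ L.det = 1 := by
  rcases cellTwist_eventuallyEq hκ η z with h | ⟨c, h⟩
  · refine ⟨ContinuousLinearMap.id ℝ _, (hasFDerivAt_id z).congr_of_eventuallyEq h, ?_⟩
    simp [ContinuousLinearMap.det]
  · obtain ⟨L, hL, hd⟩ := exists_hasFDerivAt_ellipseTwist κ η (z - c)
    refine ⟨L, HasFDerivAt.congr_of_eventuallyEq ?_ h, hd⟩
    have := hL.comp z ((hasFDerivAt_id z).sub_const c)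
    exact this.add_const c

theorem measurePreserving_cellTwist {κ : ℝ} (hκ : 0 < κ) (η : ℝ) :
    MeasurePreserving (cellTwist κ η) := by
  have hm : Measurable (cellTwist κ η) := (contDiff_cellTwist hκ η).continuous.measurable
  refine ⟨hm, ?_⟩
  choose L hL hd using exists_hasFDerivAt_cellTwist hκ η
  have hinv : Function.LeftInverse (cellTwist κ (-η)) (cellTwist κ η) :=
    cellTwist_neg_cellTwist hκ η
  have hsurj : Function.Surjective (cellTwist κ η) := fun z =>
    ⟨cellTwist κ (-η) z, by simpa using cellTwist_neg_cellTwist hκ (-η) z⟩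
  have := map_withDensity_abs_det_fderiv_eq_addHaar (μ := (volume : Measure (ℝ × ℝ)))
    (s := univ) (f := cellTwist κ η) (f' := L) MeasurableSet.univ.nullMeasurableSet
    (fun z _ => (hL z).hasFDerivWithinAt) hinv.injective.injOn
  simpa [hd, hsurj.range_eq, withDensity_one, hm] using this

/-- The periodic twist as a permutation of the plane. -/
noncomputable def cellTwistPerm {κ : ℝ} (hκ : 0 < κ) : Equiv.Perm (ℝ × ℝ) where
  toFun := cellTwist κ 1
  invFun := cellTwist κ (-1)
  left_inv := cellTwist_neg_cellTwist hκ 1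
  right_inv z := by simpa using cellTwist_neg_cellTwist hκ (-1) z

/-! ### The quasi-rotation with cells of width `1 / q`. -/

/-- The horizontal dilation by the factor `q`. -/
noncomputable def dilation (q : ℕ) : ℝ × ℝ →L[ℝ] ℝ × ℝ :=
  ((max q 1 : ℕ) • ContinuousLinearMap.fst ℝ ℝ ℝ).prod (ContinuousLinearMap.snd ℝ ℝ ℝ)

/-- The horizontal contraction by the factor `q`. -/
noncomputable def contraction (q : ℕ) : ℝ × ℝ →L[ℝ] ℝ × ℝ :=
  (((max q 1 : ℕ) : ℝ)⁻¹ • ContinuousLinearMap.fst ℝ ℝ ℝ).prod (ContinuousLinearMap.snd ℝ ℝ ℝ)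

theorem dilation_apply (q : ℕ) (z : ℝ × ℝ) : dilation q z = (((max q 1 : ℕ) : ℝ) * z.1, z.2) := by
  simp [dilation]

theorem contraction_apply (q : ℕ) (z : ℝ × ℝ) :
    contraction q z = (((max q 1 : ℕ) : ℝ)⁻¹ * z.1, z.2) := by
  simp [contraction]

/-- The factor `max q 1` instead of `q` keeps the dilation invertible at `q = 0`, so that a
permutation is defined for every `q`. -/
theorem max_one_ne_zero (q : ℕ) : ((max q 1 : ℕ) : ℝ) ≠ 0 := by
  have : 0 < max q 1 := by omega
  positivity

theorem contraction_dilation (q : ℕ) (z : ℝ × ℝ) : contraction q (dilation q z) = z := by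
  rw [contraction_apply, dilation_apply]
  ext
  · exact inv_mul_cancel_left₀ (max_one_ne_zero q) _
  · rfl

theorem dilation_contraction (q : ℕ) (z : ℝ × ℝ) : dilation q (contraction q z) = z := by
  rw [contraction_apply, dilation_apply]
  ext
  · exact mul_inv_cancel_left₀ (max_one_ne_zero q) _
  · rfl

/-- The dilation as a permutation of the plane. -/
noncomputable def dilationPerm (q : ℕ) : Equiv.Perm (ℝ × ℝ) where
  toFun := dilation q
  invFun := contraction q
  left_inv := contraction_dilation q
  right_inv := dilation_contraction q

theorem conj_dilation_equivariant (κ η : ℝ) (q : ℕ) (z : ℝ × ℝ) (m n : ℤ) :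
    contraction q (cellTwist κ η (dilation q (z + ((m : ℝ) / (max q 1 : ℕ), (n : ℝ)))))
      = contraction q (cellTwist κ η (dilation q z)) + ((m : ℝ) / (max q 1 : ℕ), (n : ℝ)) := by
  have h : dilation q ((m : ℝ) / (max q 1 : ℕ), (n : ℝ)) = ((m : ℝ), (n : ℝ)) := by
    rw [dilation_apply]
    ext
    · exact mul_div_cancel₀ _ (max_one_ne_zero q)
    · rfl
  rw [map_add, h, cellTwist_equivariant, map_add, ← h, contraction_dilation]

theorem isCover_conj_dilation {κ : ℝ} (hκ : 0 < κ) (η : ℝ) (q : ℕ) :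
    IsCover (fun z => contraction q (cellTwist κ η (dilation q z))) where
  contDiff := (contraction q).contDiff.comp ((contDiff_cellTwist hκ η).comp (dilation q).contDiff)
  strip z hz := by
    rw [contraction_apply]
    refine cellTwist_strip hκ η ?_
    rwa [dilation_apply]
  equivariant := by
    refine ⟨0, fun z m n => ?_⟩
    have h := conj_dilation_equivariant κ η q z (m * (max q 1 : ℕ)) n
    have e : (((m * (max q 1 : ℕ) : ℤ)) : ℝ) / ((max q 1 : ℕ) : ℝ) = m := by
      rw [Int.cast_mul, Int.cast_natCast]
      exact mul_div_cancel_right₀ _ (max_one_ne_zero q)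
    rw [e] at h
    simpa using h

/-- The quasi-rotation with horizontal period `1 / q`. -/
noncomputable def twistCover {κ : ℝ} (hκ : 0 < κ) (q : ℕ) : coverGroup :=
  ⟨(dilationPerm q)⁻¹ * cellTwistPerm hκ * dilationPerm q,
    isCover_conj_dilation hκ 1 q, isCover_conj_dilation hκ (-1) q⟩

theorem twistCover_apply {κ : ℝ} (hκ : 0 < κ) (q : ℕ) (z : ℝ × ℝ) :
    (twistCover hκ q).1 z = contraction q (cellTwist κ 1 (dilation q z)) := rfl

/-- The dilation turns translation by `p / q` into translation by the integer `p`, under which the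
periodic twist is equivariant. -/
theorem twistCover_commute {κ : ℝ} (hκ : 0 < κ) {q : ℕ} (hq : 1 ≤ q) (p : ℤ) :
    rotCover ((p : ℝ) / q) * twistCover hκ q = twistCover hκ q * rotCover ((p : ℝ) / q) :=
  coverGroup_ext fun z => by
    have h := conj_dilation_equivariant κ 1 q z p 0
    rw [Nat.max_eq_left hq] at h
    have e (w : ℝ × ℝ) : (w.1 + (p : ℝ) / q, w.2) = w + ((p : ℝ) / (q : ℝ), ((0 : ℤ) : ℝ)) := by
      ext <;> simp
    rw [Subgroup.coe_mul, Equiv.Perm.mul_apply, Subgroup.coe_mul, Equiv.Perm.mul_apply,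
      rotCover_apply, rotCover_apply, twistCover_apply, twistCover_apply, e, e, h]

theorem norm_dilation_le {q : ℕ} (hq : 1 ≤ q) : ‖dilation q‖ ≤ 1 * q ^ 1 := by
  refine ContinuousLinearMap.opNorm_le_bound _ (by positivity) fun z => ?_
  rw [dilation_apply, Nat.max_eq_left hq]
  have hq1 : (1 : ℝ) ≤ q := by exact_mod_cast hq
  refine max_le ?_ ?_
  · simp only [norm_mul, RCLike.norm_natCast, one_mul, pow_one]
    exact mul_le_mul_of_nonneg_left (norm_fst_le z) (by positivity)
  · simp only [one_mul, pow_one]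
    refine (norm_snd_le z).trans (le_mul_of_one_le_left (norm_nonneg _) hq1)

theorem norm_contraction_le {q : ℕ} (hq : 1 ≤ q) : ‖contraction q‖ ≤ 1 * q ^ 0 := by
  refine ContinuousLinearMap.opNorm_le_bound _ (by positivity) fun z => ?_
  rw [contraction_apply, Nat.max_eq_left hq]
  have hq1 : (1 : ℝ) ≤ q := by exact_mod_cast hq
  simp only [pow_zero, one_mul]
  refine max_le ?_ (norm_snd_le z)
  simp only [norm_mul, norm_inv, RCLike.norm_natCast]
  exact (mul_le_of_le_one_left (norm_nonneg _) (inv_le_one_of_one_le₀ hq1)).trans (norm_fst_le z)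

theorem isCover_cellTwist {κ : ℝ} (hκ : 0 < κ) (η : ℝ) : IsCover (cellTwist κ η) where
  contDiff := contDiff_cellTwist hκ η
  strip _ hz := cellTwist_strip hκ η hz
  equivariant := ⟨0, fun z m n => by simpa using cellTwist_equivariant κ η z m n⟩

theorem polyBounded_conj_dilation {κ : ℝ} (hκ : 0 < κ) (η : ℝ) :
    PolyBounded fun q => contraction q ∘ cellTwist κ η ∘ dilation q :=
  PolyBounded.comp (polyBounded_clm fun _ => norm_contraction_le)
    ((isCover_cellTwist hκ η).polyBounded.comp (polyBounded_clm fun _ => norm_dilation_le))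

/-- The dilation multiplies Lebesgue measure by a constant, the twist preserves the multiple, and
the contraction undoes it; the constant never has to be evaluated. -/
theorem measurePreserving_conj_dilation {κ : ℝ} (hκ : 0 < κ) (η : ℝ) (q : ℕ) :
    MeasurePreserving fun z => contraction q (cellTwist κ η (dilation q z)) := by
  have hp := measurePreserving_cellTwist hκ η
  refine ⟨(contraction q).continuous.measurable.comp
    (hp.measurable.comp (dilation q).continuous.measurable), ?_⟩
  have hdet : LinearMap.det ((dilation q : ℝ × ℝ →L[ℝ] ℝ × ℝ) : ℝ × ℝ →ₗ[ℝ] ℝ × ℝ) ≠ 0 := by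
    have h : (dilation q).det = ((max q 1 : ℕ) : ℝ) := by
      rw [dilation, det_prod_clm]
      simp
    have h' : (dilation q).det ≠ 0 := h ▸ max_one_ne_zero q
    exact h'
  have hd := Measure.map_linearMap_addHaar_eq_smul_addHaar
    (volume : Measure (ℝ × ℝ)) hdet
  have hd' : Measure.map (dilation q) (volume : Measure (ℝ × ℝ)) = _ := hd
  set c := ENNReal.ofReal
    |(LinearMap.det ((dilation q : ℝ × ℝ →L[ℝ] ℝ × ℝ) : ℝ × ℝ →ₗ[ℝ] ℝ × ℝ))⁻¹|
  have e1 : Measure.map (fun z => contraction q (cellTwist κ η (dilation q z))) volume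
      = Measure.map (contraction q) (Measure.map (cellTwist κ η)
          (Measure.map (dilation q) (volume : Measure (ℝ × ℝ)))) := by
    rw [Measure.map_map hp.measurable (dilation q).continuous.measurable,
      Measure.map_map (contraction q).continuous.measurable
        (hp.measurable.comp (dilation q).continuous.measurable)]
    rfl
  rw [e1, hd', Measure.map_smul, hp.map_eq, ← hd', Measure.map_map
    (contraction q).continuous.measurable (dilation q).continuous.measurable]
  have : (contraction q ∘ dilation q : ℝ × ℝ → ℝ × ℝ) = id :=
    funext (contraction_dilation q)
  rw [this, Measure.map_id]

/-- The quasi-rotation maps the unit square to itself. -/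
theorem conj_dilation_mem_square {κ : ℝ} (hκ : 0 < κ) (η : ℝ) (q : ℕ) {z : ℝ × ℝ}
    (hz : z ∈ Ico (0 : ℝ) 1 ×ˢ Ico (0 : ℝ) 1) :
    contraction q (cellTwist κ η (dilation q z)) ∈ Ico (0 : ℝ) 1 ×ˢ Ico (0 : ℝ) 1 := by
  have hc : (0 : ℝ) < ((max q 1 : ℕ) : ℝ) := by
    have : 0 < max q 1 := by omega
    exact_mod_cast this
  have h := ellipseTwist_mem hκ η (fract_mem_cell (dilation q z))
  rw [contraction_apply, cellTwist]
  set w := ellipseTwist κ η (Int.fract (dilation q z).1, Int.fract (dilation q z).2)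
  rw [dilation_apply]
  have h2 : ⌊z.2⌋ = 0 := Int.floor_eq_zero_iff.2 hz.2
  have h3 : 0 ≤ ⌊((max q 1 : ℕ) : ℝ) * z.1⌋ := Int.floor_nonneg.2 (mul_nonneg hc.le hz.1.1)
  have h4 : ⌊((max q 1 : ℕ) : ℝ) * z.1⌋ + 1 ≤ (max q 1 : ℕ) := by
    rw [Int.add_one_le_iff, Int.floor_lt]
    have := mul_lt_mul_of_pos_left hz.1.2 hc
    simpa using this
  have h3' : (0 : ℝ) ≤ ⌊((max q 1 : ℕ) : ℝ) * z.1⌋ := by exact_mod_cast h3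
  have h4' : (⌊((max q 1 : ℕ) : ℝ) * z.1⌋ : ℝ) + 1 ≤ ((max q 1 : ℕ) : ℝ) := by exact_mod_cast h4
  refine ⟨⟨?_, ?_⟩, ?_⟩
  · exact mul_nonneg (inv_nonneg.2 hc.le) (add_nonneg h.1.1 h3')
  · have h5 : w.1 + (⌊((max q 1 : ℕ) : ℝ) * z.1⌋ : ℝ) < ((max q 1 : ℕ) : ℝ) := by
      linarith [h.1.2]
    change ((max q 1 : ℕ) : ℝ)⁻¹ * (w.1 + (⌊((max q 1 : ℕ) : ℝ) * z.1⌋ : ℝ)) < 1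
    rw [inv_mul_lt_iff₀ hc, mul_one]
    exact h5
  · change w.2 + (⌊z.2⌋ : ℝ) ∈ Ico (0 : ℝ) 1
    rw [h2]
    simpa using h.2

/-! ### The distances -/

theorem supNorm_nonneg (u : ℝ × ℝ → ℝ) : 0 ≤ supNorm u := by
  refine Real.sSup_nonneg ?_
  rintro _ ⟨z, _, rfl⟩
  exact abs_nonneg _

theorem supNorm_le {u : ℝ × ℝ → ℝ} {e : ℝ} (he : 0 ≤ e)
    (h : ∀ z ∈ Ioo (0 : ℝ) 1 ×ˢ Ioo (0 : ℝ) 1, |u z| ≤ e) : supNorm u ≤ e := by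
  refine Real.sSup_le ?_ he
  rintro _ ⟨z, hz, rfl⟩
  exact h z hz

theorem liftDistZero_nonneg (M : Surface) (F G : ℝ × ℝ → ℝ × ℝ) : 0 ≤ liftDistZero M F G :=
  le_max_of_le_left (Real.iInf_nonneg fun _ => supNorm_nonneg _)

theorem liftDist_nonneg (M : Surface) (k : ℕ) (F G : ℝ × ℝ → ℝ × ℝ) : 0 ≤ liftDist M k F G := by
  refine Real.sSup_nonneg ?_
  rintro s (rfl | ⟨a, _, _, rfl | rfl⟩)
  · exact liftDistZero_nonneg M F G
  · exact supNorm_nonneg _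
  · exact supNorm_nonneg _

theorem distC_nonneg {M : Surface} (k : ℕ) (f g : Diff M) : 0 ≤ f.distC k g :=
  le_max_of_le_left (liftDist_nonneg _ _ _ _)

theorem contDiff_fderiv_apply {u : ℝ × ℝ → ℝ} (hu : ContDiff ℝ ∞ u) (v : ℝ × ℝ) :
    ContDiff ℝ ∞ fun z => fderiv ℝ u z v :=
  (hu.fderiv_right (m := ∞) (by simp)).clm_apply contDiff_const

theorem norm_iteratedFDeriv_fderiv_apply_le {u : ℝ × ℝ → ℝ} (hu : ContDiff ℝ ∞ u) {v : ℝ × ℝ}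
    (hv : ‖v‖ ≤ 1) (k : ℕ) (z : ℝ × ℝ) :
    ‖iteratedFDeriv ℝ k (fun z => fderiv ℝ u z v) z‖ ≤ ‖iteratedFDeriv ℝ (k + 1) u z‖ := by
  have e : (fun z => fderiv ℝ u z v) = (ContinuousLinearMap.apply ℝ ℝ v) ∘ fderiv ℝ u := rfl
  rw [← norm_iteratedFDeriv_fderiv, e]
  have hn : ‖ContinuousLinearMap.apply ℝ ℝ v‖ ≤ 1 := by
    refine ContinuousLinearMap.opNorm_le_bound _ zero_le_one fun L => ?_
    rw [ContinuousLinearMap.apply_apply, one_mul]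
    exact (L.le_opNorm v).trans (mul_le_of_le_one_right (norm_nonneg _) hv)
  refine ((ContinuousLinearMap.apply ℝ ℝ v).norm_iteratedFDeriv_comp_left (N := ∞)
    ((hu.fderiv_right (m := ∞) (by simp)).contDiffAt) (by exact_mod_cast le_top)).trans ?_
  exact mul_le_of_le_one_left (norm_nonneg _) hn

theorem contDiff_iterate_and_norm_le {D : (ℝ × ℝ → ℝ) → ℝ × ℝ → ℝ}
    (h1 : ∀ u, ContDiff ℝ ∞ u → ContDiff ℝ ∞ (D u))
    (h2 : ∀ u, ContDiff ℝ ∞ u → ∀ k z,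
      ‖iteratedFDeriv ℝ k (D u) z‖ ≤ ‖iteratedFDeriv ℝ (k + 1) u z‖) (a : ℕ) :
    ∀ u, ContDiff ℝ ∞ u → ContDiff ℝ ∞ (D^[a] u) ∧
      ∀ k z, ‖iteratedFDeriv ℝ k (D^[a] u) z‖ ≤ ‖iteratedFDeriv ℝ (k + a) u z‖ := by
  induction a with
  | zero => exact fun u hu => ⟨hu, fun k z => le_rfl⟩
  | succ a ih =>
    intro u hu
    obtain ⟨h3, h4⟩ := ih (D u) (h1 u hu)
    refine ⟨h3, fun k z => (h4 k z).trans ?_⟩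
    exact h2 u hu (k + a) z

/-- Each partial derivative is evaluation of the full derivative at a unit vector, so iterating
costs no constant. -/
theorem abs_partialD_le {u : ℝ × ℝ → ℝ} (hu : ContDiff ℝ ∞ u) (a : ℕ × ℕ) (z : ℝ × ℝ) :
    |partialD a u z| ≤ ‖iteratedFDeriv ℝ (a.1 + a.2) u z‖ := by
  have hθ := contDiff_iterate_and_norm_le (D := partialTheta)
    (fun u hu => contDiff_fderiv_apply hu _)
    (fun u hu k z => norm_iteratedFDeriv_fderiv_apply_le hu (by simp [Prod.norm_def]) k z) a.2 u hu
  have hr := contDiff_iterate_and_norm_le (D := partialR)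
    (fun u hu => contDiff_fderiv_apply hu _)
    (fun u hu k z => norm_iteratedFDeriv_fderiv_apply_le hu (by simp [Prod.norm_def]) k z) a.1 _
    hθ.1
  have h := (hr.2 0 z).trans (hθ.2 _ z)
  rw [norm_iteratedFDeriv_zero, zero_add] at h
  exact h

theorem iterate_eqOn {D : (ℝ × ℝ → ℝ) → ℝ × ℝ → ℝ} {s : Set (ℝ × ℝ)}
    (h : ∀ u v, EqOn u v s → EqOn (D u) (D v) s) (a : ℕ) :
    ∀ u v, EqOn u v s → EqOn (D^[a] u) (D^[a] v) s := by
  induction a with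
  | zero => exact fun u v huv => huv
  | succ a ih => exact fun u v huv => ih _ _ (h u v huv)

theorem fderiv_apply_eqOn {s : Set (ℝ × ℝ)} (hs : IsOpen s) {u v : ℝ × ℝ → ℝ} (h : EqOn u v s)
    (w : ℝ × ℝ) : EqOn (fun z => fderiv ℝ u z w) (fun z => fderiv ℝ v z w) s := fun z hz => by
  have : u =ᶠ[𝓝 z] v := h.eventuallyEq_of_mem (hs.mem_nhds hz)
  simp only [this.fderiv_eq]

theorem partialD_eqOn {s : Set (ℝ × ℝ)} (hs : IsOpen s) {u v : ℝ × ℝ → ℝ} (h : EqOn u v s)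
    (a : ℕ × ℕ) : EqOn (partialD a u) (partialD a v) s :=
  iterate_eqOn (fun _ _ h => fderiv_apply_eqOn hs h _) a.1 _ _
    (iterate_eqOn (fun _ _ h => fderiv_apply_eqOn hs h _) a.2 _ _ h)

theorem partialD_add_const {a : ℕ × ℕ} (ha : 1 ≤ a.1 + a.2) (u : ℝ × ℝ → ℝ) (c : ℝ) :
    partialD a (fun z => u z + c) = partialD a u := by
  have h (w : ℝ × ℝ) : (fun z => fderiv ℝ (fun z => u z + c) z w) = fun z => fderiv ℝ u z w := by
    funext z
    rw [fderiv_add_const]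
  obtain ⟨m, n⟩ := a
  rcases n with _ | n
  · rcases m with _ | m
    · simp at ha
    · exact congrArg partialR^[m] (h (0, 1))
  · exact congrArg (fun v => partialR^[m] (partialTheta^[n] v)) (h (1, 0))

theorem square_subset_strip (M : Surface) : Ioo (0 : ℝ) 1 ×ˢ Ioo (0 : ℝ) 1 ⊆ M.strip :=
  fun _ hz => mem_strip_of_mem_Icc M (Ioo_subset_Icc_self hz.2)

theorem isPreconnected_strip (M : Surface) : IsPreconnected M.strip := by
  cases M
  · exact (convex_univ.prod (convex_Icc 0 1)).isPreconnected
  · exact isPreconnected_univ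

/-- Two lifts of the same map differ by a deck translation. -/
theorem exists_eqOn_of_isSmoothLift {M : Surface} {F G : ℝ × ℝ → ℝ × ℝ} {f : M.Pt → M.Pt}
    (hF : M.IsSmoothLift F f) (hG : M.IsSmoothLift G f) :
    ∃ m : ℤ, ∃ n ∈ M.deck, ∀ z ∈ M.strip, F z = G z + ((m : ℝ), (n : ℝ)) := by
  have key : ∀ z ∈ M.strip, ∃ m : ℤ, ∃ n ∈ M.deck, F z = G z + ((m : ℝ), (n : ℝ)) := fun z hz =>
    exists_deck_of_proj_eq M (hF.mapsTo hz) (hG.mapsTo hz)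
      ((hF.proj_comp z hz).trans (hG.proj_comp z hz).symm)
  -- The difference of the two lifts is continuous with integer coordinates, hence constant on the
  -- connected strip.
  have hdisc : IsDiscrete (range ((↑) : ℤ → ℝ)) := Int.isClosedEmbedding_coe_real.isEmbedding.isDiscrete_range
  have h0 : (0 : ℝ × ℝ) ∈ M.strip := mem_strip_of_mem_Icc M (by simp)
  obtain ⟨m, n, hn, h⟩ := key 0 h0
  refine ⟨m, n, hn, fun z hz => ?_⟩
  have hc : ContinuousOn (fun z => F z - G z) M.strip :=
    hF.contDiffOn.continuousOn.sub hG.contDiffOn.continuousOn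
  have e1 := (isPreconnected_strip M).constant_of_mapsTo hdisc
    (continuous_fst.comp_continuousOn hc)
    (fun w hw => by
      obtain ⟨m', n', _, h'⟩ := key w hw
      exact ⟨m', by simp [h']⟩) hz h0
  have e2 := (isPreconnected_strip M).constant_of_mapsTo hdisc
    (continuous_snd.comp_continuousOn hc)
    (fun w hw => by
      obtain ⟨m', n', _, h'⟩ := key w hw
      exact ⟨n', by simp [h']⟩) hz h0
  simp only [Function.comp_apply, h, add_sub_cancel_left] at e1 e2
  have e3 : F z - G z = ((m : ℝ), (n : ℝ)) := Prod.ext e1 e2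
  rw [← e3]
  abel

/-- The distances use arbitrarily chosen lifts, known to be smooth only on the strip. On the open
square these differ from the global lifts by deck translations, which the infimum absorbs at order
zero and differentiation kills at higher orders. Estimates on plane maps thus suffice. -/
theorem liftDist_le {M : Surface} {F G F' G' : ℝ × ℝ → ℝ × ℝ} {f g : M.Pt → M.Pt}
    (hF : M.IsSmoothLift F f) (hF' : M.IsSmoothLift F' f) (hG : M.IsSmoothLift G g)
    (hG' : M.IsSmoothLift G' g) (h1 : ContDiff ℝ ∞ F) (h2 : ContDiff ℝ ∞ G) {k : ℕ} {e : ℝ}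
    (h : ∀ i ≤ k, ∀ z, ‖iteratedFDeriv ℝ i (fun w => F w - G w) z‖ ≤ e) :
    liftDist M k F' G' ≤ e := by
  have he : 0 ≤ e := (norm_nonneg _).trans (h 0 (Nat.zero_le k) 0)
  obtain ⟨m, n, hn, hFF⟩ := exists_eqOn_of_isSmoothLift hF hF'
  obtain ⟨m', n', hn', hGG⟩ := exists_eqOn_of_isSmoothLift hG hG'
  have hd : n - n' ∈ M.deck := by
    cases M
    · have h1 : n = 0 := hn
      have h2 : n' = 0 := hn'
      rw [h1, h2]
      exact sub_self 0
    · exact mem_univ _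
  set c : ℝ := ((m - m' : ℤ) : ℝ)
  set c' : ℝ := ((n - n' : ℤ) : ℝ)
  have hopen : IsOpen (Ioo (0 : ℝ) 1 ×ˢ Ioo (0 : ℝ) 1) := isOpen_Ioo.prod isOpen_Ioo
  set D : ℝ × ℝ → ℝ × ℝ := fun w => F w - G w
  have hD : ContDiff ℝ ∞ D := h1.sub h2
  have hb1 (i : ℕ) (hi : i ≤ k) (z : ℝ × ℝ) : ‖iteratedFDeriv ℝ i (fun w => (D w).1) z‖ ≤ e := by
    refine ((ContinuousLinearMap.fst ℝ ℝ ℝ).norm_iteratedFDeriv_comp_left (N := ∞)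
      hD.contDiffAt (by exact_mod_cast le_top)).trans ?_
    exact (mul_le_of_le_one_left (norm_nonneg _) (ContinuousLinearMap.norm_fst_le ℝ ℝ ℝ)).trans
      (h i hi z)
  have hb2 (i : ℕ) (hi : i ≤ k) (z : ℝ × ℝ) : ‖iteratedFDeriv ℝ i (fun w => (D w).2) z‖ ≤ e := by
    refine ((ContinuousLinearMap.snd ℝ ℝ ℝ).norm_iteratedFDeriv_comp_left (N := ∞)
      hD.contDiffAt (by exact_mod_cast le_top)).trans ?_
    exact (mul_le_of_le_one_left (norm_nonneg _) (ContinuousLinearMap.norm_snd_le ℝ ℝ ℝ)).trans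
      (h i hi z)
  have q1 : EqOn (fun z => (F' z).1 - (G' z).1) (fun z => (D z).1 + (-c))
      (Ioo (0 : ℝ) 1 ×ˢ Ioo (0 : ℝ) 1) := fun z hz => by
    have hz' := square_subset_strip M hz
    simp only [D, hFF z hz', hGG z hz', c]
    simp
    ring
  have q2 : EqOn (fun z => (F' z).2 - (G' z).2) (fun z => (D z).2 + (-c'))
      (Ioo (0 : ℝ) 1 ×ˢ Ioo (0 : ℝ) 1) := fun z hz => by
    have hz' := square_subset_strip M hz
    simp only [D, hFF z hz', hGG z hz', c']
    simp
    ring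
  refine Real.sSup_le ?_ he
  rintro s (rfl | ⟨a, ha1, hak, rfl | rfl⟩)
  · refine max_le ?_ ?_
    · refine (ciInf_le ⟨0, by rintro _ ⟨p, rfl⟩; exact supNorm_nonneg _⟩ (m - m')).trans
        (supNorm_le he fun z hz => ?_)
      have := q1 hz
      simp only at this
      rw [this, neg_add_cancel_right]
      simpa using hb1 0 (Nat.zero_le k) z
    · refine (ciInf_le ⟨0, by rintro _ ⟨p, rfl⟩; exact supNorm_nonneg _⟩
        (⟨n - n', hd⟩ : M.deck)).trans (supNorm_le he fun z hz => ?_)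
      have := q2 hz
      simp only at this
      rw [this, neg_add_cancel_right]
      simpa using hb2 0 (Nat.zero_le k) z
  · refine supNorm_le he fun z hz => ?_
    rw [partialD_eqOn hopen q1 a hz, partialD_add_const ha1]
    exact (abs_partialD_le (contDiff_fst.comp hD) a z).trans (hb1 _ hak z)
  · refine supNorm_le he fun z hz => ?_
    rw [partialD_eqOn hopen q2 a hz, partialD_add_const ha1]
    exact (abs_partialD_le (contDiff_snd.comp hD) a z).trans (hb2 _ hak z)

theorem distC_desc_le (M : Surface) {F G : coverGroup} {k : ℕ} {e : ℝ}
    (h1 : ∀ i ≤ k, ∀ z, ‖iteratedFDeriv ℝ i (fun w => F.1 w - G.1 w) z‖ ≤ e)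
    (h2 : ∀ i ≤ k, ∀ z, ‖iteratedFDeriv ℝ i (fun w => F.1.symm w - G.1.symm w) z‖ ≤ e) :
    (desc M F).distC k (desc M G) ≤ e := by
  refine max_le ?_ ?_
  · exact liftDist_le (desc_isSmoothLift M F) (desc M F).smooth_toFun.choose_spec
      (desc_isSmoothLift M G) (desc M G).smooth_toFun.choose_spec F.2.1.contDiff G.2.1.contDiff h1
  · rw [← map_inv, ← map_inv]
    exact liftDist_le (desc_isSmoothLift M F⁻¹) (desc M F⁻¹).smooth_toFun.choose_spec
      (desc_isSmoothLift M G⁻¹) (desc M G⁻¹).smooth_toFun.choose_spec F.2.2.contDiff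
      G.2.2.contDiff h2

/-- Closeness in finitely many of the distances `d_k` implies closeness in `d_∞`. -/
theorem exists_distInfty_lt (M : Surface) {ε : ℝ} (hε : 0 < ε) :
    ∃ K : ℕ, ∃ e > 0, ∀ f g : Diff M, (∀ k ≤ K, f.distC k g ≤ e) → f.distInfty g < ε := by
  obtain ⟨K, hK⟩ := exists_pow_lt_of_lt_one (half_pos hε) (by norm_num : (1 / 2 : ℝ) < 1)
  refine ⟨K, ε / 4, by positivity, fun f g h => ?_⟩
  set t : ℕ → ℝ := fun k => f.distC (k + 1) g / (2 ^ (k + 1) * (1 + f.distC (k + 1) g))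
  have hgeo : HasSum (fun k : ℕ => (1 / 2 : ℝ) ^ (k + 1)) 1 := by
    have := (hasSum_geometric_of_lt_one (by norm_num) (by norm_num : (1 / 2 : ℝ) < 1)).mul_left
      (1 / 2)
    have e : (fun k : ℕ => (1 / 2 : ℝ) ^ (k + 1)) = fun k => 1 / 2 * (1 / 2) ^ k :=
      funext fun k => pow_succ' _ _
    rw [e]
    norm_num at this ⊢
    exact this
  have h0 (k) : 0 ≤ t k := by
    have := distC_nonneg (k + 1) f g
    positivity
  have h1 (k) : t k ≤ (1 / 2 : ℝ) ^ (k + 1) := by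
    have := distC_nonneg (k + 1) f g
    simp only [t]
    rw [div_le_iff₀ (by positivity), ← mul_assoc, ← mul_pow]
    norm_num
  have h2 (k) (hk : k < K) : t k ≤ ε / 4 * (1 / 2 : ℝ) ^ (k + 1) := by
    have h3 := distC_nonneg (k + 1) f g
    simp only [t]
    rw [div_le_iff₀ (by positivity), mul_assoc, ← mul_assoc ((1 / 2 : ℝ) ^ (k + 1)), ← mul_pow]
    norm_num
    nlinarith [h (k + 1) hk]
  have hs : Summable t := Summable.of_nonneg_of_le h0 h1 hgeo.summable
  -- The first `K` terms are small because the distances are; the tail is below `(1 / 2) ^ K < ε /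
  -- 2`. The total is less than `ε / 4 + ε / 2`.
  have hlt : ∀ k, t k ≤ ε / 4 * (1 / 2 : ℝ) ^ (k + 1) + if k < K then 0 else (1 / 2 : ℝ) ^ (k + 1) := by
    intro k
    split_ifs with hk
    · simpa using h2 k hk
    · have : 0 ≤ ε / 4 * (1 / 2 : ℝ) ^ (k + 1) := by positivity
      linarith [h1 k]
  have hs2 : HasSum (fun k : ℕ => if k < K then 0 else (1 / 2 : ℝ) ^ (k + 1)) ((1 / 2) ^ K) := by
    rw [← hasSum_nat_add_iff' K]
    have : ∑ i ∈ Finset.range K, (if i < K then 0 else (1 / 2 : ℝ) ^ (i + 1)) = 0 :=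
      Finset.sum_eq_zero fun i hi => if_pos (Finset.mem_range.1 hi)
    rw [this, sub_zero]
    have e : (fun k : ℕ => if k + K < K then 0 else (1 / 2 : ℝ) ^ (k + K + 1))
        = fun k => (1 / 2) ^ K * (1 / 2) ^ (k + 1) := funext fun k => by
      rw [if_neg (by omega), ← pow_add]
      congr 1
      omega
    rw [e]
    simpa only [mul_one] using hgeo.mul_left ((1 / 2) ^ K)
  have := hasSum_le hlt hs.hasSum ((hgeo.mul_left (ε / 4)).add hs2)
  change ∑' k, t k < ε
  linarith

/-! ### The torus -/

/-- The torus as a product of two circles. -/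
abbrev Torus : Type := UnitAddCircle × UnitAddCircle

/-- The covering map of the torus. -/
noncomputable def torusProj (z : ℝ × ℝ) : Torus := ((z.1 : UnitAddCircle), (z.2 : UnitAddCircle))

/-- The map of the torus induced by a global lift. -/
noncomputable def torusMap (H : coverGroup) : Torus → Torus := desc Surface.torus H

theorem torusMap_torusProj (H : coverGroup) (z : ℝ × ℝ) :
    torusMap H (torusProj z) = torusProj (H.1 z) :=
  desc_apply_proj Surface.torus H (mem_univ z)

theorem torusMap_mul (H K : coverGroup) (x : Torus) :
    torusMap (H * K) x = torusMap H (torusMap K x) := by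
  unfold torusMap
  rw [map_mul]
  rfl

theorem torusMap_one (x : Torus) : torusMap 1 x = x := by
  unfold torusMap
  rw [map_one]
  rfl

theorem torusMap_pow (H : coverGroup) (m : ℕ) : torusMap (H ^ m) = (torusMap H)^[m] := by
  induction m with
  | zero => funext x; exact torusMap_one x
  | succ m ih =>
    funext x
    rw [pow_succ', torusMap_mul, ih, Function.iterate_succ_apply']

theorem torusProj_surjective : Function.Surjective torusProj := fun x =>
  let ⟨z, _, hz⟩ := exists_proj_eq Surface.torus x
  ⟨z, hz⟩

theorem isOpenQuotientMap_torusProj : IsOpenQuotientMap torusProj :=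
  QuotientAddGroup.isOpenQuotientMap_mk.prodMap QuotientAddGroup.isOpenQuotientMap_mk

theorem continuous_torusProj : Continuous torusProj := isOpenQuotientMap_torusProj.continuous

theorem continuous_torusMap (H : coverGroup) : Continuous (torusMap H) := by
  rw [isOpenQuotientMap_torusProj.isQuotientMap.continuous_iff]
  have : torusMap H ∘ torusProj = torusProj ∘ H.1 := funext (torusMap_torusProj H)
  rw [this]
  exact continuous_torusProj.comp H.2.1.contDiff.continuous

theorem torusProj_add_int (z : ℝ × ℝ) (m n : ℤ) :
    torusProj (z + ((m : ℝ), (n : ℝ))) = torusProj z :=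
  proj_add_deck Surface.torus z m (mem_univ n)

/-- Preservation of area on the torus. -/
def TorusPreserving (H : coverGroup) : Prop := MeasurePreserving (torusMap H) volume volume

theorem TorusPreserving.mul {H K : coverGroup} (hH : TorusPreserving H) (hK : TorusPreserving K) :
    TorusPreserving (H * K) := by
  have : torusMap (H * K) = torusMap H ∘ torusMap K := funext (torusMap_mul H K)
  rw [TorusPreserving, this]
  exact MeasurePreserving.comp hH hK

theorem torusPreserving_one : TorusPreserving 1 := by
  have : torusMap 1 = id := funext torusMap_one
  rw [TorusPreserving, this]
  exact MeasurePreserving.id _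

theorem TorusPreserving.inv {H : coverGroup} (hH : TorusPreserving H) : TorusPreserving H⁻¹ := by
  have h1 : torusMap H⁻¹ ∘ torusMap H = id := funext fun x => by
    rw [Function.comp_apply, ← torusMap_mul, inv_mul_cancel, torusMap_one, id]
  refine ⟨(continuous_torusMap _).measurable, ?_⟩
  have h2 : Measure.map (torusMap H) volume = volume := MeasurePreserving.map_eq hH
  conv_lhs => rw [← h2]
  rw [Measure.map_map (continuous_torusMap _).measurable (continuous_torusMap _).measurable, h1,
    Measure.map_id]

theorem measurePreserving_torusProj :
    MeasurePreserving torusProj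
      ((volume : Measure (ℝ × ℝ)).restrict (Ico (0 : ℝ) 1 ×ˢ Ico (0 : ℝ) 1)) volume := by
  have h := UnitAddCircle.measurePreserving_mk 0
  rw [zero_add, ← Measure.restrict_congr_set (Ico_ae_eq_Ioc (a := (0 : ℝ)) (b := 1))] at h
  have h2 := h.prod h
  rw [Measure.prod_restrict] at h2
  exact h2

/-- The plane map preserves both Lebesgue measure and the unit square, and the restriction of
Lebesgue measure to that square projects to the measure of the torus. -/
theorem torusPreserving_twistCover {κ : ℝ} (hκ : 0 < κ) (q : ℕ) :
    TorusPreserving (twistCover hκ q) := by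
  set s : Set (ℝ × ℝ) := Ico (0 : ℝ) 1 ×ˢ Ico (0 : ℝ) 1
  set F := (twistCover hκ q).1
  have hF : MeasurePreserving F := measurePreserving_conj_dilation hκ 1 q
  have hpre : F ⁻¹' s = s := by
    ext z
    refine ⟨fun h => ?_, fun h => conj_dilation_mem_square hκ 1 q h⟩
    have := conj_dilation_mem_square hκ (-1) q h
    have e : contraction q (cellTwist κ (-1) (dilation q (F z))) = z := F.symm_apply_apply z
    rwa [e] at this
  have hs : MeasurableSet s := measurableSet_Ico.prod measurableSet_Ico
  have h1 : MeasurePreserving F ((volume : Measure (ℝ × ℝ)).restrict s)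
      ((volume : Measure (ℝ × ℝ)).restrict s) := by
    have := hF.restrict_preimage hs
    rwa [hpre] at this
  refine ⟨(continuous_torusMap _).measurable, ?_⟩
  have e : torusMap (twistCover hκ q) ∘ torusProj = torusProj ∘ F :=
    funext (torusMap_torusProj _)
  have hp := measurePreserving_torusProj
  conv_lhs => rw [← hp.map_eq]
  rw [Measure.map_map (continuous_torusMap _).measurable hp.measurable, e,
    (hp.comp h1).map_eq]

theorem torusMap_affineCover (k : ℤ) (t : ℝ) (x : Torus) :
    torusMap (affineCover k t) x = (x.1 + k • x.2 + (t : UnitAddCircle), x.2) := by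
  unfold torusMap
  rw [desc_affineCover]
  rfl

/-- After exchanging the coordinates this is a skew product acting by a translation on each fibre.
-/
theorem torusPreserving_affineCover (k : ℤ) (t : ℝ) : TorusPreserving (affineCover k t) := by
  have h : MeasurePreserving (fun p : Torus => (p.1, p.2 + (k • p.1 + (t : UnitAddCircle))))
      ((volume : Measure UnitAddCircle).prod volume)
      ((volume : Measure UnitAddCircle).prod volume) :=
    (MeasurePreserving.id _).skew_product (g := fun y x => x + (k • y + (t : UnitAddCircle)))
      (by fun_prop) (Eventually.of_forall fun y => map_add_right_eq_self _ _)
  have h2 := (Measure.measurePreserving_swap.comp h).comp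
    (Measure.measurePreserving_swap (μ := (volume : Measure UnitAddCircle))
      (ν := (volume : Measure UnitAddCircle)))
  have e : torusMap (affineCover k t) = (Prod.swap ∘
      (fun p : Torus => (p.1, p.2 + (k • p.1 + (t : UnitAddCircle))))) ∘ Prod.swap :=
    funext fun x => by
      rw [torusMap_affineCover]
      simp [add_assoc]
  rw [TorusPreserving, e]
  exact h2

theorem TorusPreserving.conjRot {H : coverGroup} (hH : TorusPreserving H) (t : ℝ) :
    TorusPreserving (conjRot H t) :=
  (hH.mul (torusPreserving_affineCover 0 t)).mul hH.inv

theorem integral_torus {E : Type*} [NormedAddCommGroup E] [NormedSpace ℝ E] {K : Torus → E}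
    (hK : Continuous K) :
    ∫ x, K x = ∫ s in (0 : ℝ)..1, ∫ t in (0 : ℝ)..1, K (torusProj (s, t)) := by
  have hi : Integrable K volume :=
    hK.integrable_of_hasCompactSupport (HasCompactSupport.of_compactSpace K)
  have h1 : ∫ x, K x = ∫ a : UnitAddCircle, ∫ b : UnitAddCircle, K (a, b) :=
    integral_prod K hi
  rw [h1, ← UnitAddCircle.intervalIntegral_preimage 0, zero_add]
  congr 1
  funext s
  rw [← UnitAddCircle.intervalIntegral_preimage 0, zero_add]
  rfl

/-! ### Comparison of the annulus with the torus -/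

/-- The annulus as a product. -/
abbrev Annulus : Type := UnitAddCircle × Icc (0 : ℝ) 1

/-- The map of the annulus induced by a global lift. -/
noncomputable def annulusMap (H : coverGroup) : Annulus → Annulus := desc Surface.annulus H

/-- The map gluing the boundary components of the annulus. -/
noncomputable def glue (x : Annulus) : Torus := (x.1, ((x.2 : ℝ) : UnitAddCircle))

/-- A measurable section of `glue`. -/
noncomputable def cut (x : Torus) : Annulus :=
  (x.1, projIcc (0 : ℝ) 1 zero_le_one (AddCircle.measurableEquivIoc (1 : ℝ) 0 x.2 : ℝ))

theorem measurable_glue : Measurable glue :=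
  measurable_fst.prodMk (AddCircle.measurable_mk'.comp (measurable_subtype_coe.comp measurable_snd))

theorem measurable_cut : Measurable cut :=
  measurable_fst.prodMk (continuous_projIcc.measurable.comp (measurable_subtype_coe.comp
    ((AddCircle.measurableEquivIoc (1 : ℝ) 0).measurable.comp measurable_snd)))

theorem cut_glue {x : Annulus} (hx : (x.2 : ℝ) ≠ 0) : cut (glue x) = x := by
  have h0 : (x.2 : ℝ) ∈ Ioc (0 : ℝ) (0 + 1) :=
    ⟨lt_of_le_of_ne x.2.2.1 hx.symm, by simpa using x.2.2.2⟩
  refine Prod.ext rfl ?_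
  have h : AddCircle.measurableEquivIoc (1 : ℝ) 0 (((x.2 : ℝ) : UnitAddCircle)) = ⟨x.2, h0⟩ :=
    (AddCircle.measurableEquivIoc (1 : ℝ) 0).apply_symm_apply ⟨x.2, h0⟩
  change projIcc (0 : ℝ) 1 zero_le_one
    (AddCircle.measurableEquivIoc (1 : ℝ) 0 (((x.2 : ℝ) : UnitAddCircle)) : ℝ) = x.2
  rw [h]
  exact projIcc_val zero_le_one x.2

theorem glue_cut (x : Torus) : glue (cut x) = x := by
  refine Prod.ext rfl ?_
  have h := (AddCircle.measurableEquivIoc (1 : ℝ) 0).symm_apply_apply x.2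
  have h0 := (AddCircle.measurableEquivIoc (1 : ℝ) 0 x.2).2
  change (((projIcc (0 : ℝ) 1 zero_le_one (AddCircle.measurableEquivIoc (1 : ℝ) 0 x.2 : ℝ) :
    Icc (0 : ℝ) 1) : ℝ) : UnitAddCircle) = x.2
  rw [projIcc_of_mem zero_le_one ⟨h0.1.le, by simpa using h0.2⟩]
  exact h

theorem measurePreserving_glue : MeasurePreserving glue volume volume := by
  have h1 : MeasurePreserving (Subtype.val : Icc (0 : ℝ) 1 → ℝ) volume
      (volume.restrict (Icc 0 1)) := measurePreserving_subtype_coe measurableSet_Icc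
  have h2 := UnitAddCircle.measurePreserving_mk 0
  rw [zero_add] at h2
  rw [← Measure.restrict_congr_set (Ioc_ae_eq_Icc (a := (0 : ℝ)) (b := 1))] at h1
  exact (MeasurePreserving.id (volume : Measure UnitAddCircle)).prod (h2.comp h1)

theorem ae_annulus_ne_zero : ∀ᵐ x : Annulus, (x.2 : ℝ) ≠ 0 := by
  have h : ∀ᵐ r : Icc (0 : ℝ) 1, (r : ℝ) ≠ 0 := by
    have h1 : MeasurePreserving (Subtype.val : Icc (0 : ℝ) 1 → ℝ) volume
      (volume.restrict (Icc 0 1)) := measurePreserving_subtype_coe measurableSet_Icc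
    refine h1.quasiMeasurePreserving.ae (p := fun x => x ≠ 0) (ae_restrict_of_ae ?_)
    simp [ae_iff]
  exact Measure.quasiMeasurePreserving_snd.ae h

theorem measurePreserving_cut : MeasurePreserving cut volume volume := by
  refine ⟨measurable_cut, ?_⟩
  conv_lhs => rw [← measurePreserving_glue.map_eq]
  rw [Measure.map_map measurable_cut measurable_glue]
  have : cut ∘ glue =ᵐ[volume] id := by
    filter_upwards [ae_annulus_ne_zero] with x hx using cut_glue hx
  rw [Measure.map_congr this, Measure.map_id]

theorem glue_annulusMap (H : coverGroup) (x : Annulus) :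
    glue (annulusMap H x) = torusMap H (glue x) := by
  obtain ⟨z, hz, hx⟩ := exists_proj_eq Surface.annulus x
  have e : ∀ z ∈ Surface.annulus.strip, glue (Surface.annulus.proj z) = torusProj z :=
    fun z hz => Prod.ext rfl (by
      change (((projIcc (0 : ℝ) 1 zero_le_one z.2 : Icc (0 : ℝ) 1) : ℝ) : UnitAddCircle) = z.2
      rw [projIcc_of_mem zero_le_one hz.2])
  have h2 : annulusMap H x = Surface.annulus.proj (H.1 z) := by
    rw [← hx]
    exact desc_apply_proj Surface.annulus H hz
  have h3 : glue x = torusProj z := by rw [← hx]; exact e z hz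
  rw [h2, h3, torusMap_torusProj]
  exact e _ (H.2.1.mapsTo_strip _ hz)

/-- Gluing intertwines the two actions everywhere, and `cut` inverts it off the boundary circle `r =
0`. Area preservation on the torus makes the points mapped into that circle negligible. -/
theorem annulusMap_cut_ae {H : coverGroup} (hH : TorusPreserving H) :
    annulusMap H ∘ cut =ᵐ[volume] cut ∘ torusMap H := by
  have h0 : ∀ᵐ y : Torus, y.2 ≠ 0 := by
    refine Measure.quasiMeasurePreserving_snd.ae (p := fun y : UnitAddCircle => y ≠ 0) ?_
    have h := AddCircle.volume_closedBall (1 : ℝ) (x := 0) 0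
    rw [Metric.closedBall_zero] at h
    simp [ae_iff, h]
  filter_upwards [(MeasurePreserving.quasiMeasurePreserving hH).ae h0] with y hy
  have h1 : glue (annulusMap H (cut y)) = torusMap H y := by rw [glue_annulusMap, glue_cut]
  rw [Function.comp_apply, Function.comp_apply, ← h1, cut_glue]
  intro h
  apply hy
  rw [← h1]
  change (((annulusMap H (cut y)).2 : ℝ) : UnitAddCircle) = 0
  rw [h]
  rfl

theorem continuous_annulusMap (H : coverGroup) : Continuous (annulusMap H) := by
  have hemb : IsClosedEmbedding (fun z : ℝ × Icc (0 : ℝ) 1 => (z.1, (z.2 : ℝ))) :=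
    (IsClosedEmbedding.id).prodMap isClosed_Icc.isClosedEmbedding_subtypeVal
  have hq : IsOpenQuotientMap (Prod.map ((↑) : ℝ → UnitAddCircle) (id : Icc (0 : ℝ) 1 → _)) :=
    QuotientAddGroup.isOpenQuotientMap_mk.prodMap IsOpenQuotientMap.id
  rw [hq.isQuotientMap.continuous_iff]
  have : annulusMap H ∘ Prod.map ((↑) : ℝ → UnitAddCircle) (id : Icc (0 : ℝ) 1 → _)
      = (fun z : ℝ × ℝ => ((z.1 : UnitAddCircle), projIcc (0 : ℝ) 1 zero_le_one z.2)) ∘ H.1 ∘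
        fun z : ℝ × Icc (0 : ℝ) 1 => (z.1, (z.2 : ℝ)) := by
    funext z
    have hz : (z.1, (z.2 : ℝ)) ∈ Surface.annulus.strip := ⟨mem_univ _, z.2.2⟩
    have h := desc_apply_proj Surface.annulus H hz
    have e : Surface.annulus.proj (z.1, (z.2 : ℝ))
        = Prod.map ((↑) : ℝ → UnitAddCircle) (id : Icc (0 : ℝ) 1 → _) z :=
      Prod.ext rfl (projIcc_val zero_le_one z.2)
    rw [e] at h
    exact h
  rw [this]
  refine Continuous.comp ?_ (H.2.1.contDiff.continuous.comp hemb.continuous)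
  exact ((AddCircle.continuous_mk' 1).comp continuous_fst).prodMk
    (continuous_projIcc.comp continuous_snd)

theorem measurePreserving_annulusMap {H : coverGroup} (hH : TorusPreserving H) :
    MeasurePreserving (annulusMap H) volume volume := by
  refine ⟨(continuous_annulusMap H).measurable, ?_⟩
  conv_lhs => rw [← measurePreserving_cut.map_eq]
  rw [Measure.map_map (continuous_annulusMap H).measurable measurable_cut,
    Measure.map_congr (annulusMap_cut_ae hH),
    (measurePreserving_cut.comp hH).map_eq]

theorem TorusPreserving.areaPreserving {H : coverGroup} (hH : TorusPreserving H) (M : Surface) :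
    (desc M H).AreaPreserving := by
  cases M
  · exact measurePreserving_annulusMap hH
  · exact hH

/-- Every measurable eigenfunction on the torus is almost everywhere constant. -/
def TorusEigenConst (H : coverGroup) : Prop :=
  ∀ (u : Torus → ℂ) (c : ℂ), Measurable u → (∀ᵐ x, u (torusMap H x) = c * u x) →
    ∃ b : ℂ, ∀ᵐ x, u x = b

theorem TorusEigenConst.annulus {H : coverGroup} (hH : TorusPreserving H)
    (h : TorusEigenConst H) (u : Annulus → ℂ) (c : ℂ) (hu : Measurable u)
    (hc : ∀ᵐ x, u (annulusMap H x) = c * u x) : ∃ b : ℂ, ∀ᵐ x, u x = b := by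
  obtain ⟨b, hb⟩ := h (u ∘ cut) c (hu.comp measurable_cut) (by
    filter_upwards [annulusMap_cut_ae hH, measurePreserving_cut.quasiMeasurePreserving.ae hc]
      with x h1 h2
    simp only [Function.comp_apply] at h1 ⊢
    rw [← h1, h2])
  refine ⟨b, ?_⟩
  filter_upwards [measurePreserving_glue.quasiMeasurePreserving.ae hb, ae_annulus_ne_zero]
    with x h1 h2
  rwa [Function.comp_apply, cut_glue h2] at h1

theorem weakMixing_desc {H : coverGroup} (hH : TorusPreserving H) (h : TorusEigenConst H)
    (M : Surface) : (desc M H).WeakMixing := by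
  refine ⟨hH.areaPreserving M, ?_⟩
  cases M
  · exact h.annulus hH
  · exact h

/-! ### Mixing along twisted fibres -/

theorem intervalIntegral_swap {E : Type*} [NormedAddCommGroup E] [NormedSpace ℝ E]
    (f : ℝ → ℝ → E) (hf : Continuous (Function.uncurry f)) :
    ∫ x in (0 : ℝ)..1, ∫ y in (0 : ℝ)..1, f x y = ∫ y in (0 : ℝ)..1, ∫ x in (0 : ℝ)..1, f x y := by
  simp only [intervalIntegral.integral_of_le zero_le_one]
  refine integral_integral_swap ?_
  rw [Measure.prod_restrict]
  exact (hf.continuousOn.integrableOn_compact (isCompact_Icc.prod isCompact_Icc)).mono_set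
    (prod_mono Ioc_subset_Icc_self Ioc_subset_Icc_self)

/-- Equidistribution of a steep closed curve. Moving it horizontally by `s ≤ 1` is, after
reparametrization, a vertical move by `s / B`, so the integral of `F` along it hardly depends on
`θ`; its average over `θ` is the double integral. -/
theorem integral_shear_near_integral {E : Type*} [NormedAddCommGroup E] [NormedSpace ℝ E]
    [CompleteSpace E] {F : ℝ × ℝ → E} (hF : Continuous F)
    (hp : ∀ (z : ℝ × ℝ) (m n : ℤ), F (z + ((m : ℝ), (n : ℝ))) = F z) {e δ : ℝ}
    (he : ∀ z w : ℝ × ℝ, dist z w < δ → ‖F z - F w‖ ≤ e) {B : ℤ} (hB : 1 ≤ B)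
    (hδ : 1 / (B : ℝ) < δ) (θ : ℝ) :
    ‖(∫ y in (0 : ℝ)..1, F (θ + B * y, y)) - ∫ x in (0 : ℝ)..1, ∫ y in (0 : ℝ)..1, F (x, y)‖
      ≤ e := by
  have hB0 : (0 : ℝ) < B := by exact_mod_cast hB
  set P : ℝ → E := fun θ => ∫ y in (0 : ℝ)..1, F (θ + B * y, y) with hP
  have hPc : Continuous P :=
    intervalIntegral.continuous_parametric_intervalIntegral_of_continuous'
      (f := fun θ y => F (θ + B * y, y)) (hF.comp (by fun_prop)) 0 1
  have hshift : ∀ s ∈ Icc (0 : ℝ) 1, ‖P θ - P (θ + s)‖ ≤ e := by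
    intro s hs
    set k : ℝ → E := fun y => F (θ + B * y, y - s / B) with hk
    have hkp : Function.Periodic k 1 := fun y => by
      have := hp (θ + B * y, y - s / B) B 1
      simp only [hk]
      rw [← this]
      congr 1
      ext <;> simp <;> ring
    have e1 : P (θ + s) = ∫ y in (0 : ℝ)..1, k y := by
      have h1 : P (θ + s) = ∫ y in (0 : ℝ)..1, k (y + s / B) := by
        simp only [hP, hk]
        congr 1
        funext y
        congr 1
        ext
        · simp only; field_simp; ring
        · simp
      rw [h1, intervalIntegral.integral_comp_add_right, zero_add, add_comm (1 : ℝ),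
        hkp.intervalIntegral_add_eq (s / B) 0, zero_add]
    have i1 : IntervalIntegrable (fun y => F (θ + B * y, y)) volume 0 1 :=
      (hF.comp (by fun_prop)).intervalIntegrable _ _
    have i2 : IntervalIntegrable k volume 0 1 :=
      (hF.comp (by fun_prop)).intervalIntegrable _ _
    rw [e1, hP]
    simp only
    rw [← intervalIntegral.integral_sub i1 i2]
    refine (intervalIntegral.norm_integral_le_of_norm_le_const (C := e) fun y _ => ?_).trans
      (by simp)
    refine he _ _ ?_
    rw [Prod.dist_eq, dist_self, Real.dist_eq, sub_sub_cancel]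
    have h0 : 0 ≤ s / B := div_nonneg hs.1 hB0.le
    rw [max_eq_right (abs_nonneg _), abs_of_nonneg h0]
    exact (div_le_div_of_nonneg_right hs.2 hB0.le).trans_lt hδ
  have hmean : ∫ s in (0 : ℝ)..1, P (θ + s) = ∫ x in (0 : ℝ)..1, ∫ y in (0 : ℝ)..1, F (x, y) := by
    rw [intervalIntegral_swap (fun x y => F (x, y)) (hF.comp (by fun_prop))]
    simp only [hP]
    rw [intervalIntegral_swap (fun s y => F (θ + s + B * y, y)) (hF.comp (by fun_prop))]
    congr 1
    funext y
    have hper : Function.Periodic (fun x => F (x, y)) 1 := fun x => by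
      have := hp (x, y) 1 0
      simpa using this
    have h1 : (∫ s in (0 : ℝ)..1, F (θ + s + B * y, y))
        = ∫ s in (0 : ℝ)..1, (fun x => F (x, y)) (s + (θ + B * y)) := by
      congr 1
      funext s
      congr 1
      ext <;> simp; ring
    rw [h1, intervalIntegral.integral_comp_add_right (fun x => F (x, y)), zero_add,
      add_comm (1 : ℝ), hper.intervalIntegral_add_eq (θ + B * y) 0, zero_add]
  have i3 : IntervalIntegrable (fun s => P (θ + s)) volume 0 1 :=
    (hPc.comp (by fun_prop)).intervalIntegrable _ _
  have e2 : P θ - ∫ s in (0 : ℝ)..1, P (θ + s) = ∫ s in (0 : ℝ)..1, (P θ - P (θ + s)) := by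
    rw [intervalIntegral.integral_sub intervalIntegrable_const i3]
    simp
  change ‖P θ - _‖ ≤ e
  rw [← hmean, e2]
  refine (intervalIntegral.norm_integral_le_of_norm_le_const (C := e) fun s hs => ?_).trans
    (by simp)
  rw [uIoc_of_le zero_le_one] at hs
  exact hshift s (Ioc_subset_Icc_self hs)

theorem norm_sub_unit_mul_sq (a b ζ : ℂ) (hζ : ‖ζ‖ = 1) :
    ‖a - ζ * b‖ ^ 2 = ‖a‖ ^ 2 + ‖b‖ ^ 2 - 2 * (starRingEnd ℂ a * ζ * b).re := by
  have h : ‖ζ * b‖ ^ 2 = ‖b‖ ^ 2 := by rw [norm_mul, hζ, one_mul]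
  rw [← h, ← Complex.normSq_eq_norm_sq, ← Complex.normSq_eq_norm_sq, ← Complex.normSq_eq_norm_sq,
    Complex.normSq_sub]
  congr 2
  simp
  ring

/-- Expanding the square, the cross term is twice the real part of a number of modulus at most `‖∫
A‖`, whatever the unimodular `ζ`. -/
theorem le_integral_norm_sub_sq {A : ℝ → ℂ} (hA : Continuous A) {a ζ : ℂ} (ha : ‖a‖ ≤ 1)
    (hζ : ‖ζ‖ = 1) {s t : ℝ} :
    (t - s) * ‖a‖ ^ 2 + (∫ y in s..t, ‖A y‖ ^ 2) - 2 * ‖∫ y in s..t, A y‖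
      ≤ ∫ y in s..t, ‖a - ζ * A y‖ ^ 2 := by
  have e : ∫ y in s..t, ‖a - ζ * A y‖ ^ 2 = (t - s) * ‖a‖ ^ 2 + (∫ y in s..t, ‖A y‖ ^ 2)
      - 2 * (starRingEnd ℂ a * ζ * ∫ y in s..t, A y).re := by
    have i1 : IntervalIntegrable (fun y => ‖A y‖ ^ 2) volume s t :=
      (by fun_prop : Continuous fun y => ‖A y‖ ^ 2).intervalIntegrable _ _
    have i2 : IntervalIntegrable (fun y => starRingEnd ℂ a * ζ * A y) volume s t :=
      (by fun_prop : Continuous fun y => starRingEnd ℂ a * ζ * A y).intervalIntegrable _ _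
    have i3 : IntervalIntegrable (fun y => 2 * (starRingEnd ℂ a * ζ * A y).re) volume s t :=
      (continuous_const.mul (Complex.continuous_re.comp (by fun_prop :
        Continuous fun y => starRingEnd ℂ a * ζ * A y))).intervalIntegrable _ _
    have e3 : ∫ y in s..t, 2 * (starRingEnd ℂ a * ζ * A y).re
        = 2 * (starRingEnd ℂ a * ζ * ∫ y in s..t, A y).re := by
      rw [intervalIntegral.integral_const_mul,
        ← intervalIntegral.integral_const_mul (starRingEnd ℂ a * ζ)]
      congr 1
      exact Complex.reCLM.intervalIntegral_comp_comm i2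
    simp only [norm_sub_unit_mul_sq _ _ _ hζ]
    rw [intervalIntegral.integral_sub (intervalIntegrable_const.add i1) i3,
      intervalIntegral.integral_add intervalIntegrable_const i1, e3]
    simp
  rw [e]
  have h1 := Complex.re_le_norm (starRingEnd ℂ a * ζ * ∫ y in s..t, A y)
  have h2 : ‖starRingEnd ℂ a * ζ * ∫ y in s..t, A y‖ ≤ ‖∫ y in s..t, A y‖ := by
    rw [norm_mul, norm_mul, hζ, mul_one, RCLike.norm_conj]
    exact mul_le_of_le_one_left (norm_nonneg _) ha
  linarith

/-- The lower bound on a product of a short interval and a nearly full interval. -/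
theorem le_integral_integral_norm_sub_sq {A : ℝ → ℂ} (hA : Continuous A) (hA1 : ∀ y, ‖A y‖ ≤ 1)
    {ζ : ℂ} (hζ : ‖ζ‖ = 1) {κ d m : ℝ} (hκ : 0 < κ) (hκ2 : κ ≤ 1 / 2)
    (hd : 1 - ∫ y in (0 : ℝ)..1, ‖A y‖ ^ 2 ≤ d) (hm : ‖∫ y in (0 : ℝ)..1, A y‖ ≤ m) :
    (1 - κ) * (κ - d) + κ * (1 - κ - d) - 2 * κ * (m + κ) ≤
      ∫ y₁ in (1 / 2 - κ / 2)..(1 / 2 + κ / 2), ∫ y₂ in (κ / 2)..(1 - κ / 2),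
        ‖A y₁ - ζ * A y₂‖ ^ 2 := by
  have hsq : Continuous fun y => ‖A y‖ ^ 2 := by fun_prop
  -- The nonnegative deficit `1 - ‖A y‖ ^ 2` has total at most `d`, hence at most `d` on any
  -- subinterval.
  have hpart : ∀ s t : ℝ, 0 ≤ s → s ≤ t → t ≤ 1 → t - s - d ≤ ∫ y in s..t, ‖A y‖ ^ 2 := by
    intro s t h0 hst h1
    have i1 (a b : ℝ) : IntervalIntegrable (fun y => ‖A y‖ ^ 2) volume a b :=
      hsq.intervalIntegrable _ _
    have hmono : ∫ y in s..t, (1 - ‖A y‖ ^ 2) ≤ ∫ y in (0 : ℝ)..1, (1 - ‖A y‖ ^ 2) := by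
      refine intervalIntegral.integral_mono_interval h0 hst h1 (Eventually.of_forall fun y => ?_)
        ((continuous_const.sub hsq).intervalIntegrable _ _)
      have := pow_le_one₀ (n := 2) (norm_nonneg _) (hA1 y)
      simpa using this
    rw [intervalIntegral.integral_sub intervalIntegrable_const (i1 _ _),
      intervalIntegral.integral_sub intervalIntegrable_const (i1 _ _)] at hmono
    simp at hmono
    linarith
  -- Only the second variable runs over nearly the full interval: this keeps the integral of `A`
  -- close to its mean, the two missing ends costing `κ / 2` each.
  have hM : ‖∫ y in (κ / 2)..(1 - κ / 2), A y‖ ≤ m + κ := by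
    have i1 (a b : ℝ) : IntervalIntegrable A volume a b := hA.intervalIntegrable _ _
    have e1 := intervalIntegral.integral_add_adjacent_intervals (i1 0 (κ / 2))
      (i1 (κ / 2) (1 - κ / 2))
    have e2 := intervalIntegral.integral_add_adjacent_intervals (i1 0 (1 - κ / 2))
      (i1 (1 - κ / 2) 1)
    have e3 : ∫ y in (κ / 2)..(1 - κ / 2), A y
        = (∫ y in (0 : ℝ)..1, A y) - (∫ y in (0 : ℝ)..(κ / 2), A y) - ∫ y in (1 - κ / 2)..1, A y := by
      rw [← e2, ← e1]; abel
    have n1 : ‖∫ y in (0 : ℝ)..(κ / 2), A y‖ ≤ κ / 2 :=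
      (intervalIntegral.norm_integral_le_of_norm_le_const (C := 1) fun y _ => hA1 y).trans (by
        rw [sub_zero, abs_of_pos (by positivity), one_mul])
    have n2 : ‖∫ y in (1 - κ / 2)..1, A y‖ ≤ κ / 2 :=
      (intervalIntegral.norm_integral_le_of_norm_le_const (C := 1) fun y _ => hA1 y).trans (by
        rw [sub_sub_cancel, abs_of_pos (by positivity), one_mul])
    rw [e3]
    have := norm_sub_le ((∫ y in (0 : ℝ)..1, A y) - (∫ y in (0 : ℝ)..(κ / 2), A y))
      (∫ y in (1 - κ / 2)..1, A y)
    have := norm_sub_le (∫ y in (0 : ℝ)..1, A y) (∫ y in (0 : ℝ)..(κ / 2), A y)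
    linarith
  set N2 := ∫ y in (κ / 2)..(1 - κ / 2), ‖A y‖ ^ 2
  set M2 := ‖∫ y in (κ / 2)..(1 - κ / 2), A y‖
  have h1 : ∫ y₁ in (1 / 2 - κ / 2)..(1 / 2 + κ / 2), ((1 - κ) * ‖A y₁‖ ^ 2 + (N2 - 2 * M2)) ≤
      ∫ y₁ in (1 / 2 - κ / 2)..(1 / 2 + κ / 2), ∫ y₂ in (κ / 2)..(1 - κ / 2),
        ‖A y₁ - ζ * A y₂‖ ^ 2 := by
    refine intervalIntegral.integral_mono (by linarith)
      ((by fun_prop : Continuous fun y => (1 - κ) * ‖A y‖ ^ 2 + (N2 - 2 * M2)).intervalIntegrable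
        _ _) ?_ fun y₁ => ?_
    · refine (intervalIntegral.continuous_parametric_intervalIntegral_of_continuous'
        (f := fun y₁ y₂ => ‖A y₁ - ζ * A y₂‖ ^ 2) ?_ _ _).intervalIntegrable _ _
      unfold Function.uncurry
      fun_prop
    · have := le_integral_norm_sub_sq hA (hA1 y₁) hζ (s := κ / 2) (t := 1 - κ / 2)
      simp only
      linarith
  refine le_trans ?_ h1
  rw [intervalIntegral.integral_add
    ((by fun_prop : Continuous fun y => (1 - κ) * ‖A y‖ ^ 2).intervalIntegrable _ _)
    intervalIntegrable_const, intervalIntegral.integral_const_mul, intervalIntegral.integral_const]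
  have n1 := hpart (1 / 2 - κ / 2) (1 / 2 + κ / 2) (by linarith) (by linarith) (by linarith)
  have n2 : 1 - κ / 2 - κ / 2 - d ≤ N2 := hpart (κ / 2) (1 - κ / 2) (by linarith) (by linarith)
    (by linarith)
  have n1' := mul_le_mul_of_nonneg_left n1 (by linarith : 0 ≤ 1 - κ)
  have n2' := mul_le_mul_of_nonneg_left n2 hκ.le
  have n3' := mul_le_mul_of_nonneg_left hM hκ.le
  rw [smul_eq_mul]
  have : (1 / 2 + κ / 2 - (1 / 2 - κ / 2)) = κ := by ring
  rw [this] at n1' ⊢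
  have h5 : κ * (N2 - 2 * M2) = κ * N2 - 2 * (κ * M2) := by ring
  rw [h5]
  linarith

/-- On the left half of a cell the normalized abscissa is `2 * s - 3 ≤ -1`, outside the ellipse. -/
theorem twistCover_apply_left {κ : ℝ} (hκ : 0 < κ) {q : ℕ} (hq : 1 ≤ q) (j : ℕ) {s : ℝ} (t : ℝ)
    (hs : s ∈ Icc (0 : ℝ) 1) :
    (twistCover hκ q).1 ((j + s / 2) / q, t) = ((j + s / 2) / q, t) := by
  have hq0 : (q : ℝ) ≠ 0 := by positivity
  have hd : dilation q ((j + s / 2) / q, t) = (j + s / 2, t) := by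
    rw [dilation_apply, Nat.max_eq_left hq]
    simp only
    rw [mul_div_cancel₀ _ hq0]
  rw [twistCover_apply, cellTwist_of_ge hκ, contraction_dilation]
  have hf : Int.fract ((j : ℝ) + s / 2) = s / 2 := by
    rw [Int.fract_natCast_add, Int.fract_eq_self.2 ⟨by linarith [hs.1], by linarith [hs.2]⟩]
  rw [hd, ellipseSq]
  simp only [hf]
  nlinarith [sq_nonneg (2 * Int.fract t - 1), hs.1, hs.2]

/-- The quarter turn exchanges the roles of the coordinates: `s` becomes the height, while `t`
survives only in the position inside a cell of width `1 / q`. -/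
theorem twistCover_apply_right {κ : ℝ} (hκ : 0 < κ) {q : ℕ} (hq : 1 ≤ q) (j : ℕ) {s t : ℝ}
    (hs : s ∈ Ico (0 : ℝ) 1) (ht : t ∈ Ico (0 : ℝ) 1)
    (h : (2 * s - 1) ^ 2 + (2 * t - 1) ^ 2 ≤ 1 - κ) :
    (twistCover hκ q).1 ((j + s / 2) / q + 1 / (2 * q), t) = ((j + 1 - t / 2) / q, s) := by
  have hq0 : (q : ℝ) ≠ 0 := by positivity
  have hd : dilation q ((j + s / 2) / q + 1 / (2 * q), t)
      = ((1 + s) / 2, t) + (((j : ℤ) : ℝ), ((0 : ℤ) : ℝ)) := by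
    rw [dilation_apply, Nat.max_eq_left hq]
    ext
    · simp only [Prod.mk_add_mk, Int.cast_natCast]
      field_simp
      ring
    · simp
  rw [twistCover_apply, hd, cellTwist_add ⟨⟨by linarith [hs.1], by linarith [hs.2]⟩, ht⟩,
    ellipseTwist_of_le hκ, contraction_apply, Nat.max_eq_left hq]
  · ext
    · simp only [Prod.mk_add_mk, Int.cast_natCast]
      field_simp
      ring
    · simp only [Prod.mk_add_mk, Int.cast_zero]
      ring
  · rw [ellipseSq]
    simp only
    convert h using 2
    ring

/-- Both norms are at most `2` and differ by at most `2 * e`, so their squares differ by at most `4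
* (2 * e)`. -/
theorem norm_sq_sub_le {a b a' b' ζ : ℂ} {e : ℝ} (ha : ‖a‖ ≤ 1) (hb : ‖b‖ ≤ 1) (ha' : ‖a'‖ ≤ 1)
    (hb' : ‖b'‖ ≤ 1) (hζ : ‖ζ‖ = 1) (h1 : ‖a - a'‖ ≤ e) (h2 : ‖b - b'‖ ≤ e) :
    ‖a - ζ * b‖ ^ 2 - 8 * e ≤ ‖a' - ζ * b'‖ ^ 2 := by
  have hz (w : ℂ) : ‖ζ * w‖ = ‖w‖ := by rw [norm_mul, hζ, one_mul]
  have n1 : ‖a - ζ * b‖ ≤ 2 := (norm_sub_le _ _).trans (by rw [hz]; linarith)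
  have n2 : ‖a' - ζ * b'‖ ≤ 2 := (norm_sub_le _ _).trans (by rw [hz]; linarith)
  have n3 : ‖a - ζ * b‖ - ‖a' - ζ * b'‖ ≤ 2 * e := by
    refine (norm_sub_norm_le _ _).trans ?_
    have : a - ζ * b - (a' - ζ * b') = (a - a') - ζ * (b - b') := by ring
    rw [this]
    exact (norm_sub_le _ _).trans (by rw [hz]; linarith)
  have he : 0 ≤ e := (norm_nonneg _).trans h1
  nlinarith [norm_nonneg (a - ζ * b), norm_nonneg (a' - ζ * b')]

/-- Integration of a pointwise lower bound over one period. -/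
theorem le_integral_cell {G : ℝ → ℝ → ℝ} (hGc : Continuous (Function.uncurry G))
    (hG0 : ∀ x y, 0 ≤ G x y) {A : ℝ → ℂ} (hAc : Continuous A) (ζ : ℂ) {κ e L : ℝ} (hκ : 0 < κ)
    (hκ2 : κ ≤ 1 / 2) (he0 : 0 ≤ e) {q : ℕ} (hq1 : 1 ≤ q) (j : ℕ)
    (hpt : ∀ y₁ ∈ Icc (1 / 2 - κ / 2) (1 / 2 + κ / 2), ∀ y₂ ∈ Icc (κ / 2) (1 - κ / 2),
        ‖A y₁ - ζ * A y₂‖ ^ 2 - 8 * e ≤ G ((j + y₁ / 2) / q) y₂)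
    (hloc : L ≤ ∫ y₁ in (1 / 2 - κ / 2)..(1 / 2 + κ / 2), ∫ y₂ in (κ / 2)..(1 - κ / 2),
        ‖A y₁ - ζ * A y₂‖ ^ 2) :
    1 / (2 * q) * (L - 8 * e) ≤
      ∫ x in ((j : ℕ) : ℝ) / q..((j + 1 : ℕ) : ℝ) / q, ∫ y in (0 : ℝ)..1, G x y := by
  have hq0 : (0 : ℝ) < q := by exact_mod_cast hq1
  set Φ : ℝ → ℝ := fun x => ∫ y in (0 : ℝ)..1, G x y with hΦ
  have hΦc : Continuous Φ :=
    intervalIntegral.continuous_parametric_intervalIntegral_of_continuous' hGc 0 1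
  have hΦ0 : ∀ x, 0 ≤ Φ x := fun x =>
    intervalIntegral.integral_nonneg zero_le_one fun y _ => hG0 x y
  have iΦ (a b : ℝ) : IntervalIntegrable Φ volume a b := hΦc.intervalIntegrable _ _
  have hinner : ∀ y₁ ∈ Icc (1 / 2 - κ / 2) (1 / 2 + κ / 2),
      (∫ y₂ in (κ / 2)..(1 - κ / 2), ‖A y₁ - ζ * A y₂‖ ^ 2) - 8 * e ≤ Φ ((j + y₁ / 2) / q) := by
    intro y₁ h1
    have i1 : IntervalIntegrable (fun y₂ => ‖A y₁ - ζ * A y₂‖ ^ 2) volume (κ / 2) (1 - κ / 2) :=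
      (by fun_prop : Continuous fun y₂ => ‖A y₁ - ζ * A y₂‖ ^ 2).intervalIntegrable _ _
    have c2 : Continuous fun y₂ => G ((j + y₁ / 2) / q) y₂ :=
      hGc.comp (by fun_prop : Continuous fun y₂ : ℝ => ((j + y₁ / 2) / q, y₂))
    have h3 : ∫ y₂ in (κ / 2)..(1 - κ / 2), (‖A y₁ - ζ * A y₂‖ ^ 2 - 8 * e)
        ≤ ∫ y₂ in (κ / 2)..(1 - κ / 2), G ((j + y₁ / 2) / q) y₂ :=
      intervalIntegral.integral_mono_on (by linarith) (i1.sub intervalIntegrable_const)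
        (c2.intervalIntegrable _ _) fun y₂ h2 => hpt y₁ h1 y₂ h2
    have h4 : ∫ y₂ in (κ / 2)..(1 - κ / 2), G ((j + y₁ / 2) / q) y₂ ≤ Φ ((j + y₁ / 2) / q) :=
      intervalIntegral.integral_mono_interval (by linarith) (by linarith) (by linarith)
        (Eventually.of_forall fun y => hG0 _ y) (c2.intervalIntegrable _ _)
    rw [intervalIntegral.integral_sub i1 intervalIntegrable_const,
      intervalIntegral.integral_const, smul_eq_mul] at h3
    nlinarith
  have houter : L - 8 * e ≤ ∫ y₁ in (1 / 2 - κ / 2)..(1 / 2 + κ / 2), Φ ((j + y₁ / 2) / q) := by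
    have cI : Continuous fun y₁ => ∫ y₂ in (κ / 2)..(1 - κ / 2), ‖A y₁ - ζ * A y₂‖ ^ 2 := by
      refine intervalIntegral.continuous_parametric_intervalIntegral_of_continuous'
        (f := fun y₁ y₂ => ‖A y₁ - ζ * A y₂‖ ^ 2) ?_ _ _
      unfold Function.uncurry
      fun_prop
    have h3 := intervalIntegral.integral_mono_on (a := 1 / 2 - κ / 2) (b := 1 / 2 + κ / 2)
      (μ := volume) (by linarith) ((cI.intervalIntegrable _ _).sub intervalIntegrable_const)
      ((hΦc.comp (by fun_prop : Continuous fun y₁ : ℝ => (j + y₁ / 2) / q)).intervalIntegrable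
        _ _) hinner
    rw [intervalIntegral.integral_sub (cI.intervalIntegrable _ _) intervalIntegrable_const,
      intervalIntegral.integral_const, smul_eq_mul] at h3
    refine le_trans ?_ h3
    have e1 : (1 / 2 + κ / 2 - (1 / 2 - κ / 2)) * (8 * e) = κ * (8 * e) := by ring
    rw [e1]
    nlinarith
  -- The substitution `x = (j + y₁ / 2) / q` produces the factor `2 * q`. It covers only a piece of
  -- the left half cell; the rest is dropped because the integrand is nonnegative.
  have hsub : ∫ y₁ in (1 / 2 - κ / 2)..(1 / 2 + κ / 2), Φ ((j + y₁ / 2) / q)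
      = (2 * q) * ∫ x in ((j + (1 / 2 - κ / 2) / 2) / q)..((j + (1 / 2 + κ / 2) / 2) / q), Φ x := by
    have h0 : (1 / (2 * q) : ℝ) ≠ 0 := by positivity
    have := intervalIntegral.integral_comp_mul_add (a := 1 / 2 - κ / 2) (b := 1 / 2 + κ / 2) Φ h0
      (j / q)
    have e1 (y : ℝ) : 1 / (2 * q) * y + j / q = (j + y / 2) / q := by field_simp; ring
    simp only [e1] at this
    rw [this, smul_eq_mul, one_div, inv_inv]
  have hle : ∫ x in ((j + (1 / 2 - κ / 2) / 2) / q)..((j + (1 / 2 + κ / 2) / 2) / q), Φ x ≤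
      ∫ x in ((j : ℕ) : ℝ) / q..((j + 1 : ℕ) : ℝ) / q, Φ x := by
    refine intervalIntegral.integral_mono_interval ?_ ?_ ?_ (Eventually.of_forall hΦ0) (iΦ _ _)
    · exact div_le_div_of_nonneg_right (by linarith) hq0.le
    · exact div_le_div_of_nonneg_right (by linarith) hq0.le
    · push_cast
      exact div_le_div_of_nonneg_right (by linarith) hq0.le
  rw [hsub] at houter
  refine le_trans ?_ hle
  rw [div_mul_eq_mul_div, one_mul, div_le_iff₀ (by positivity)]
  linarith

/-- The lower bound for the defect of invariance under a half-period rotation of a function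
composed with the quasi-rotation followed by a strong shear. -/
theorem exists_le_integral_twist {v : ℝ × ℝ → ℂ} (hv : UniformContinuous v)
    (hp : ∀ (z : ℝ × ℝ) (m n : ℤ), v (z + ((m : ℝ), (n : ℝ))) = v z) (hv1 : ∀ z, ‖v z‖ ≤ 1)
    {κ : ℝ} (hκ : 0 < κ) (hκ2 : κ ≤ 1 / 2) {ε : ℝ} (hε : 0 < ε) {d m : ℝ}
    (hd : 1 - ∫ x in (0 : ℝ)..1, ∫ y in (0 : ℝ)..1, ‖v (x, y)‖ ^ 2 ≤ d)
    (hm : ‖∫ x in (0 : ℝ)..1, ∫ y in (0 : ℝ)..1, v (x, y)‖ ≤ m) :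
    ∃ N : ℕ, ∀ q : ℕ, N ≤ q → ∀ B : ℤ, (N : ℤ) ≤ B → ∀ ζ : ℂ, ‖ζ‖ = 1 →
      1 / 2 * ((1 - κ) * (κ - d) + κ * (1 - κ - d) - 2 * κ * (m + κ)) - ε ≤
        ∫ x in (0 : ℝ)..1, ∫ y in (0 : ℝ)..1,
          ‖v ((affineCover B 0 * twistCover hκ q).1 (x + 1 / (2 * q), y))
            - ζ * v ((affineCover B 0 * twistCover hκ q).1 (x, y))‖ ^ 2 := by
  -- Passing from `d`, `m` to `d + e`, `m + e` costs `(1 + 2 * κ) * e` and the pointwise comparison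
  -- costs `8 * e`. Together this is at most `10 * e`, below the available `2 * ε`.
  set e : ℝ := ε / 6 with he
  have he0 : 0 < e := by positivity
  obtain ⟨δ, hδ, hδe⟩ := Metric.uniformContinuous_iff.1 hv (e / 2) (by positivity)
  have hmod : ∀ z w : ℝ × ℝ, dist z w < δ → ‖v z - v w‖ ≤ e / 2 := fun z w h => by
    have := hδe h
    rw [dist_eq_norm] at this
    exact this.le
  have hmod2 : ∀ z w : ℝ × ℝ, dist z w < δ → ‖‖v z‖ ^ 2 - ‖v w‖ ^ 2‖ ≤ e := fun z w h => by
    have h1 := (abs_norm_sub_norm_le (v z) (v w)).trans (hmod z w h)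
    rw [Real.norm_eq_abs, sq_sub_sq, abs_mul, abs_of_nonneg (by positivity)]
    nlinarith [hv1 z, hv1 w, norm_nonneg (v z), norm_nonneg (v w), abs_nonneg (‖v z‖ - ‖v w‖)]
  have hvc := hv.continuous
  obtain ⟨N, hN⟩ := exists_nat_gt (1 / δ)
  refine ⟨N + 1, fun q hq B hB ζ hζ => ?_⟩
  have hlarge : ∀ r : ℝ, (N : ℝ) + 1 ≤ r → 1 / r < δ := fun r hr => by
    have h1 : 1 / δ < r := by linarith
    have h2 : 0 < r := (by positivity : 0 < 1 / δ).trans h1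
    rw [div_lt_iff₀ h2]
    rwa [div_lt_iff₀' hδ] at h1
  have hq1 : 1 ≤ q := by omega
  have hq0 : (0 : ℝ) < q := by exact_mod_cast hq1
  have hqδ : 1 / (q : ℝ) < δ := hlarge q (by exact_mod_cast hq)
  have hB1 : 1 ≤ B := by omega
  have hBδ : 1 / (B : ℝ) < δ := hlarge B (by exact_mod_cast hB)
  obtain ⟨H, hH⟩ : ∃ H, H = (affineCover B 0 * twistCover hκ q).1 := ⟨_, rfl⟩
  have hHc : Continuous H := by
    rw [hH]
    exact (affineCover B 0 * twistCover hκ q).2.1.contDiff.continuous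
  rw [← hH]
  set G : ℝ → ℝ → ℝ := fun x y => ‖v (H (x + 1 / (2 * q), y)) - ζ * v (H (x, y))‖ ^ 2 with hG
  have hGc : Continuous (Function.uncurry G) := by
    have h1 : Continuous fun z : ℝ × ℝ => v (H (z.1 + 1 / (2 * q), z.2)) :=
      hvc.comp (hHc.comp (by fun_prop))
    have h2 : Continuous fun z : ℝ × ℝ => v (H (z.1, z.2)) := hvc.comp (hHc.comp (by fun_prop))
    exact ((h1.sub (continuous_const.mul h2)).norm).pow 2
  set Φ : ℝ → ℝ := fun x => ∫ y in (0 : ℝ)..1, G x y with hΦ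
  have hΦc : Continuous Φ :=
    intervalIntegral.continuous_parametric_intervalIntegral_of_continuous' hGc 0 1
  have iΦ (a b : ℝ) : IntervalIntegrable Φ volume a b := hΦc.intervalIntegrable _ _
  set L := (1 - κ) * (κ - d) + κ * (1 - κ - d) - 2 * κ * (m + κ) with hL
  have hcell : ∀ j : ℕ, 1 / (2 * q) * (L - 2 * ε) ≤
      ∫ x in ((j : ℕ) : ℝ) / q..((j + 1 : ℕ) : ℝ) / q, Φ x := by
    intro j
    -- `A` is `v` along the sheared left wall of the cell; it stands in for `v` on the whole sheared
    -- cell.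
    set A : ℝ → ℂ := fun y => v (j / q + B * y, y) with hA
    have hAc : Continuous A := hvc.comp (by fun_prop)
    have hd' : 1 - ∫ y in (0 : ℝ)..1, ‖A y‖ ^ 2 ≤ d + e := by
      have := integral_shear_near_integral (F := fun z => ‖v z‖ ^ 2) (by fun_prop)
        (fun z m n => by rw [hp]) hmod2 hB1 hBδ (j / q)
      rw [Real.norm_eq_abs, abs_le] at this
      linarith [this.1]
    have hm' : ‖∫ y in (0 : ℝ)..1, A y‖ ≤ m + e := by
      have := integral_shear_near_integral hvc hp hmod hB1 hBδ (j / q)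
      have h2 := norm_sub_norm_le (∫ y in (0 : ℝ)..1, A y)
        (∫ x in (0 : ℝ)..1, ∫ y in (0 : ℝ)..1, v (x, y))
      linarith
    have hloc := le_integral_integral_norm_sub_sq hAc (fun y => hv1 _) hζ hκ hκ2 hd' hm'
    have hpt : ∀ y₁ ∈ Icc (1 / 2 - κ / 2) (1 / 2 + κ / 2), ∀ y₂ ∈ Icc (κ / 2) (1 - κ / 2),
        ‖A y₁ - ζ * A y₂‖ ^ 2 - 8 * e ≤ G ((j + y₁ / 2) / q) y₂ := by
      intro y₁ h1 y₂ h2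
      have h1' : y₁ ∈ Ico (0 : ℝ) 1 := ⟨by linarith [h1.1], by linarith [h1.2]⟩
      have h2' : y₂ ∈ Ico (0 : ℝ) 1 := ⟨by linarith [h2.1], by linarith [h2.2]⟩
      -- The rectangle lies in the ellipse where the turn is exact: `κ ^ 2 + (1 - κ) ^ 2 ≤ 1 - κ`
      -- holds precisely because `κ ≤ 1 / 2`.
      have hsq : (2 * y₁ - 1) ^ 2 + (2 * y₂ - 1) ^ 2 ≤ 1 - κ := by
        have e1 : (2 * y₁ - 1) ^ 2 ≤ κ ^ 2 :=
          sq_le_sq' (by linarith [h1.1]) (by linarith [h1.2])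
        have e2 : (2 * y₂ - 1) ^ 2 ≤ (1 - κ) ^ 2 :=
          sq_le_sq' (by linarith [h2.1]) (by linarith [h2.2])
        nlinarith
      have hl := twistCover_apply_left hκ hq1 j y₂ (Ico_subset_Icc_self h1')
      have hr := twistCover_apply_right hκ hq1 j h1' h2' hsq
      -- Both image points lie in the `j`-th cell, so replacing their abscissa by that of the wall
      -- moves them by at most `1 / q < δ`.
      have key : ∀ s t : ℝ, 0 ≤ s → s ≤ 1 → ‖A t - v ((j + s) / q + B * t + 0, t)‖ ≤ e := by
        intro s t hs0 hs1
        refine (hmod _ _ ?_).trans (by linarith)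
        rw [Prod.dist_eq, dist_self, Real.dist_eq, max_eq_left (abs_nonneg _)]
        have : (j : ℝ) / q + B * t - ((j + s) / q + B * t + 0) = -(s / q) := by ring
        rw [this, abs_neg, abs_of_nonneg (by positivity)]
        exact (div_le_div_of_nonneg_right hs1 hq0.le).trans_lt hqδ
      have k1 := key (1 - y₂ / 2) y₁ (by linarith [h2'.2]) (by linarith [h2'.1])
      have k2 := key (y₁ / 2) y₂ (by linarith [h1'.1]) (by linarith [h1'.2])
      simp only [hG, hH, Subgroup.coe_mul, Equiv.Perm.mul_apply, hl, hr, affineCover_apply]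
      rw [add_sub_assoc]
      exact norm_sq_sub_le (hv1 _) (hv1 _) (hv1 _) (hv1 _) hζ k1 k2
    refine le_trans ?_ (le_integral_cell hGc (fun x y => sq_nonneg _) hAc ζ hκ hκ2 he0.le hq1 j hpt
      hloc)
    refine mul_le_mul_of_nonneg_left ?_ (by positivity)
    rw [hL, he]
    nlinarith
  have hsum := intervalIntegral.sum_integral_adjacent_intervals (f := Φ) (μ := volume)
    (a := fun j : ℕ => (j : ℝ) / q) (n := q) fun j _ => iΦ _ _
  simp only [Nat.cast_zero, zero_div, div_self hq0.ne'] at hsum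
  change _ ≤ ∫ x in (0 : ℝ)..1, Φ x
  rw [← hsum]
  calc 1 / 2 * L - ε = ∑ _j ∈ Finset.range q, 1 / (2 * (q : ℝ)) * (L - 2 * ε) := by
        rw [Finset.sum_const, Finset.card_range, nsmul_eq_mul]
        field_simp
    _ ≤ _ := Finset.sum_le_sum fun j _ => hcell j

/-! ### Mixing times -/

instance : IsProbabilityMeasure (volume : Measure UnitAddCircle) :=
  ⟨UnitAddCircle.measure_univ⟩

theorem uniformContinuous_torusProj : UniformContinuous torusProj := by
  have h : UniformContinuous ((↑) : ℝ → UnitAddCircle) :=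
    uniformContinuous_addMonoidHom_of_continuous (f := QuotientAddGroup.mk' _)
      (AddCircle.continuous_mk' 1)
  exact h.prodMap h

theorem integrable_torus {E : Type*} [NormedAddCommGroup E] {K : Torus → E} (hK : Continuous K) :
    Integrable K volume :=
  hK.integrable_of_hasCompactSupport (HasCompactSupport.of_compactSpace K)

theorem TorusPreserving.integral_comp {E : Type*} [NormedAddCommGroup E] [NormedSpace ℝ E]
    {H : coverGroup} (hH : TorusPreserving H) {K : Torus → E} (hK : Continuous K) :
    ∫ x, K (torusMap H x) = ∫ x, K x := by
  have h : Measure.map (torusMap H) volume = volume := MeasurePreserving.map_eq hH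
  conv_rhs => rw [← h]
  exact (integral_map (continuous_torusMap H).measurable.aemeasurable
    hK.aestronglyMeasurable).symm

/-- How far `w` is from being an eigenfunction with eigenvalue `ζ` for the map `f`. -/
noncomputable def defect (w : Torus → ℂ) (f : Torus → Torus) (ζ : ℂ) : ℝ :=
  ∫ x, ‖w (f x) - ζ * w x‖ ^ 2

/-- The distance of the mean of `w` to the unit circle. -/
noncomputable def gap (w : Torus → ℂ) : ℝ := 1 - ‖∫ x, w x‖

/-- Continuous functions that are close to nonconstant unimodular functions. -/
structure NearUnimodular (w : C(Torus, ℂ)) : Prop where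
  norm_le : ∀ x, ‖w x‖ ≤ 1
  gap_pos : 0 < gap w
  sq_le : 1 - ∫ x, ‖w x‖ ^ 2 ≤ gap w ^ 2 / 16

/-- Some iterate of `H` moves `w` away from all its unimodular multiples. -/
def Mixes (w : C(Torus, ℂ)) (H : coverGroup) : Prop :=
  ∃ m : ℕ, ∀ ζ : ℂ, ‖ζ‖ = 1 → gap w ^ 2 / 32 ≤ defect w (torusMap H)^[m] ζ

theorem defect_perturb {w : C(Torus, ℂ)} (hw : ∀ x, ‖w x‖ ≤ 1) {f g : Torus → Torus}
    (hf : Continuous f) (hg : Continuous g) {ζ : ℂ} (hζ : ‖ζ‖ = 1) {e : ℝ}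
    (h : ∀ x, ‖w (f x) - w (g x)‖ ≤ e) : defect w f ζ - 8 * e ≤ defect w g ζ := by
  have he : 0 ≤ e := (norm_nonneg _).trans (h 0)
  have i1 : Integrable (fun x => ‖w (f x) - ζ * w x‖ ^ 2) volume :=
    integrable_torus (by fun_prop)
  have i2 : Integrable (fun x => ‖w (g x) - ζ * w x‖ ^ 2) volume :=
    integrable_torus (by fun_prop)
  have h2 : ∫ x, (‖w (f x) - ζ * w x‖ ^ 2 - 8 * e) ≤ ∫ x, ‖w (g x) - ζ * w x‖ ^ 2 :=
    integral_mono (i1.sub (integrable_const _)) i2 fun x =>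
      norm_sq_sub_le (hw _) (hw _) (hw _) (hw _) hζ (h x) (by simpa using he)
  rw [integral_sub i1 (integrable_const _)] at h2
  simpa [defect] using h2

/-- Substituting `K x` for `x` removes the inverse of `K`, leaving `w ∘ K` under a plain rotation.
-/
theorem defect_conj {w : C(Torus, ℂ)} {K : coverGroup} (hK : TorusPreserving K) (t : ℝ) (ζ : ℂ) :
    defect w (torusMap (conjRot K t)) ζ
      = ∫ x, ‖w (torusMap K (torusMap (rotCover t) x)) - ζ * w (torusMap K x)‖ ^ 2 := by
  have h := hK.integral_comp (K := fun x => ‖w (torusMap (conjRot K t) x) - ζ * w x‖ ^ 2)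
    (by have := continuous_torusMap (conjRot K t); fun_prop)
  rw [defect, ← h]
  congr 1
  funext x
  rw [← torusMap_mul, ← torusMap_mul]
  simp [conjRot]

/-- Iterates depend continuously on a map with bounded derivative. -/
theorem exists_iterate_close {F : ℝ × ℝ → ℝ × ℝ} {C : ℝ} (hC : 0 ≤ C)
    (hF : ∀ z w, ‖F z - F w‖ ≤ C * ‖z - w‖) (m : ℕ) {δ : ℝ} (hδ : 0 < δ) :
    ∃ η > 0, ∀ G : ℝ × ℝ → ℝ × ℝ, (∀ z, ‖G z - F z‖ ≤ η) → ∀ z, ‖G^[m] z - F^[m] z‖ < δ := by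
  induction m generalizing δ with
  | zero => exact ⟨1, one_pos, fun G _ z => by simpa using hδ⟩
  | succ m ih =>
    obtain ⟨η, hη, h⟩ := ih (δ := δ / (2 * (C + 1))) (by positivity)
    refine ⟨min η (δ / 2), by positivity, fun G hG z => ?_⟩
    rw [Function.iterate_succ_apply', Function.iterate_succ_apply']
    have h1 := h G (fun z => (hG z).trans (min_le_left _ _)) z
    have h2 := (hG (G^[m] z)).trans (min_le_right _ _)
    have h3 := hF (G^[m] z) (F^[m] z)
    have h4 : C * ‖G^[m] z - F^[m] z‖ ≤ (C + 1) * ‖G^[m] z - F^[m] z‖ := by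
      nlinarith [norm_nonneg (G^[m] z - F^[m] z)]
    have h5 : (C + 1) * ‖G^[m] z - F^[m] z‖ < δ / 2 := by
      rw [lt_div_iff₀ (by positivity)] at h1
      linarith
    have h6 : G (G^[m] z) - F (F^[m] z) = (G (G^[m] z) - F (G^[m] z))
        + (F (G^[m] z) - F (F^[m] z)) := by abel
    rw [h6]
    exact (norm_add_le _ _).trans_lt (by linarith)

theorem IsCover.exists_lipschitz {u : ℝ × ℝ → ℝ × ℝ} (hu : IsCover u) :
    ∃ C, 0 ≤ C ∧ ∀ z w, ‖u z - u w‖ ≤ C * ‖z - w‖ := by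
  obtain ⟨C, hC⟩ := hu.exists_bound le_rfl
  refine ⟨C, (norm_nonneg _).trans (hC 0), fun z w => ?_⟩
  refine Convex.norm_image_sub_le_of_norm_fderiv_le (𝕜 := ℝ) (s := univ)
    (fun x _ => hu.contDiff.differentiable (by simp) x) (fun x _ => ?_) convex_univ
    (mem_univ _) (mem_univ _)
  rw [← norm_iteratedFDeriv_zero (𝕜 := ℝ) (f := fderiv ℝ u), norm_iteratedFDeriv_fderiv]
  exact hC x

theorem torusMap_iterate (H : coverGroup) (m : ℕ) (z : ℝ × ℝ) :
    (torusMap H)^[m] (torusProj z) = torusProj (H.1^[m] z) := by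
  induction m with
  | zero => rfl
  | succ m ih => rw [Function.iterate_succ_apply', Function.iterate_succ_apply', ih,
      torusMap_torusProj]

theorem exists_nat_mul_near {α : ℝ} (hα : Irrational α) (t : ℝ) {δ : ℝ} (hδ : 0 < δ) :
    ∃ m : ℕ, ∃ k : ℤ, |m * α - k - t| < δ := by
  have hd : DenseRange (fun n : ℕ => n • (α : UnitAddCircle)) := by
    rw [← denseRange_zsmul_iff_nsmul, AddCircle.denseRange_zsmul_coe_iff, div_one]
    exact hα
  have hopen : IsOpen ((↑) '' Metric.ball t δ : Set UnitAddCircle) :=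
    QuotientAddGroup.isOpenMap_coe _ Metric.isOpen_ball
  obtain ⟨m, s, hs, hm⟩ := hd.exists_mem_open hopen ⟨_, t, Metric.mem_ball_self hδ, rfl⟩
  have h2 : ((m * α : ℝ) : UnitAddCircle) = (s : UnitAddCircle) := by
    rw [hm, ← nsmul_eq_mul]
    rfl
  obtain ⟨k, hk⟩ := exists_int_of_coe_eq h2
  refine ⟨m, k, ?_⟩
  rw [hk, add_sub_cancel_right, ← Real.dist_eq]
  exact hs

/-- With a large period and a strong shear, the conjugates of the rotation by `α`, and all nearby
maps, have a mixing time. -/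
theorem exists_mixes {α : ℝ} (hα : Irrational α) {w : C(Torus, ℂ)} (hw : NearUnimodular w)
    {H : coverGroup} (hH : TorusPreserving H) :
    ∃ (κ : ℝ) (hκ : 0 < κ) (N : ℕ), ∀ q : ℕ, N ≤ q → ∀ B : ℤ, (N : ℤ) ≤ B → ∃ η > 0,
      ∀ F : coverGroup,
        (∀ z, ‖F.1 z - (conjRot (H * (affineCover B 0 * twistCover hκ q)) α).1 z‖ ≤ η) →
        Mixes w F := by
  set γ := gap w with hγ
  have hγ0 : 0 < γ := hw.gap_pos
  have hγ1 : γ ≤ 1 := by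
    rw [hγ, gap]
    linarith [norm_nonneg (∫ x, w x)]
  -- With `m = 1 - γ` the lower bound equals `2 * κ * γ - 4 * κ ^ 2 - d`, which is largest at `κ = γ
  -- / 4`. For `d = γ ^ 2 / 16` half of it is `3 * γ ^ 2 / 32`, and the error `γ ^ 2 / 32` leaves `γ
  -- ^ 2 / 16`.
  have hκ : 0 < γ / 4 := by positivity
  set v : ℝ × ℝ → ℂ := fun z => w (torusMap H (torusProj z)) with hv
  have hwH : Continuous fun x => w (torusMap H x) := by
    have := continuous_torusMap H
    fun_prop
  have hvu : UniformContinuous v :=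
    (CompactSpace.uniformContinuous_of_continuous hwH).comp uniformContinuous_torusProj
  have hd : 1 - ∫ x in (0 : ℝ)..1, ∫ y in (0 : ℝ)..1, ‖v (x, y)‖ ^ 2 ≤ γ ^ 2 / 16 := by
    have h1 := integral_torus (K := fun x => ‖w (torusMap H x)‖ ^ 2) (hwH.norm.pow 2)
    have h2 := hH.integral_comp (K := fun x => ‖w x‖ ^ 2) (by fun_prop)
    rw [← h1, h2]
    exact hw.sq_le
  have hm : ‖∫ x in (0 : ℝ)..1, ∫ y in (0 : ℝ)..1, v (x, y)‖ ≤ 1 - γ := by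
    have h1 := integral_torus (K := fun x => w (torusMap H x)) hwH
    have h2 := hH.integral_comp (K := fun x => w x) (by fun_prop)
    rw [← h1, h2, hγ, gap]
    linarith
  obtain ⟨N, hN⟩ := exists_le_integral_twist hvu (fun z m n => by simp only [hv, torusProj_add_int])
    (fun z => hw.norm_le _) hκ (by linarith) (ε := γ ^ 2 / 32) (by positivity) hd hm
  refine ⟨γ / 4, hκ, N, fun q hq B hB => ?_⟩
  set P := affineCover B 0 * twistCover hκ q
  set K := H * P
  have hK : TorusPreserving K :=
    hH.mul ((torusPreserving_affineCover B 0).mul (torusPreserving_twistCover hκ q))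
  have hexact : ∀ ζ : ℂ, ‖ζ‖ = 1 →
      γ ^ 2 / 16 ≤ defect w (torusMap (conjRot K (1 / (2 * q)))) ζ := by
    intro ζ hζ
    have h1 := hN q hq B hB ζ hζ
    rw [defect_conj hK, integral_torus (by
      have := continuous_torusMap K
      have := continuous_torusMap (rotCover (1 / (2 * q)))
      fun_prop)]
    have e : ∀ x y : ℝ,
        ‖w (torusMap K (torusMap (rotCover (1 / (2 * q))) (torusProj (x, y))))
          - ζ * w (torusMap K (torusProj (x, y)))‖ ^ 2
        = ‖v (P.1 (x + 1 / (2 * q), y)) - ζ * v (P.1 (x, y))‖ ^ 2 := by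
      intro x y
      simp only [hv, K, torusMap_torusProj, rotCover_apply]
      rfl
    simp only [e]
    refine le_trans ?_ h1
    nlinarith
  have hWu : UniformContinuous fun z => w (torusMap K (torusProj z)) := by
    refine (CompactSpace.uniformContinuous_of_continuous
      (f := fun x => w (torusMap K x)) ?_).comp uniformContinuous_torusProj
    have := continuous_torusMap K
    fun_prop
  -- Two perturbations follow, each costing `8 * (γ ^ 2 / 512) = γ ^ 2 / 64`: from the half-cell
  -- rotation to a multiple of `α`, and from the conjugate to `F`. What remains is `γ ^ 2 / 32`, the
  -- bound in `Mixes`.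
  have he : 0 < γ ^ 2 / 512 := by positivity
  obtain ⟨δ, hδ, hδe⟩ := Metric.uniformContinuous_iff.1 hWu _ he
  obtain ⟨m, k, hmk⟩ := exists_nat_mul_near hα (1 / (2 * q)) hδ
  have happrox : ∀ ζ : ℂ, ‖ζ‖ = 1 → 3 * γ ^ 2 / 64 ≤ defect w (torusMap (conjRot K (m * α))) ζ := by
    intro ζ hζ
    have h := defect_perturb hw.norm_le (continuous_torusMap (conjRot K (1 / (2 * q))))
      (continuous_torusMap (conjRot K (m * α))) hζ (e := γ ^ 2 / 512) fun x => by
        obtain ⟨z, rfl⟩ := torusProj_surjective x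
        rw [torusMap_torusProj, torusMap_torusProj, conjRot_apply, conjRot_apply,
          ← torusMap_torusProj, ← torusMap_torusProj, ← torusProj_add_int (_ + (m * α, 0)) (-k) 0,
          ← dist_eq_norm]
        refine (hδe ?_).le
        rw [add_assoc, dist_add_left, Prod.dist_eq, Real.dist_eq]
        simp only [Prod.mk_add_mk, Int.cast_neg, Int.cast_zero, add_zero, dist_self]
        rw [max_eq_left (abs_nonneg _), abs_sub_comm]
        exact hmk
    linarith [hexact ζ hζ]
  obtain ⟨δ', hδ', hδe'⟩ := Metric.uniformContinuous_iff.1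
    ((CompactSpace.uniformContinuous_of_continuous w.continuous).comp uniformContinuous_torusProj)
    _ he
  -- The mixing time `m` is already fixed, so uniform closeness of the maps can be chosen to force
  -- closeness of their `m`-th iterates.
  obtain ⟨C, hC, hLip⟩ := (conjRot K α).2.1.exists_lipschitz
  obtain ⟨η, hη, hclose⟩ := exists_iterate_close hC hLip m hδ'
  refine ⟨η, hη, fun F hF => ⟨m, fun ζ hζ => ?_⟩⟩
  have hc := hclose F.1 hF
  have hpow : torusMap (conjRot K (m * α)) = (torusMap (conjRot K α))^[m] := by
    rw [← conjRot_pow, torusMap_pow]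
  have h := defect_perturb hw.norm_le ((continuous_torusMap (conjRot K α)).iterate m)
    ((continuous_torusMap F).iterate m) hζ (e := γ ^ 2 / 512) fun x => by
      obtain ⟨z, rfl⟩ := torusProj_surjective x
      rw [torusMap_iterate, torusMap_iterate, ← dist_eq_norm, dist_comm]
      refine (hδe' ?_).le
      rw [dist_eq_norm]
      exact hc z
  rw [← hpow] at h
  linarith [happrox ζ hζ]

/-! ### The criterion for weak mixing -/

/-- A sequence of continuous functions bounded by one that approximates all unimodular functions. -/
theorem exists_dense_unimodular : ∃ w : ℕ → C(Torus, ℂ), (∀ i x, ‖w i x‖ ≤ 1) ∧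
    ∀ u : Torus → ℂ, Measurable u → (∀ x, ‖u x‖ = 1) → ∀ δ > 0, ∃ i, ∫ x, ‖u x - w i x‖ < δ := by
  -- The radial retraction onto the unit disc: it enforces the bound by one and at most doubles the
  -- distance to a unimodular value.
  have hc : Continuous fun z : ℂ => ((max 1 ‖z‖)⁻¹ : ℝ) • z := by
    refine Continuous.smul (Continuous.inv₀ (continuous_const.max continuous_norm) fun z => ?_)
      continuous_id
    have : 0 < max 1 ‖z‖ := lt_max_of_lt_left one_pos
    exact this.ne'
  set r : C(ℂ, ℂ) := ⟨_, hc⟩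
  have hr : ∀ z, ‖r z‖ ≤ 1 := fun z => by
    have h0 : 0 < max 1 ‖z‖ := lt_max_of_lt_left one_pos
    change ‖((max 1 ‖z‖)⁻¹ : ℝ) • z‖ ≤ 1
    rw [norm_smul, Real.norm_of_nonneg (by positivity), inv_mul_le_iff₀ h0, mul_one]
    exact le_max_right _ _
  have hr2 : ∀ a z : ℂ, ‖a‖ = 1 → ‖a - r z‖ ≤ 2 * ‖a - z‖ := fun a z ha => by
    have h1 : ‖z - r z‖ ≤ ‖a - z‖ := by
      rcases le_total ‖z‖ 1 with h | h
      · have : r z = z := by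
          change ((max 1 ‖z‖)⁻¹ : ℝ) • z = z
          rw [max_eq_left h, inv_one, one_smul]
        rw [this, sub_self, norm_zero]
        positivity
      · have h0 : 0 < ‖z‖ := by linarith
        have : z - r z = (1 - ‖z‖⁻¹ : ℝ) • z := by
          change z - ((max 1 ‖z‖)⁻¹ : ℝ) • z = _
          rw [max_eq_right h, sub_smul, one_smul]
        rw [this, norm_smul, Real.norm_of_nonneg
          (sub_nonneg.2 (inv_le_one_of_one_le₀ h)), sub_mul, inv_mul_cancel₀ h0.ne', one_mul]
        have := norm_sub_norm_le z a
        rw [norm_sub_rev, ha] at this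
        exact this
    have h2 : a - r z = (a - z) + (z - r z) := by abel
    rw [h2]
    exact (norm_add_le _ _).trans (by linarith)
  refine ⟨fun i => r.comp (TopologicalSpace.denseSeq C(Torus, ℂ) i), fun i x => hr _, ?_⟩
  intro u hu hu1 δ hδ
  have hui : Integrable u volume :=
    Integrable.of_bound hu.aestronglyMeasurable 1 (Eventually.of_forall fun x => (hu1 x).le)
  obtain ⟨g, hg, hgi⟩ := hui.exists_boundedContinuous_integral_sub_le (ε := δ / 8) (by positivity)
  obtain ⟨i, hi⟩ := (TopologicalSpace.denseRange_denseSeq C(Torus, ℂ)).exists_dist_lt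
    g.toContinuousMap (show 0 < δ / 8 by positivity)
  refine ⟨i, ?_⟩
  set k := TopologicalSpace.denseSeq C(Torus, ℂ) i
  have hpt : ∀ x, ‖u x - r (k x)‖ ≤ 2 * ‖u x - g x‖ + δ / 4 := fun x => by
    have h1 := hr2 (u x) (k x) (hu1 x)
    have h2 : ‖g x - k x‖ ≤ δ / 8 := by
      rw [← dist_eq_norm]
      exact (ContinuousMap.dist_apply_le_dist (f := g.toContinuousMap) (g := k) x).trans hi.le
    have h3 : u x - k x = (u x - g x) + (g x - k x) := by abel
    have h4 : ‖u x - k x‖ ≤ ‖u x - g x‖ + ‖g x - k x‖ := by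
      rw [h3]
      exact norm_add_le _ _
    linarith
  have hki : Integrable (fun x => r (k x)) volume := integrable_torus (by fun_prop)
  have i1 : Integrable (fun x => ‖u x - r (k x)‖) volume := (hui.sub hki).norm
  have i2 : Integrable (fun x => ‖u x - g x‖) volume := (hui.sub hgi).norm
  calc ∫ x, ‖u x - r (k x)‖ ≤ ∫ x, (2 * ‖u x - g x‖ + δ / 4) :=
        integral_mono i1 ((i2.const_mul 2).add (integrable_const _)) hpt
    _ = 2 * (∫ x, ‖u x - g x‖) + δ / 4 := by
        rw [integral_add (i2.const_mul 2) (integrable_const _), integral_const_mul]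
        simp
    _ < δ := by linarith

theorem iterate_eigen {H : coverGroup} (hH : TorusPreserving H) {u : Torus → ℂ} {c : ℂ}
    (h : ∀ᵐ x, u (torusMap H x) = c * u x) (m : ℕ) :
    ∀ᵐ x, u ((torusMap H)^[m] x) = c ^ m * u x := by
  induction m with
  | zero => simp
  | succ m ih =>
    filter_upwards [h, (MeasurePreserving.quasiMeasurePreserving hH).ae ih] with x h1 h2
    rw [Function.iterate_succ_apply, h2, h1]
    ring

/-- Unimodular eigenfunctions are constant if the continuous functions of a dense sequence have
mixing times. -/
theorem unimodular_eigen_const {H : coverGroup} (hH : TorusPreserving H) {w : ℕ → C(Torus, ℂ)}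
    (hw1 : ∀ i x, ‖w i x‖ ≤ 1)
    (hw : ∀ u : Torus → ℂ, Measurable u → (∀ x, ‖u x‖ = 1) → ∀ δ > 0,
      ∃ i, ∫ x, ‖u x - w i x‖ < δ)
    (hmix : ∀ i, NearUnimodular (w i) → Mixes (w i) H) {u : Torus → ℂ} (hu : Measurable u)
    (hu1 : ∀ x, ‖u x‖ = 1) {c : ℂ} (hc : ∀ᵐ x, u (torusMap H x) = c * u x) :
    ∃ b : ℂ, ∀ᵐ x, u x = b := by
  -- Strict convexity of the disc: a unimodular function is almost everywhere constant unless its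
  -- mean lies strictly inside the disc.
  rcases ae_eq_const_or_norm_integral_lt_of_norm_le_const (μ := (volume : Measure Torus))
    (Eventually.of_forall fun x => (hu1 x).le) with h | h
  · exact ⟨_, h⟩
  exfalso
  rw [probReal_univ, one_mul] at h
  have hc1 : ‖c‖ = 1 := by
    obtain ⟨x, hx⟩ := hc.exists
    have := congrArg norm hx
    rw [norm_mul, hu1, hu1, mul_one] at this
    exact this.symm
  set γ := 1 - ‖∫ x, u x‖ with hγ
  have hγ0 : 0 < γ := by linarith
  have hγ1 : γ ≤ 1 := by linarith [norm_nonneg (∫ x, u x)]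
  -- The eigenfunction equation makes the defect of `w i` at most `4 * τ < γ ^ 2 / 256`, while
  -- mixing with gap at least `γ / 2` makes it at least `γ ^ 2 / 128`.
  obtain ⟨i, hi⟩ := hw u hu hu1 (γ ^ 2 / 1024) (by positivity)
  set τ := ∫ x, ‖u x - w i x‖
  have hui : Integrable u volume :=
    Integrable.of_bound hu.aestronglyMeasurable 1 (Eventually.of_forall fun x => (hu1 x).le)
  have hwi : Integrable (w i) volume := integrable_torus (w i).continuous
  have hdi : Integrable (fun x => ‖u x - w i x‖) volume := (hui.sub hwi).norm
  have hmean : ‖∫ x, w i x‖ ≤ ‖∫ x, u x‖ + τ := by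
    have h1 : ‖(∫ x, u x) - ∫ x, w i x‖ ≤ τ := by
      rw [← integral_sub hui hwi]
      exact norm_integral_le_integral_norm _
    have h2 := norm_sub_norm_le (∫ x, w i x) (∫ x, u x)
    rw [norm_sub_rev] at h2
    linarith
  have hγγ : γ ^ 2 ≤ γ := by nlinarith
  have hgap : γ / 2 ≤ gap (w i) := by
    rw [gap]
    nlinarith
  have hsq : 1 - ∫ x, ‖w i x‖ ^ 2 ≤ 2 * τ := by
    have i1 : Integrable (fun x => ‖w i x‖ ^ 2) volume := integrable_torus (by fun_prop)
    have h1 : ∫ x, (1 - ‖w i x‖ ^ 2) ≤ ∫ x, 2 * ‖u x - w i x‖ := by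
      refine integral_mono ((integrable_const _).sub i1) (hdi.const_mul 2) fun x => ?_
      have h2 := norm_sub_norm_le (u x) (w i x)
      rw [hu1] at h2
      have h3 := hw1 i x
      have h4 := norm_nonneg (w i x)
      simp only
      nlinarith
    rw [integral_sub (integrable_const _) i1, integral_const_mul] at h1
    simpa using h1
  have hnear : NearUnimodular (w i) :=
    ⟨hw1 i, by linarith, by nlinarith⟩
  obtain ⟨m, hm⟩ := hmix i hnear
  have hζ : ‖c ^ m‖ = 1 := by rw [norm_pow, hc1, one_pow]
  have hlow := hm (c ^ m) hζ
  have hpow : torusMap (H ^ m) = (torusMap H)^[m] := torusMap_pow H m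
  have hmp : TorusPreserving (H ^ m) := by
    have := MeasurePreserving.iterate hH m
    rwa [← hpow] at this
  rw [← hpow] at hlow
  have hcont := continuous_torusMap (H ^ m)
  have hti : Integrable (fun x => ‖u (torusMap (H ^ m) x) - w i (torusMap (H ^ m) x)‖) volume :=
    (MeasurePreserving.integrable_comp hmp hdi.aestronglyMeasurable).2 hdi
  have hteq : ∫ x, ‖u (torusMap (H ^ m) x) - w i (torusMap (H ^ m) x)‖ = τ := by
    have e : Measure.map (torusMap (H ^ m)) volume = volume := MeasurePreserving.map_eq hmp
    have hae : AEStronglyMeasurable (fun x => ‖u x - w i x‖)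
        (Measure.map (torusMap (H ^ m)) volume) := by
      rw [e]
      exact hdi.aestronglyMeasurable
    have := integral_map hcont.measurable.aemeasurable hae
    rw [e] at this
    exact this.symm
  have hup : defect (w i) (torusMap (H ^ m)) (c ^ m) ≤ 4 * τ := by
    have hae : ∀ᵐ x, ‖w i (torusMap (H ^ m) x) - c ^ m * w i x‖ ^ 2 ≤
        2 * ‖u (torusMap (H ^ m) x) - w i (torusMap (H ^ m) x)‖ + 2 * ‖u x - w i x‖ := by
      filter_upwards [iterate_eigen hH hc m] with x hx
      rw [← hpow] at hx
      have e1 : w i (torusMap (H ^ m) x) - c ^ m * w i x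
          = -(u (torusMap (H ^ m) x) - w i (torusMap (H ^ m) x)) + c ^ m * (u x - w i x) := by
        rw [hx]; ring
      have h1 : ‖w i (torusMap (H ^ m) x) - c ^ m * w i x‖ ≤
          ‖u (torusMap (H ^ m) x) - w i (torusMap (H ^ m) x)‖ + ‖u x - w i x‖ := by
        rw [e1]
        refine (norm_add_le _ _).trans (le_of_eq ?_)
        rw [norm_neg, norm_mul, hζ, one_mul]
      have h2 : ‖w i (torusMap (H ^ m) x) - c ^ m * w i x‖ ≤ 2 := by
        refine (norm_sub_le _ _).trans ?_
        rw [norm_mul, hζ, one_mul]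
        linarith [hw1 i x, hw1 i (torusMap (H ^ m) x)]
      nlinarith [norm_nonneg (w i (torusMap (H ^ m) x) - c ^ m * w i x)]
    have h3 := integral_mono_ae (integrable_torus (by fun_prop))
      ((hti.const_mul 2).add (hdi.const_mul 2)) hae
    refine h3.trans (le_of_eq ?_)
    change ∫ x, (2 * ‖u (torusMap (H ^ m) x) - w i (torusMap (H ^ m) x)‖ + 2 * ‖u x - w i x‖) = _
    rw [integral_add (hti.const_mul 2) (hdi.const_mul 2), integral_const_mul,
      integral_const_mul, hteq]
    ring
  nlinarith

/-- The frequencies `1` and `√2` are incommensurable, so no nonzero shift is a common period. -/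
theorem eq_of_exp_eq {s t : ℝ} (h1 : Complex.exp (Complex.I * s) = Complex.exp (Complex.I * t))
    (h2 : Complex.exp (Complex.I * (√2 * s : ℝ)) = Complex.exp (Complex.I * (√2 * t : ℝ))) :
    s = t := by
  obtain ⟨m, hm⟩ := Complex.exp_eq_exp_iff_exists_int.1 h1
  obtain ⟨n, hn⟩ := Complex.exp_eq_exp_iff_exists_int.1 h2
  have hm' : s = t + m * (2 * Real.pi) := by
    have := congrArg Complex.im hm
    simpa using this
  have hn' : √2 * s = √2 * t + n * (2 * Real.pi) := by
    have := congrArg Complex.im hn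
    simpa using this
  have h3 : (√2 * m - n) * (2 * Real.pi) = 0 := by
    rw [hm'] at hn'
    linear_combination hn'
  have h4 : √2 * m = n := by
    rcases mul_eq_zero.1 h3 with h | h
    · linarith
    · exact absurd h (by positivity)
  by_cases h0 : m = 0
  · simp [hm', h0]
  · exact absurd h4 ((irrational_sqrt_two.mul_intCast h0).ne_int n)

/-- The eigenvalue need not be unimodular, nor `u` integrable, so phase and modulus are treated
separately. The phase is a unimodular eigenfunction, and so are the exponentials of `i a log ‖u‖`;
the values `a = 1` and `a = √2` determine the modulus. -/
theorem torusEigenConst_of_unimodular {H : coverGroup} (hH : TorusPreserving H)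
    (h : ∀ (u : Torus → ℂ) (c : ℂ), Measurable u → (∀ x, ‖u x‖ = 1) →
      (∀ᵐ x, u (torusMap H x) = c * u x) → ∃ b : ℂ, ∀ᵐ x, u x = b) : TorusEigenConst H := by
  intro u c hu hc
  by_cases hc0 : c = 0
  · refine ⟨0, ?_⟩
    simp only [hc0, zero_mul] at hc
    have hs : MeasurableSet {x | u x ≠ 0} := (measurableSet_eq_fun hu measurable_const).compl
    have := MeasurePreserving.measure_preimage hH hs.nullMeasurableSet
    rw [ae_iff] at hc ⊢
    rw [← this]
    exact hc
  have hz : MeasurableSet {x | u x = 0} := measurableSet_eq_fun hu measurable_const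
  -- Since `c ≠ 0`, the zero set of `u` is invariant modulo null sets; its signed indicator is an
  -- eigenfunction for `1`, so `u` vanishes almost everywhere or almost nowhere.
  obtain ⟨b, hb⟩ := h (fun x => if u x = 0 then 1 else -1) 1
    (Measurable.ite hz measurable_const measurable_const) (fun x => by split_ifs <;> simp) (by
      filter_upwards [hc] with x hx
      simp [hx, hc0])
  by_cases hb1 : b = 1
  · refine ⟨0, ?_⟩
    filter_upwards [hb] with x hx
    by_contra hne
    rw [if_neg hne, hb1] at hx
    norm_num at hx
  have hne : ∀ᵐ x, u x ≠ 0 := by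
    filter_upwards [hb] with x hx h0
    rw [if_pos h0] at hx
    exact hb1 hx.symm
  obtain ⟨s, hs⟩ := h (fun x => if u x = 0 then 1 else u x / (‖u x‖ : ℂ)) (c / (‖c‖ : ℂ))
    (Measurable.ite hz measurable_const (by fun_prop))
    (fun x => by
      split_ifs with h0
      · simp
      · simp [h0])
    (by
      filter_upwards [hc, hne] with x hx h0
      rw [if_neg h0, if_neg (by rw [hx]; exact mul_ne_zero hc0 h0), hx, norm_mul]
      push_cast
      rw [mul_div_mul_comm])
  have hexp : ∀ a : ℝ, ∃ b : ℂ, ∀ᵐ x, Complex.exp (Complex.I * (a * Real.log ‖u x‖ : ℝ)) = b := by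
    intro a
    refine h _ (Complex.exp (Complex.I * (a * Real.log ‖c‖ : ℝ))) (by fun_prop) (fun x => ?_) ?_
    · rw [mul_comm]
      exact Complex.norm_exp_ofReal_mul_I _
    · filter_upwards [hc, hne] with x hx h0
      rw [hx, norm_mul, Real.log_mul (norm_ne_zero_iff.2 hc0) (norm_ne_zero_iff.2 h0),
        ← Complex.exp_add]
      congr 1
      push_cast
      ring
  obtain ⟨b₁, h1⟩ := hexp 1
  obtain ⟨b₂, h2⟩ := hexp √2
  simp only [one_mul] at h1
  have hall := (hs.and hne).and (h1.and h2)
  obtain ⟨x₀, ⟨-, hx2⟩, hx3, hx4⟩ := hall.exists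
  refine ⟨s * ‖u x₀‖, ?_⟩
  filter_upwards [hall] with x hx
  obtain ⟨⟨hy1, hy2⟩, hy3, hy4⟩ := hx
  have hlog := eq_of_exp_eq (hy3.trans hx3.symm) (hy4.trans hx4.symm)
  have hnorm : ‖u x‖ = ‖u x₀‖ :=
    Real.log_injOn_pos (norm_pos_iff.2 hy2) (norm_pos_iff.2 hx2) hlog
  rw [if_neg hy2, div_eq_iff (by simpa using hy2)] at hy1
  rw [hy1, ← hnorm]

/-! ### Closeness of global lifts -/

/-- Closeness of the derivatives up to order `k`, for the maps and their inverses. -/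
def CloseTo (k : ℕ) (e : ℝ) (F G : coverGroup) : Prop :=
  ∀ i ≤ k, ∀ z, ‖iteratedFDeriv ℝ i (fun w => F.1 w - G.1 w) z‖ ≤ e ∧
    ‖iteratedFDeriv ℝ i (fun w => F.1.symm w - G.1.symm w) z‖ ≤ e

theorem CloseTo.mono {k k' : ℕ} {e e' : ℝ} {F G : coverGroup} (h : CloseTo k e F G) (hk : k' ≤ k)
    (he : e ≤ e') : CloseTo k' e' F G := fun i hi z =>
  ⟨(h i (hi.trans hk) z).1.trans he, (h i (hi.trans hk) z).2.trans he⟩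

theorem norm_iteratedFDeriv_sub_le_add {u v w : ℝ × ℝ → ℝ × ℝ} (hu : ContDiff ℝ ∞ u)
    (hv : ContDiff ℝ ∞ v) (hw : ContDiff ℝ ∞ w) (i : ℕ) (z : ℝ × ℝ) :
    ‖iteratedFDeriv ℝ i (fun x => u x - w x) z‖ ≤
      ‖iteratedFDeriv ℝ i (fun x => u x - v x) z‖ +
        ‖iteratedFDeriv ℝ i (fun x => v x - w x) z‖ := by
  have e : (fun x => u x - w x) = (fun x => u x - v x) + fun x => v x - w x := by
    funext x
    simp
  rw [e, iteratedFDeriv_add_apply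
    (((hu.sub hv).contDiffAt).of_le (by exact_mod_cast le_top))
    (((hv.sub hw).contDiffAt).of_le (by exact_mod_cast le_top))]
  exact norm_add_le _ _

theorem CloseTo.trans {k : ℕ} {e e' : ℝ} {F G K : coverGroup} (h : CloseTo k e F G)
    (h' : CloseTo k e' G K) : CloseTo k (e + e') F K := fun i hi z =>
  ⟨(norm_iteratedFDeriv_sub_le_add F.2.1.contDiff G.2.1.contDiff K.2.1.contDiff i z).trans
    (add_le_add (h i hi z).1 (h' i hi z).1),
   (norm_iteratedFDeriv_sub_le_add F.2.2.contDiff G.2.2.contDiff K.2.2.contDiff i z).trans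
    (add_le_add (h i hi z).2 (h' i hi z).2)⟩

theorem CloseTo.symm {k : ℕ} {e : ℝ} {F G : coverGroup} (h : CloseTo k e F G) :
    CloseTo k e G F := by
  have key : ∀ (u v : ℝ × ℝ → ℝ × ℝ) (i : ℕ) (z : ℝ × ℝ),
      ‖iteratedFDeriv ℝ i (fun w => u w - v w) z‖ = ‖iteratedFDeriv ℝ i (fun w => v w - u w) z‖ := by
    intro u v i z
    have e : (fun w => u w - v w) = -fun w => v w - u w := by
      funext w
      simp
    rw [e, iteratedFDeriv_neg_apply, norm_neg]
  intro i hi z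
  rw [key, key G.1.symm]
  exact h i hi z

theorem CloseTo.distC_le {k : ℕ} {e : ℝ} {F G : coverGroup} (h : CloseTo k e F G) (M : Surface) :
    (desc M F).distC k (desc M G) ≤ e :=
  distC_desc_le M (fun i hi z => (h i hi z).1) fun i hi z => (h i hi z).2

theorem CloseTo.norm_sub_le {k : ℕ} {e : ℝ} {F G : coverGroup} (h : CloseTo k e F G) (z : ℝ × ℝ) :
    ‖F.1 z - G.1 z‖ ≤ e := by
  have := (h 0 (Nat.zero_le k) z).1
  rwa [norm_iteratedFDeriv_zero] at this

/-- The inverse of a conjugated rotation is the conjugate of the opposite rotation, so one estimate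
serves maps and inverses. -/
theorem exists_closeTo_conjRot {H : ℕ → coverGroup} (h1 : PolyBounded fun q => (H q).1)
    (h2 : PolyBounded fun q => (H q).1.symm) (k : ℕ) :
    ∃ C : ℝ, ∃ N : ℕ, 0 ≤ C ∧ ∀ q : ℕ, 1 ≤ q → ∀ s t : ℝ,
      CloseTo k (C * q ^ N * |s - t|) (conjRot (H q) s) (conjRot (H q) t) := by
  obtain ⟨C, N, hC, h⟩ := exists_conjRot_sub_bound h1 h2 k
  refine ⟨C, N, hC, fun q hq s t i hi z => ⟨h q hq i hi s t z, ?_⟩⟩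
  have e (r : ℝ) : (conjRot (H q) r).1.symm = (conjRot (H q) (-r)).1 := by
    rw [← conjRot_inv]
    rfl
  rw [e, e]
  refine (h q hq i hi (-s) (-t) z).trans (le_of_eq ?_)
  rw [← abs_neg (s - t)]
  congr 2
  ring

/-! ### Limits of sequences of maps -/

/-- The order `n + K` of control grows with `n`. For each `n` the tail series `S n` converges in
`C^(n+K)`, and the limit is `u n + S n` for every `n`, hence smooth. Halving sums the errors to `2 *
e n`. -/
theorem exists_contDiff_limit {u : ℕ → ℝ × ℝ → ℝ × ℝ} (hu : ∀ n, ContDiff ℝ ∞ (u n)) {e : ℕ → ℝ}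
    (he : ∀ n, e (n + 1) ≤ e n / 2) {K : ℕ}
    (h : ∀ n, ∀ i ≤ n + K, ∀ z, ‖iteratedFDeriv ℝ i (fun w => u (n + 1) w - u n w) z‖ ≤ e n) :
    ∃ U : ℝ × ℝ → ℝ × ℝ, ContDiff ℝ ∞ U ∧
      ∀ n, ∀ i ≤ n + K, ∀ z, ‖iteratedFDeriv ℝ i (fun w => U w - u n w) z‖ ≤ 2 * e n := by
  have hdecay : ∀ n j, e (n + j) ≤ e n * (1 / 2) ^ j := by
    intro n j
    induction j with
    | zero => simp
    | succ j ih =>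
      rw [← add_assoc, pow_succ]
      linarith [he (n + j)]
  have hgeo : ∀ n, HasSum (fun j => e n * (1 / 2 : ℝ) ^ j) (2 * e n) := by
    intro n
    have := (hasSum_geometric_of_lt_one (by norm_num) (by norm_num : (1 / 2 : ℝ) < 1)).mul_left
      (e n)
    norm_num at this
    rw [mul_comm]
    norm_num
    exact this
  set g : ℕ → ℕ → ℝ × ℝ → ℝ × ℝ := fun n j w => u (n + j + 1) w - u (n + j) w with hg
  have hgs : ∀ n j, ContDiff ℝ ∞ (g n j) := fun n j => (hu _).sub (hu _)
  have hgb : ∀ n j i, i ≤ n + K → ∀ z, ‖iteratedFDeriv ℝ i (g n j) z‖ ≤ e n * (1 / 2) ^ j :=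
    fun n j i hi z => (h (n + j) i (by omega) z).trans (hdecay n j)
  set S : ℕ → ℝ × ℝ → ℝ × ℝ := fun n w => ∑' j, g n j w with hS
  have hsum : ∀ n w, Summable fun j => g n j w := fun n w => by
    refine Summable.of_norm_bounded (hgeo n).summable fun j => ?_
    have := hgb n j 0 (by omega) w
    rwa [norm_iteratedFDeriv_zero] at this
  have hlim : ∀ n w, Tendsto (fun j => u (n + j) w) atTop (𝓝 (u n w + S n w)) := by
    intro n w
    have h1 := (hsum n w).hasSum.tendsto_sum_nat
    have h2 : ∀ m, ∑ j ∈ Finset.range m, g n j w = u (n + m) w - u n w := fun m =>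
      Finset.sum_range_sub (fun j => u (n + j) w) m
    simp only [h2] at h1
    have := h1.const_add (u n w)
    simpa using this
  have heq : ∀ n w, u 0 w + S 0 w = u n w + S n w := by
    intro n w
    have h1 := hlim 0 w
    simp only [zero_add] at h1
    have h2 : Tendsto (fun j => u (n + j) w) atTop (𝓝 (u 0 w + S 0 w)) := by
      have := h1.comp (tendsto_add_atTop_nat n)
      simpa [Function.comp_def, add_comm] using this
    exact tendsto_nhds_unique h2 (hlim n w)
  have hSc : ∀ n, ContDiff ℝ ((n + K : ℕ) : ℕ∞) (S n) := fun n =>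
    contDiff_tsum (v := fun _ j => e n * (1 / 2 : ℝ) ^ j)
      (fun j => (hgs n j).of_le (by exact_mod_cast le_top)) (fun _ _ => (hgeo n).summable)
      fun i j z hi => hgb n j i (by exact_mod_cast hi) z
  refine ⟨fun w => u 0 w + S 0 w, ?_, fun n i hi z => ?_⟩
  · rw [contDiff_infty]
    intro n
    have e1 : (fun w => u 0 w + S 0 w) = fun w => u n w + S n w := funext (heq n)
    rw [e1]
    exact ((hu n).of_le (by exact_mod_cast le_top)).add
      ((hSc n).of_le (by exact_mod_cast Nat.le_add_right n K))
  · have e1 : (fun w => u 0 w + S 0 w - u n w) = S n := by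
      funext w
      rw [heq n w, add_sub_cancel_left]
    rw [e1, hS]
    simp only
    rw [iteratedFDeriv_tsum_apply (N := ((n + K : ℕ) : ℕ∞))
      (v := fun _ j => e n * (1 / 2 : ℝ) ^ j)
      (fun j => (hgs n j).of_le (by exact_mod_cast le_top)) (fun _ _ => (hgeo n).summable)
      (fun i j z hi => hgb n j i (by exact_mod_cast hi) z) (by exact_mod_cast hi) z]
    exact tsum_of_norm_bounded (hgeo n) fun j => hgb n j i hi z

theorem tendsto_zero_of_halving {e : ℕ → ℝ} (he0 : ∀ n, 0 < e n)
    (he : ∀ n, e (n + 1) ≤ e n / 2) : Tendsto e atTop (𝓝 0) := by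
  have hdecay : ∀ j, e j ≤ e 0 * (1 / 2) ^ j := by
    intro j
    induction j with
    | zero => simp
    | succ j ih =>
      rw [pow_succ]
      linarith [he j]
  refine squeeze_zero (fun n => (he0 n).le) hdecay ?_
  have := (tendsto_pow_atTop_nhds_zero_of_lt_one (by norm_num) (by norm_num : (1 / 2 : ℝ) < 1)).const_mul
    (e 0)
  simpa using this

/-- Inverses are controlled too, and the two limits are inverse to each other because the
convergence is uniform. The equivariance hypothesis has no shear, so it passes to the limit. -/
theorem exists_cover_limit {F : ℕ → coverGroup}
    (hF : ∀ n (z : ℝ × ℝ) (m k : ℤ), (F n).1 (z + ((m : ℝ), (k : ℝ))) = (F n).1 z + ((m : ℝ), (k : ℝ)))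
    {e : ℕ → ℝ} (he0 : ∀ n, 0 < e n) (he : ∀ n, e (n + 1) ≤ e n / 2) {K : ℕ}
    (h : ∀ n, CloseTo (n + K) (e n) (F (n + 1)) (F n)) :
    ∃ G : coverGroup, ∀ n, CloseTo (n + K) (2 * e n) G (F n) := by
  obtain ⟨U, hU, hU'⟩ := exists_contDiff_limit (u := fun n => (F n).1)
    (fun n => (F n).2.1.contDiff) he (fun n i hi z => (h n i hi z).1)
  obtain ⟨V, hV, hV'⟩ := exists_contDiff_limit (u := fun n => (F n).1.symm)
    (fun n => (F n).2.2.contDiff) he (fun n i hi z => (h n i hi z).2)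
  have het := (tendsto_zero_of_halving he0 he).const_mul 2
  rw [mul_zero] at het
  have hUn : ∀ n z, ‖U z - (F n).1 z‖ ≤ 2 * e n := fun n z => by
    have := hU' n 0 (by omega) z
    rwa [norm_iteratedFDeriv_zero] at this
  have hVn : ∀ n z, ‖V z - (F n).1.symm z‖ ≤ 2 * e n := fun n z => by
    have := hV' n 0 (by omega) z
    rwa [norm_iteratedFDeriv_zero] at this
  have hUt : ∀ z, Tendsto (fun n => (F n).1 z) atTop (𝓝 (U z)) := fun z => by
    rw [tendsto_iff_norm_sub_tendsto_zero]
    refine squeeze_zero (fun _ => norm_nonneg _) (fun n => ?_) het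
    rw [norm_sub_rev]
    exact hUn n z
  have hVt : ∀ z, Tendsto (fun n => (F n).1.symm z) atTop (𝓝 (V z)) := fun z => by
    rw [tendsto_iff_norm_sub_tendsto_zero]
    refine squeeze_zero (fun _ => norm_nonneg _) (fun n => ?_) het
    rw [norm_sub_rev]
    exact hVn n z
  have hUV : ∀ z, U (V z) = z := fun z => by
    have h1 : Tendsto (fun n => U ((F n).1.symm z)) atTop (𝓝 (U (V z))) :=
      (hU.continuous.tendsto _).comp (hVt z)
    have h2 : Tendsto (fun n => U ((F n).1.symm z)) atTop (𝓝 z) := by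
      rw [tendsto_iff_norm_sub_tendsto_zero]
      refine squeeze_zero (fun _ => norm_nonneg _) (fun n => ?_) het
      have := hUn n ((F n).1.symm z)
      rwa [Equiv.apply_symm_apply] at this
    exact tendsto_nhds_unique h1 h2
  have hVU : ∀ z, V (U z) = z := fun z => by
    have h1 : Tendsto (fun n => V ((F n).1 z)) atTop (𝓝 (V (U z))) :=
      (hV.continuous.tendsto _).comp (hUt z)
    have h2 : Tendsto (fun n => V ((F n).1 z)) atTop (𝓝 z) := by
      rw [tendsto_iff_norm_sub_tendsto_zero]
      refine squeeze_zero (fun _ => norm_nonneg _) (fun n => ?_) het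
      have := hVn n ((F n).1 z)
      rwa [Equiv.symm_apply_apply] at this
    exact tendsto_nhds_unique h1 h2
  have hUe : ∀ (z : ℝ × ℝ) (m k : ℤ), U (z + ((m : ℝ), (k : ℝ))) = U z + ((m : ℝ), (k : ℝ)) := by
    intro z m k
    have h1 := hUt (z + ((m : ℝ), (k : ℝ)))
    simp only [hF] at h1
    exact tendsto_nhds_unique h1 ((hUt z).add_const _)
  have hVe : ∀ (z : ℝ × ℝ) (m k : ℤ), V (z + ((m : ℝ), (k : ℝ))) = V z + ((m : ℝ), (k : ℝ)) := by
    intro z m k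
    have h1 := hUe (V z) m k
    rw [hUV] at h1
    rw [← h1, hVU]
  have cU : IsCover U :=
    { contDiff := hU
      strip := fun z hz => isClosed_Icc.mem_of_tendsto ((continuous_snd.tendsto _).comp (hUt z))
        (Eventually.of_forall fun n => (F n).2.1.strip z hz)
      equivariant := ⟨0, fun z m k => by simpa using hUe z m k⟩ }
  have cV : IsCover V :=
    { contDiff := hV
      strip := fun z hz => isClosed_Icc.mem_of_tendsto ((continuous_snd.tendsto _).comp (hVt z))
        (Eventually.of_forall fun n => (F n).2.2.strip z hz)
      equivariant := ⟨0, fun z m k => by simpa using hVe z m k⟩ }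
  exact ⟨⟨⟨U, V, hVU, hUV⟩, cU, cV⟩, fun n i hi z => ⟨hU' n i hi z, hV' n i hi z⟩⟩

/-- Integrals of bounded continuous functions pass to the limit by dominated convergence, and they
determine a finite measure. -/
theorem torusPreserving_of_tendsto {F : ℕ → coverGroup} (hF : ∀ n, TorusPreserving (F n))
    {G : coverGroup} (h : ∀ z, Tendsto (fun n => (F n).1 z) atTop (𝓝 (G.1 z))) :
    TorusPreserving G := by
  refine ⟨(continuous_torusMap G).measurable, ?_⟩
  have : IsFiniteMeasure (Measure.map (torusMap G) volume) :=
    Measure.isFiniteMeasure_map _ _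
  refine ext_of_forall_integral_eq_of_IsFiniteMeasure fun f => ?_
  rw [integral_map (continuous_torusMap G).measurable.aemeasurable
    f.continuous.aestronglyMeasurable]
  have h1 : Tendsto (fun n => ∫ x, f (torusMap (F n) x)) atTop (𝓝 (∫ x, f (torusMap G x))) := by
    refine tendsto_integral_of_dominated_convergence (fun _ => ‖f‖) (fun n => ?_)
      (integrable_const _) (fun n => Eventually.of_forall fun x => f.norm_coe_le_norm _)
      (Eventually.of_forall fun x => ?_)
    · exact (f.continuous.comp (continuous_torusMap (F n))).aestronglyMeasurable
    · obtain ⟨z, rfl⟩ := torusProj_surjective x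
      simp only [torusMap_torusProj]
      exact ((f.continuous.comp continuous_torusProj).tendsto _).comp (h z)
  simp only [fun n => (hF n).integral_comp f.continuous] at h1
  exact tendsto_nhds_unique h1 tendsto_const_nhds

/-! ### Liouville approximation -/

theorem exists_liouville_approx {α : ℝ} (hα : Liouville α) (N : ℕ) {C η : ℝ}
    (hη : 0 < η) (q₀ : ℕ) :
    ∃ a : ℚ, q₀ ≤ a.den ∧ C * a.den ^ N * |α - a| ≤ η ∧ |α - a| ≤ η := by
  -- Rationals with denominator at most `q₀` stay at distance at least `c` from `α`; an
  -- approximation closer than `c` has a large reduced denominator.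
  obtain ⟨c, hc0, hc⟩ : ∃ c > 0, ∀ r : ℚ, r.den ≤ q₀ → c ≤ dist α r := by
    have h1 := hα.irrational.eventually_forall_le_dist_cast_rat_of_den_le q₀
    have h2 := (h1.filter_mono nhdsWithin_le_nhds).and (self_mem_nhdsWithin (s := Ioi (0 : ℝ)))
    obtain ⟨c, hc, hc0⟩ := h2.exists
    exact ⟨c, hc0, hc⟩
  set κ := min c (η / (|C| + 1)) with hκ
  have hκ0 : 0 < κ := by positivity
  obtain ⟨k, hk⟩ := exists_pow_lt_of_lt_one hκ0 (by norm_num : (1 / 2 : ℝ) < 1)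
  -- Of the exponent `N + k`, the part `N` absorbs the polynomial factor and the part `k` gives
  -- smallness through `b ≥ 2`. The fraction may be reducible, but reduction only lowers the
  -- denominator.
  obtain ⟨a, b, hb, -, hab⟩ := hα (N + k)
  set r : ℚ := (a : ℚ) / b with hr
  have hrr : (r : ℝ) = a / b := by rw [hr]; push_cast; rfl
  rw [← hrr] at hab
  have hb0 : 0 < b := by omega
  have hden : (r.den : ℤ) ∣ b := by
    rw [hr, ← Rat.divInt_eq_div]
    exact Rat.den_dvd a b
  have hle : (r.den : ℤ) ≤ b := Int.le_of_dvd hb0 hden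
  have hle' : (r.den : ℝ) ≤ b := by exact_mod_cast hle
  have hb2 : (2 : ℝ) ≤ b := by exact_mod_cast hb
  have hd1 : (1 : ℝ) ≤ r.den := by exact_mod_cast r.pos
  have hbk : 1 / (b : ℝ) ^ k ≤ κ := by
    have : 1 / (b : ℝ) ^ k ≤ (1 / 2) ^ k := by
      rw [div_pow, one_pow]
      exact one_div_le_one_div_of_le (by positivity) (pow_le_pow_left₀ (by norm_num) hb2 k)
    linarith
  have hmain : (r.den : ℝ) ^ N * |α - r| ≤ κ := by
    have h1 : (r.den : ℝ) ^ N * |α - r| ≤ (b : ℝ) ^ N * (1 / (b : ℝ) ^ (N + k)) :=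
      mul_le_mul (pow_le_pow_left₀ (by positivity) hle' N) hab.le (abs_nonneg _) (by positivity)
    refine h1.trans (le_trans (le_of_eq ?_) hbk)
    rw [pow_add]
    field_simp
  have hmain2 : |α - r| ≤ κ := by
    refine le_trans ?_ hmain
    exact le_mul_of_one_le_left (abs_nonneg _) (one_le_pow₀ hd1)
  have hκη : κ ≤ η / (|C| + 1) := min_le_right _ _
  have hκη2 : (|C| + 1) * κ ≤ η := by
    rwa [le_div_iff₀ (by positivity), mul_comm] at hκη
  have hC0 := abs_nonneg C
  refine ⟨r, ?_, ?_, ?_⟩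
  · by_contra hlt
    have h1 := hc r (by omega)
    rw [Real.dist_eq] at h1
    have h2 : |α - r| < c := by
      have hbk2 : 1 / (b : ℝ) ^ (N + k) ≤ 1 / (b : ℝ) ^ k :=
        one_div_le_one_div_of_le (by positivity)
          (pow_le_pow_right₀ (by linarith) (Nat.le_add_left k N))
      exact hab.trans_le (hbk2.trans (hbk.trans (min_le_left _ _)))
    linarith
  · rw [mul_assoc]
    have h1 := mul_le_mul_of_nonneg_right (le_abs_self C)
      (by positivity : 0 ≤ (r.den : ℝ) ^ N * |α - r|)
    have h2 := mul_le_mul_of_nonneg_left hmain hC0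
    linarith
  · nlinarith

/-! ### The inductive step -/

/-- The linear shear of the plane. -/
noncomputable def shearCLM (B : ℤ) : ℝ × ℝ →L[ℝ] ℝ × ℝ :=
  (ContinuousLinearMap.fst ℝ ℝ ℝ + (B : ℝ) • ContinuousLinearMap.snd ℝ ℝ ℝ).prod
    (ContinuousLinearMap.snd ℝ ℝ ℝ)

theorem shearCLM_apply (B : ℤ) (z : ℝ × ℝ) : shearCLM B z = (z.1 + B * z.2, z.2) := rfl

theorem norm_shearCLM_le (B : ℤ) : ‖shearCLM B‖ ≤ 1 + |(B : ℝ)| := by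
  refine ContinuousLinearMap.opNorm_le_bound _ (by positivity) fun z => ?_
  rw [shearCLM_apply]
  have h1 := norm_fst_le z
  have h2 := norm_snd_le z
  have h0 := norm_nonneg z
  refine max_le ?_ ?_
  · refine (norm_add_le _ _).trans ?_
    rw [norm_mul, Real.norm_eq_abs (B : ℝ), add_mul, one_mul]
    exact add_le_add h1 (mul_le_mul_of_nonneg_left h2 (abs_nonneg _))
  · refine h2.trans (le_mul_of_one_le_left h0 ?_)
    linarith [abs_nonneg (B : ℝ)]

theorem polyBounded_shear_twist (H : coverGroup) {κ : ℝ} (hκ : 0 < κ) {B : ℕ → ℤ} {C : ℝ}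
    {N : ℕ} (hB : ∀ q : ℕ, 1 ≤ q → 1 + |(B q : ℝ)| ≤ C * q ^ N) :
    (PolyBounded fun q => (H * (affineCover (B q) 0 * twistCover hκ q)).1) ∧
      PolyBounded fun q => (H * (affineCover (B q) 0 * twistCover hκ q)).1.symm := by
  have h1 : PolyBounded fun q => shearCLM (B q) :=
    polyBounded_clm fun q hq => (norm_shearCLM_le _).trans (hB q hq)
  have h2 : PolyBounded fun q => shearCLM (-B q) :=
    polyBounded_clm fun q hq => (norm_shearCLM_le _).trans (by simpa using hB q hq)
  constructor
  · convert H.2.1.polyBounded.comp (h1.comp (polyBounded_conj_dilation hκ 1)) using 2 with q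
    funext z
    change H.1 ((affineCover (B q) 0).1 ((twistCover hκ q).1 z)) = H.1 (shearCLM (B q) _)
    rw [affineCover_apply, shearCLM_apply, add_zero]
    rfl
  · convert (polyBounded_conj_dilation hκ (-1)).comp (h2.comp H.2.2.polyBounded) using 2 with q
    funext z
    change contraction q (cellTwist κ (-1) (dilation q ((affineCover (B q) 0).1.symm (H.1.symm z))))
      = contraction q (cellTwist κ (-1) (dilation q (shearCLM (-B q) (H.1.symm z))))
    congr 3
    rw [shearCLM_apply]
    change ((H.1.symm z).1 + ((-B q : ℤ) : ℝ) * (H.1.symm z).2 + -0, (H.1.symm z).2) = _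
    rw [neg_zero, add_zero]

theorem one_add_abs_floor_le {σ : ℝ} (hσ : σ < 1) (n : ℕ) {q : ℕ} (hq : 1 ≤ q) :
    1 + |(⌊((n : ℝ)) * (q : ℝ) ^ σ⌋ : ℝ)| ≤ (1 + n : ℝ) * q ^ 1 := by
  have hq1 : (1 : ℝ) ≤ q := by exact_mod_cast hq
  have h0 : 0 ≤ (n : ℝ) * (q : ℝ) ^ σ := by positivity
  have h1 : (q : ℝ) ^ σ ≤ q := by
    simpa using Real.rpow_le_rpow_of_exponent_le hq1 hσ.le
  have h2 : (0 : ℝ) ≤ ⌊(n : ℝ) * (q : ℝ) ^ σ⌋ := by exact_mod_cast Int.floor_nonneg.2 h0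
  rw [abs_of_nonneg h2, pow_one, add_mul, one_mul]
  exact add_le_add hq1 ((Int.floor_le _).trans (mul_le_mul_of_nonneg_left h1 (by positivity)))

theorem eventually_le_floor {σ : ℝ} (hσ : 0 < σ) {n : ℕ} (hn : 1 ≤ n) (N : ℕ) :
    ∃ q₀ : ℕ, ∀ q : ℕ, q₀ ≤ q → (N : ℤ) ≤ ⌊(n : ℝ) * (q : ℝ) ^ σ⌋ := by
  have h := ((tendsto_rpow_atTop hσ).comp tendsto_natCast_atTop_atTop).eventually_ge_atTop (N : ℝ)
  obtain ⟨q₀, hq⟩ := eventually_atTop.1 h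
  refine ⟨q₀, fun q h => Int.le_floor.2 ?_⟩
  have h1 : (N : ℝ) ≤ (q : ℝ) ^ σ := hq q h
  have hn1 : (1 : ℝ) ≤ n := by exact_mod_cast hn
  exact h1.trans (le_mul_of_one_le_left (by positivity) hn1)

/-- The order of choices matters: `κ` and `N` depend on `w` and `H`, the polynomial bounds then hold
for all `q` at once, the rational is chosen against these bounds, and the tolerance `e'` comes last
since it depends on the denominator. -/
theorem exists_conjugation_step {σ : ℝ} (hσ0 : 0 < σ) (hσ1 : σ < 1) {α : ℝ} (hα : Liouville α)
    (n k : ℕ) (hn : 1 ≤ n) (w : C(Torus, ℂ)) {H : coverGroup} (hH : TorusPreserving H) {e : ℝ}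
    (he : 0 < e) (a : ℚ) :
    ∃ (a' : ℚ) (P : coverGroup) (e' : ℝ), TorusPreserving P ∧
      rotCover (1 / (a'.den : ℝ)) * P = P * rotCover (1 / (a'.den : ℝ)) ∧
      |α - a'| ≤ |α - a| ∧ |α - a'| ≤ e ∧
      CloseTo k e (conjRot H a') (conjRot H α) ∧
      CloseTo k e
        (conjRot (H * (affineCover ⌊(n : ℝ) * (a'.den : ℝ) ^ σ⌋ 0 * P)) α) (conjRot H α) ∧
      0 < e' ∧ e' ≤ e / 2 ∧ (NearUnimodular w → ∀ F : coverGroup,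
        (∀ z, ‖F.1 z -
          (conjRot (H * (affineCover ⌊(n : ℝ) * (a'.den : ℝ) ^ σ⌋ 0 * P)) α).1 z‖ ≤ 2 * e') →
        Mixes w F) := by
  obtain ⟨κ, hκ, N, hN⟩ : ∃ (κ : ℝ) (hκ : 0 < κ) (N : ℕ), ∀ q : ℕ, N ≤ q →
      ∀ B : ℤ, (N : ℤ) ≤ B → ∃ η > 0, NearUnimodular w → ∀ F : coverGroup,
        (∀ z, ‖F.1 z - (conjRot (H * (affineCover B 0 * twistCover hκ q)) α).1 z‖ ≤ η) →
        Mixes w F := by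
    by_cases hw : NearUnimodular w
    · obtain ⟨κ, hκ, N, h⟩ := exists_mixes hα.irrational hw hH
      refine ⟨κ, hκ, N, fun q hq B hB => ?_⟩
      obtain ⟨η, hη, h'⟩ := h q hq B hB
      exact ⟨η, hη, fun _ => h'⟩
    · exact ⟨1, one_pos, 0, fun q _ B _ => ⟨1, one_pos, fun h => absurd h hw⟩⟩
  obtain ⟨q₀, hq₀⟩ := eventually_le_floor hσ0 hn N
  obtain ⟨hp1, hp2⟩ := polyBounded_shear_twist H hκ
    (B := fun q => ⌊(n : ℝ) * (q : ℝ) ^ σ⌋) fun q hq => one_add_abs_floor_le hσ1 n hq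
  obtain ⟨C, m, hC, hclose⟩ := exists_closeTo_conjRot hp1 hp2 k
  obtain ⟨C', m', hC', hclose'⟩ :=
    exists_closeTo_conjRot (H := fun _ => H) H.2.1.polyBounded H.2.2.polyBounded k
  -- Using this gap as a target accuracy makes the approximation errors non-increasing.
  have hgap : 0 < |α - a| :=
    abs_pos.2 (sub_ne_zero.2 fun h => hα.irrational ⟨a, h.symm⟩)
  obtain ⟨a', hden, hb, hb'⟩ := exists_liouville_approx (C := C + C') hα (m + m')
    (lt_min (half_pos he) hgap) (max N q₀)
  have hq1 : 1 ≤ a'.den := a'.pos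
  have hq1' : (1 : ℝ) ≤ a'.den := by exact_mod_cast hq1
  have hbe := hb.trans (min_le_left _ _)
  have hsmall : ∀ D : ℝ, ∀ j ≤ m + m', 0 ≤ D → D ≤ C + C' →
      D * (a'.den : ℝ) ^ j * |α - a'| ≤ e / 2 := fun D j hj hD hDC =>
    (mul_le_mul_of_nonneg_right (mul_le_mul hDC (pow_le_pow_right₀ hq1' hj) (by positivity)
      (by positivity)) (abs_nonneg _)).trans hbe
  obtain ⟨η, hη, hmix⟩ := hN a'.den (le_of_max_le_left hden) _
    (hq₀ a'.den (le_of_max_le_right hden))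
  have hnum : (a' : ℝ) = (a'.num : ℝ) / (a'.den : ℝ) := by exact_mod_cast (Rat.num_div_den a').symm
  have hcomm : rotCover (a' : ℝ) *
      (affineCover ⌊(n : ℝ) * (a'.den : ℝ) ^ σ⌋ 0 * twistCover hκ a'.den) =
      (affineCover ⌊(n : ℝ) * (a'.den : ℝ) ^ σ⌋ 0 * twistCover hκ a'.den) *
        rotCover (a' : ℝ) := by
    rw [← mul_assoc, affineCover_commute_rot, mul_assoc, hnum, twistCover_commute hκ hq1, mul_assoc]
  have h1 : CloseTo k (e / 2) (conjRot H a') (conjRot H α) :=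
    (((hclose' a'.den hq1 α a').symm).mono le_rfl
      (hsmall C' m' (Nat.le_add_left _ _) hC' (by linarith)))
  -- The conjugate of the rotation by `a'` is common to the old and the new conjugacy, so it bridges
  -- the two conjugates of the rotation by `α`.
  have h2 : CloseTo k (e / 2)
      (conjRot (H * (affineCover ⌊(n : ℝ) * (a'.den : ℝ) ^ σ⌋ 0 * twistCover hκ a'.den)) α)
      (conjRot H a') := by
    rw [← conjRot_mul_of_commute hcomm]
    exact (hclose a'.den hq1 α a').mono le_rfl
      (hsmall C m (Nat.le_add_right _ _) hC (by linarith))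
  refine ⟨a', twistCover hκ a'.den, min (e / 2) (η / 2), torusPreserving_twistCover hκ _, ?_,
    hb'.trans (min_le_right _ _), ?_, h1.mono le_rfl (by linarith), ?_,
    lt_min (half_pos he) (half_pos hη), min_le_left _ _, fun hw F hF => hmix hw F fun z => ?_⟩
  · simpa using twistCover_commute hκ hq1 1
  · linarith [hb'.trans (min_le_left _ _)]
  · simpa using h2.trans h1
  · refine (hF z).trans ?_
    linarith [min_le_right (e / 2) (η / 2)]

/-- The data produced by the inductive construction. -/
theorem exists_conjugation_sequence {σ : ℝ} (hσ0 : 0 < σ) (hσ1 : σ < 1) {α : ℝ} (hα : Liouville α)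
    (K : ℕ) {e₀ : ℝ} (he₀ : 0 < e₀) (w : ℕ → C(Torus, ℂ)) :
    ∃ (a : ℕ → ℚ) (P H : ℕ → coverGroup) (e : ℕ → ℝ), e 0 = e₀ ∧ H 0 = 1 ∧
      (∀ n, H (n + 1) = H n *
        (affineCover ⌊((n + 1 : ℕ) : ℝ) * ((a (n + 1)).den : ℝ) ^ σ⌋ 0 * P (n + 1))) ∧
      (∀ n, 0 < e n) ∧ (∀ n, e (n + 1) ≤ e n / 2) ∧
      (∀ n, TorusPreserving (P n)) ∧ (∀ n, TorusPreserving (H n)) ∧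
      (∀ n, rotCover (1 / ((a n).den : ℝ)) * P n = P n * rotCover (1 / ((a n).den : ℝ))) ∧
      (∀ n, |α - a (n + 1)| ≤ |α - a n|) ∧ (∀ n, |α - a (n + 1)| ≤ e n) ∧
      (∀ n, CloseTo (n + K) (e n) (conjRot (H n) (a (n + 1))) (conjRot (H n) α)) ∧
      (∀ n, CloseTo (n + K) (e n) (conjRot (H (n + 1)) α) (conjRot (H n) α)) ∧
      ∀ n, NearUnimodular (w n) → ∀ F : coverGroup,
        (∀ z, ‖F.1 z - (conjRot (H (n + 1)) α).1 z‖ ≤ 2 * e (n + 1)) → Mixes (w n) F := by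
  let State := {s : coverGroup × ℝ × ℚ // TorusPreserving s.1 ∧ 0 < s.2.1}
  choose a' P' e' hP hc ha hae hca hcc he'0 he' hmix using fun (n : ℕ) (s : State) =>
    exists_conjugation_step hσ0 hσ1 hα (n + 1) (n + K) (Nat.succ_pos n) (w n) s.2.1 s.2.2 s.1.2.2
  let next : ℕ → State → State := fun n s =>
    ⟨(s.1.1 * (affineCover ⌊((n + 1 : ℕ) : ℝ) * ((a' n s).den : ℝ) ^ σ⌋ 0 * P' n s),
      e' n s, a' n s), s.2.1.mul ((torusPreserving_affineCover _ _).mul (hP n s)), he'0 n s⟩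
  let S : ℕ → State := fun n =>
    Nat.rec ⟨(1, e₀, 0), torusPreserving_one, he₀⟩ (fun n s => next n s) n
  -- The entries `a 0 = 0` and `P 0 = 1` are placeholders; the recursion for `H` uses indices from
  -- `1` on.
  refine ⟨fun n => (S n).1.2.2, fun n => Nat.casesOn n 1 fun n => P' n (S n), fun n => (S n).1.1,
    fun n => (S n).1.2.1, rfl, rfl, fun n => rfl, fun n => (S n).2.2, fun n => he' n (S n),
    fun n => ?_, fun n => (S n).2.1, fun n => ?_, fun n => ha n (S n), fun n => hae n (S n),
    fun n => hca n (S n), fun n => hcc n (S n), fun n => hmix n (S n)⟩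
  · cases n with
    | zero => exact torusPreserving_one
    | succ n => exact hP n (S n)
  · cases n with
    | zero => exact (mul_one _).trans (one_mul _).symm
    | succ n => exact hc n (S n)

end AbC

/-! ### Assembly of the limit diffeomorphism. -/

theorem theorem3 (M : AbC.Surface) (σ : ℝ) (hσ0 : 0 < σ) (hσ1 : σ < 1)
    (α : ℝ) (hα : Liouville α) (ε : ℝ) (hε : 0 < ε) :
    ∃ (a : ℕ → ℚ) (φ : ℕ → AbC.Diff M) (f : AbC.Diff M),
      Tendsto (fun n => (a n : ℝ)) atTop (𝓝 α) ∧
      Antitone (fun n => |α - (a n : ℝ)|) ∧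
      (∀ n, (φ n).AreaPreserving) ∧
      (∀ n, AbC.rot M (1 / ((a n).den : ℝ)) * φ n = φ n * AbC.rot M (1 / ((a n).den : ℝ))) ∧
      AbC.Diff.TendstoInfty (AbC.approx M σ a φ) f ∧
      f.WeakMixing ∧
      f ∈ AbC.rotClosure M α ∧
      f.distInfty (AbC.rot M α) < ε := by
  obtain ⟨w, hw1, hw⟩ := AbC.exists_dense_unimodular
  obtain ⟨K, e₀, he₀, hdist⟩ := AbC.exists_distInfty_lt M hε
  -- Starting from half of `e₀` makes the limit `2 * (e₀ / 2)`-close to the initial conjugate, which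
  -- is the rotation itself.
  obtain ⟨a, P, H, e, h0, hH0, hHs, he0, he, hPt, hHt, hPc, hmono, hae, hca, hcc, hmix⟩ :=
    AbC.exists_conjugation_sequence hσ0 hσ1 hα K (half_pos he₀) w
  obtain ⟨G, hG⟩ := AbC.exists_cover_limit (F := fun n => AbC.conjRot (H n) α)
    (fun n => AbC.conjRot_equivariant (H n) α) he0 he hcc
  have het := AbC.tendsto_zero_of_halving he0 he
  have hconj : ∀ n, AbC.conjDiff M σ a (fun n => AbC.desc M (P n)) n = AbC.desc M (H n) := by
    intro n
    induction n with
    | zero => rw [hH0, map_one]; rfl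
    | succ n ih =>
      rw [hHs, map_mul, map_mul, AbC.desc_affineCover, ← ih]
      rfl
  have hrot : ∀ n t, AbC.desc M (AbC.conjRot (H n) t) =
      AbC.desc M (H n) * AbC.rot M t * (AbC.desc M (H n))⁻¹ := fun n t => by
    rw [AbC.conjRot, map_mul, map_mul, map_inv, AbC.desc_rotCover]
  have hGt : AbC.TorusPreserving G := by
    refine AbC.torusPreserving_of_tendsto (F := fun n => AbC.conjRot (H n) α)
      (fun n => (hHt n).conjRot α) fun z => ?_
    rw [tendsto_iff_norm_sub_tendsto_zero]
    refine squeeze_zero (fun _ => norm_nonneg _) (fun n => (hG n).symm.norm_sub_le z) ?_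
    simpa using het.const_mul 2
  refine ⟨a, fun n => AbC.desc M (P n), AbC.desc M G, ?_, antitone_nat_of_succ_le hmono,
    fun n => (hPt n).areaPreserving M, fun n => ?_, fun k => ?_, ?_, ?_, ?_⟩
  · rw [← tendsto_add_atTop_iff_nat 1, tendsto_iff_dist_tendsto_zero]
    refine squeeze_zero (fun _ => dist_nonneg) (fun n => ?_) het
    rw [dist_comm, Real.dist_eq]
    exact hae n
  · rw [← AbC.desc_rotCover, ← map_mul, hPc, map_mul]
  -- From `f_n` to the conjugate of the rotation by `α` costs `e n`, and from there to the limit `2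
  -- * e n`.
  · have h3 := het.const_mul 3
    rw [mul_zero] at h3
    refine squeeze_zero' (Eventually.of_forall fun n => AbC.distC_nonneg k _ _) ?_ h3
    filter_upwards [eventually_ge_atTop k] with n hn
    rw [AbC.approx, hconj, ← hrot]
    exact (((hca n).trans (hG n).symm).mono (by omega) (by linarith)).distC_le M
  -- The limit lies within `2 * e (n + 1)` of the conjugate built at step `n`, exactly the tolerance
  -- under which `w n` keeps its mixing time.
  · refine AbC.weakMixing_desc hGt (AbC.torusEigenConst_of_unimodular hGt fun u c hu hu1 hc =>
      AbC.unimodular_eigen_const hGt hw1 hw (fun n hn => hmix n hn G fun z => ?_) hu hu1 hc) M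
    exact (hG (n + 1)).norm_sub_le z
  · intro δ hδ
    obtain ⟨L, d, hd, hL⟩ := AbC.exists_distInfty_lt M hδ
    have h2 : Tendsto (fun n => 2 * e n) atTop (𝓝 0) := by simpa using het.const_mul 2
    obtain ⟨n, hn1, hn2⟩ :=
      ((h2.eventually_lt_const hd).and (eventually_ge_atTop L)).exists
    refine ⟨AbC.desc M (H n), (hHt n).areaPreserving M, ?_⟩
    rw [← hrot]
    exact hL _ _ fun k hk => ((hG n).mono (by omega) hn1.le).distC_le M
  · have h1 : AbC.conjRot (H 0) α = AbC.rotCover α := by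
      rw [hH0, AbC.conjRot, one_mul, inv_one, mul_one]
    have h2 := hG 0
    simp only [h1, h0] at h2
    rw [← AbC.desc_rotCover]
    exact hdist _ _ fun k hk => (h2.mono (by omega) (by linarith)).distC_le M
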